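/- **Setting.** Let $Y_1,\dots,Y_n$ be i.i.d. with law $P$, $\Theta\subseteq\mathbb R^p$ convex, $\ell(y,\theta)$ a (quasi) log-density, $L(\theta)=\sum_{i=1}^n\ell(Y_i,\theta)$, $G$ a symmetric matrix and $L_G(\theta)=L(\theta)-\|G\theta\|^2/2$, $L_G(\theta,\theta')=L_G(\theta)-L_G(\theta')$. Let $\theta^*_G\in\Theta$ maximize $\mathbb E L_G$ over $\Theta$. Put $$\zeta_1(\theta)=\ell(Y_1,\theta)-\mathbb E\ell(Y_1,\theta),\quad \zeta(\theta)=L(\theta)-\mathbb EL(\theta),\quad F(\theta)=-\nabla^2\mathbb E\ell(Y_1,\theta),\quad D_G^2(\theta)=nF(\theta)+G^2,$$ let $D_G$ be the positive square root of $D_G^2=D_G^2(\theta^*_G)$, let $v_0$ be a symmetric positive definite matrix, and put $$\xi_G=D_G^{-1}\nabla\zeta(\theta^*_G),\quad B_G=D_G^{-1}\,(n v_0^2)\,D_G^{-1},\quad p_G=\operatorname{tr}B_G,\quad \Theta_{0,G}(r)=\{\theta\in\mathbb R^p:\|D_G(\theta-\theta^*_G)\|\le r\}.$$ **Conditions.**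 Fix constants $\nu_0\ge1$, $\mathtt g,\omega^*,\delta^*,a,u_0,K>0$ and a function $\mathtt b$, positive on $(0,\infty)$, with $u\,\mathtt b(u)/\log u\to\infty$ as $u\to\infty$. Suppose: * (regularity) $\ell(y,\cdot)$ and $\mathbb E\ell(Y_1,\cdot)$ are continuous on $\Theta$ and twice continuously differentiable in its interior $\Theta^\circ$; $\ell(\cdot,\theta)$ is measurable and $P$-integrable for $\theta\in\Theta$; $\Theta_{0,G}(u_0\sqrt n)\subseteq\Theta^\circ$; * (gradient) $\operatorname{Var}\{\nabla\zeta_1(\theta^*_G)\}\le v_0^2$, and $\log\mathbb E\exp\{\lambda\,\gamma^\top\nabla\zeta_1(\theta)/\|v_0\gamma\|\}\le\nu_0^2\lambda^2/2$ for all $\theta\in\Theta^\circ$, $\gamma\in\mathbb R^p\setminus\{0\}$, $|\lambda|\le\mathtt g$; * (Hessian) $\log\mathbb E\exp\bigl\{\frac{\lambda}{\omega^*}\frac{\gamma_1^\top\nabla^2\zeta_1(\theta)\gamma_2}{\|v_0\gamma_1\|\,\|v_0\gamma_2\|}\bigr\}\le\nu_0^2\lambda^2/2$ for all $\theta\in\Theta_{0,G}(u_0\sqrt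 n)$, $\gamma_1,\gamma_2\in\mathbb R^p\setminus\{0\}$, $|\lambda|\le\mathtt g$; * (local smoothness) $\|D_G^{-1}D_G^2(\theta)D_G^{-1}-I_p\|\le\delta^*u$ (operator norm) for $0<u\le u_0$, $\theta\in\Theta_{0,G}(u\sqrt n)$; * (identifiability) $n v_0^2\le a^2D_G^2$; * (global identification) $-2\,\mathbb E L_G(\theta,\theta^*_G)\ge\mathtt b(u)\,\|D_G(\theta-\theta^*_G)\|^2$ for all $u>0$, $\theta\in\Theta\cap\Theta_{0,G}(u\sqrt n)$. **Theorem.** There is a constant $C>0$ depending only on $\nu_0,\mathtt g,\omega^*,\delta^*,a,u_0,K$ and $\mathtt b$ (not on $n$, $p$, $G$ or the model) such that, whenever the above conditions hold and $x>0$ satisfies $$p_G+x\le Kn,\qquad \operatorname{tr}\bigl(B_G^{1/2}\bigr)\le K\sqrt{n\,(p_G+x)}$$ (after adjusting $K$, both hold whenever $p+x\le Kn$), there is an event of probability at least $1-2e^{-x}$ on which every maximizer $\tilde\theta_G$ of $L_G$ over $\Theta$ satisfies $$\bigl\|D_G(\tilde\theta_G-\theta^*_G)-\xi_G\bigr\|\le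 C\sqrt{(p_G+x)^2/n},$$ $$\Bigl|\sqrt{2L_G(\tilde\theta_G,\theta^*_G)}-\|\xi_G\|\Bigr|\le C\sqrt{(p_G+x)^2/n},$$ $$\Bigl|2L_G(\tilde\theta_G,\theta^*_G)-\|\xi_G\|^2\Bigr|\le C\sqrt{(p_G+x)^3/n}.$$ In particular this holds with $x=x_n\to\infty$, e.g. $x_n=\log n$, for models, $p$ and $G$ that vary with $n$. -/

import Mathlib

open Real Set Filter Topology MeasureTheory ProbabilityTheory
open scoped MatrixOrder

noncomputable section

namespace PenML

/-- The Euclidean space `ℝᵖ` carrying the parameter. -/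
abbrev Vec (p : ℕ) : Type := EuclideanSpace ℝ (Fin p)

/-- Real square matrices of size `p`. -/
abbrev Mat (p : ℕ) : Type := Matrix (Fin p) (Fin p) ℝ

/-- The matrix `M` as an operator on Euclidean `ℝᵖ`; its norm is the spectral norm of `M`. -/
def op {p : ℕ} (M : Mat p) : Vec p →L[ℝ] Vec p := Matrix.toEuclideanCLM (𝕜 := ℝ) M

/-- The Hessian matrix of `f` at `θ`. -/
def hess {p : ℕ} (f : Vec p → ℝ) (θ : Vec p) : Mat p :=
  Matrix.of fun i j => fderiv ℝ (fderiv ℝ f) θ (EuclideanSpace.single i 1) (EuclideanSpace.single j 1)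

/-- `log E exp(t X) ≤ ν² t² / 2` for `|t| ≤ g`, the exponential moments being finite.
(`cgf X P t` is `log E exp(t X)`.) -/
def ExpMoment {𝓨 : Type*} [MeasurableSpace 𝓨] (P : Measure 𝓨) (X : 𝓨 → ℝ) (ν g : ℝ) : Prop :=
  ∀ t : ℝ, |t| ≤ g → Integrable (fun y => exp (t * X y)) P ∧ cgf X P t ≤ ν ^ 2 * t ^ 2 / 2

section Model

variable {𝓨 : Type*} {p n : ℕ}

/-- The log-likelihood `L(θ) = ∑ᵢ ℓ(Yᵢ, θ)` of the sample `ys`. -/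
def logLik (ℓ : 𝓨 → Vec p → ℝ) (ys : Fin n → 𝓨) (θ : Vec p) : ℝ :=
  ∑ i, ℓ (ys i) θ

/-- The penalized log-likelihood `L_G(θ) = L(θ) - ‖G θ‖² / 2`. -/
def penLogLik (G : Mat p) (ℓ : 𝓨 → Vec p → ℝ) (ys : Fin n → 𝓨) (θ : Vec p) : ℝ :=
  logLik ℓ ys θ - ‖op G θ‖ ^ 2 / 2

variable [MeasurableSpace 𝓨]

/-- `E ℓ(Y₁, θ)`, where `Y₁` has law `P`. -/
def meanLogLik (P : Measure 𝓨) (ℓ : 𝓨 → Vec p → ℝ) (θ : Vec p) : ℝ :=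
  ∫ y, ℓ y θ ∂P

/-- `E L_G(θ) = n E ℓ(Y₁, θ) - ‖G θ‖² / 2`. -/
def meanPenLogLik (n : ℕ) (G : Mat p) (P : Measure 𝓨) (ℓ : 𝓨 → Vec p → ℝ) (θ : Vec p) : ℝ :=
  n * meanLogLik P ℓ θ - ‖op G θ‖ ^ 2 / 2

/-- The stochastic component `ζ₁(θ) = ℓ(y, θ) - E ℓ(Y₁, θ)` of one observation. -/
def zetaOne (P : Measure 𝓨) (ℓ : 𝓨 → Vec p → ℝ) (y : 𝓨) (θ : Vec p) : ℝ :=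
  ℓ y θ - meanLogLik P ℓ θ

/-- The stochastic component `ζ(θ) = L(θ) - E L(θ)` of the log-likelihood. -/
def zeta (P : Measure 𝓨) (ℓ : 𝓨 → Vec p → ℝ) (ys : Fin n → 𝓨) (θ : Vec p) : ℝ :=
  logLik ℓ ys θ - n * meanLogLik P ℓ θ

/-- `F(θ) = - ∇² E ℓ(Y₁, θ)`. -/
def fisherInfo (P : Measure 𝓨) (ℓ : 𝓨 → Vec p → ℝ) (θ : Vec p) : Mat p :=
  - hess (meanLogLik P ℓ) θ

/-- The penalized information matrix `D_G²(θ) = - ∇² E L_G(θ) = n F(θ) + G²`. -/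
def penInfo (n : ℕ) (G : Mat p) (P : Measure 𝓨) (ℓ : 𝓨 → Vec p → ℝ) (θ : Vec p) : Mat p :=
  (n : ℝ) • fisherInfo P ℓ θ + G * G

/-- `D_G`, the positive semidefinite square root of `D_G² = D_G²(θs)` (`θs` is the target). -/
def rootInfo (n : ℕ) (G : Mat p) (P : Measure 𝓨) (ℓ : 𝓨 → Vec p → ℝ) (θs : Vec p) : Mat p :=
  CFC.sqrt (penInfo n G P ℓ θs)

/-- `B_G = D_G⁻¹ V₀² D_G⁻¹` with `V₀² = n v₀²`. -/
def matB (n : ℕ) (G v₀ : Mat p) (P : Measure 𝓨) (ℓ : 𝓨 → Vec p → ℝ) (θs : Vec p) : Mat p :=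
  (rootInfo n G P ℓ θs)⁻¹ * ((n : ℝ) • (v₀ * v₀)) * (rootInfo n G P ℓ θs)⁻¹

/-- The effective dimension `p_G = tr B_G`. -/
def effDim (n : ℕ) (G v₀ : Mat p) (P : Measure 𝓨) (ℓ : 𝓨 → Vec p → ℝ) (θs : Vec p) : ℝ :=
  (matB n G v₀ P ℓ θs).trace

/-- The penalized entropy `tr (B_G ^ (1/2))`. -/
def penEntropy (n : ℕ) (G v₀ : Mat p) (P : Measure 𝓨) (ℓ : 𝓨 → Vec p → ℝ) (θs : Vec p) : ℝ :=
  (CFC.sqrt (matB n G v₀ P ℓ θs)).trace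

/-- The normalized score `ξ_G = D_G⁻¹ ∇ζ(θs)`. -/
def xiG (G : Mat p) (P : Measure 𝓨) (ℓ : 𝓨 → Vec p → ℝ) (θs : Vec p) (ys : Fin n → 𝓨) : Vec p :=
  op (rootInfo n G P ℓ θs)⁻¹ (gradient (zeta P ℓ ys) θs)

/-- The vicinity `Θ_{0,G}(r) = {θ : ‖D_G (θ - θs)‖ ≤ r}`. -/
def localSet (n : ℕ) (G : Mat p) (P : Measure 𝓨) (ℓ : 𝓨 → Vec p → ℝ) (θs : Vec p) (r : ℝ) :
    Set (Vec p) :=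
  {θ | ‖op (rootInfo n G P ℓ θs) (θ - θs)‖ ≤ r}

/-- The conditions on one observation (law `P`, quasi log-density `ℓ`), the parameter set `Θ`,
the penalty matrix `G`, the score normalization `v₀`, and the target `θs`.
A radius `r` and its rescaling `u` are related by `r = u √n`. -/
structure IIDConditions (Θ : Set (Vec p)) (P : Measure 𝓨) (ℓ : 𝓨 → Vec p → ℝ) (n : ℕ)
    (G v₀ : Mat p) (θs : Vec p) (ν g ω δ a u₀ : ℝ) (b : ℝ → ℝ) : Prop where
  convex : Convex ℝ Θ
  measurable : ∀ θ ∈ Θ, Measurable fun y => ℓ y θ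
  integrable : ∀ θ ∈ Θ, Integrable (fun y => ℓ y θ) P
  continuousOn : ∀ y, ContinuousOn (ℓ y) Θ
  contDiffOn : ∀ y, ContDiffOn ℝ 2 (ℓ y) (interior Θ)
  continuousOn_mean : ContinuousOn (meanLogLik P ℓ) Θ
  contDiffOn_mean : ContDiffOn ℝ 2 (meanLogLik P ℓ) (interior Θ)
  symm_penalty : G.IsSymm
  /-- the target maximizes `E L_G` over `Θ`, and a vicinity of it lies inside `Θ` -/
  target_mem : θs ∈ Θ
  target_max : IsMaxOn (meanPenLogLik n G P ℓ) Θ θs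
  local_subset : localSet n G P ℓ θs (u₀ * √n) ⊆ interior Θ
  /-- `v₀` is symmetric positive definite and `Var ∇ζ₁(θs) ≤ v₀²` -/
  posDef : v₀.PosDef
  var_le : ∀ γ : Vec p,
    Var[fun y => inner ℝ γ (gradient (zetaOne P ℓ y) θs); P] ≤ ‖op v₀ γ‖ ^ 2
  /-- exponential moments of the gradient `∇ζ₁(θ)` -/
  expMoment_grad : ∀ θ ∈ interior Θ, ∀ γ : Vec p,
    ExpMoment P (fun y => inner ℝ γ (gradient (zetaOne P ℓ y) θ) / ‖op v₀ γ‖) ν g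
  /-- exponential moments of the Hessian `∇²ζ₁(θ)` in the local zone -/
  expMoment_hess : ∀ θ ∈ localSet n G P ℓ θs (u₀ * √n), ∀ γ₁ γ₂ : Vec p,
    ExpMoment P (fun y => ω⁻¹ *
      (inner ℝ γ₁ (op (hess (zetaOne P ℓ y) θ) γ₂) / (‖op v₀ γ₁‖ * ‖op v₀ γ₂‖))) ν g
  /-- local smoothness: `‖D_G⁻¹ D_G²(θ) D_G⁻¹ - I‖ ≤ δ u` on `Θ_{0,G}(u √n)`, `u ≤ u₀` -/
  smooth : ∀ u : ℝ, 0 < u → u ≤ u₀ → ∀ θ ∈ localSet n G P ℓ θs (u * √n),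
    ‖op ((rootInfo n G P ℓ θs)⁻¹ * penInfo n G P ℓ θ * (rootInfo n G P ℓ θs)⁻¹ - 1)‖ ≤ δ * u
  /-- identifiability: `V₀² = n v₀² ≤ a² D_G²` -/
  ident : (a ^ 2 • penInfo n G P ℓ θs - (n : ℝ) • (v₀ * v₀)).PosSemidef
  /-- global identification:
  `- 2 E L_G(θ, θs) ≥ b(u) ‖D_G (θ - θs)‖²` for `θ ∈ Θ` in `Θ_{0,G}(u √n)` -/
  global : ∀ u : ℝ, 0 < u → ∀ θ ∈ Θ ∩ localSet n G P ℓ θs (u * √n),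
    b u * ‖op (rootInfo n G P ℓ θs) (θ - θs)‖ ^ 2
      ≤ -2 * (meanPenLogLik n G P ℓ θ - meanPenLogLik n G P ℓ θs)

end Model

end PenML

end

/-! Put q = √(p_G + x). The proof separates uniform deviation bounds, which hold with high
probability, from a deterministic argument for a single sample.

Deviations. In an eigenbasis of B_G^{1/2}, with eigenvalues s_c ≤ a, the increments of ζ, the score,
and the increments of ∇ζ have Bernstein tails with respect to the metric of an ellipsoid with
semi-axes s_c / a (for ∇ζ, two copies of them). `ellipsoid_chaining` bounds such a process by √(Σ
b²) for the Gaussian part and Σ b for the exponential part. These are √(tr B_G) and tr(B_G^{1/2}),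
and the second comes with a factor 1/√n; under the size conditions both are of order q. To avoid
logarithms, the cells of the chaining depend on the point. Coordinates are grouped into blocks of
semi-axis about 2⁻ʲ, and at level l the mesh in block j < l is 4^{-(l-j)} times the quantized norm
of that block. The distances d_l from a point to its representatives then satisfy Σ 4^l d_l² ≤ 10,
not merely a bound on each term, and Cauchy–Schwarz across the levels gives √(Σ b²).

Concentration. At a maximizer L_G is at least its value at the target, so by global identification
b(u) r² is at most twice the increment of ζ, where r is the distance from the target. On the dyadic
slice of index k that increment is of order (q + k) r. For r ≤ u₁ √n this forces r ≤ r₀ with r₀ of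
order q; for larger r it contradicts u b(u) / log u → ∞. This is `le_radius_of_global`.

Expansions. If r₀ ≤ u₀ √n, local smoothness of the mean and the deviation bound for ∇ζ show that on
the vicinity of radius r₀ the gradient D_G⁻¹∇L_G(θ) equals ξ_G - D_G(θ - θs) up to an error Δ of
order q² / √n. At an interior maximizer the gradient vanishes, which is the Fisher expansion.
Integrating the same linearization along the segment gives 2 L_G = ‖w‖² + O(Δ ‖w‖) with w = D_G(θ̃ -
θs), and passing to square roots divides out ‖w‖: the Wilks expansion, in `fisher_wilks`. If r₀ > u₀
√n, then q² / √n is at least a multiple of q, and the crude bounds of order q suffice. -/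

namespace PenML

/-! ### Point-dependent cells in an ellipsoid, and their number -/

section Chaining

variable {ι : Type*} [Fintype ι]

/-- A two-sided geometric sum. -/
theorem sum_exp_neg_abs_le {α : ℝ} (hα : 0 < α) (R : ℕ) :
    ∑ z ∈ Finset.Icc (-(R : ℤ)) R, exp (-(α * |(z : ℝ)|)) ≤ 1 + 2 / α * (1 - exp (-(α * R))) := by
  induction R with
  | zero => simp
  | succ R ih =>
    have hs : Finset.Icc (-((R + 1 : ℕ) : ℤ)) ((R + 1 : ℕ) : ℤ)
        = insert (-((R + 1 : ℕ) : ℤ)) (insert ((R + 1 : ℕ) : ℤ) (Finset.Icc (-(R : ℤ)) R)) := by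
      ext z
      simp only [Finset.mem_Icc, Finset.mem_insert]
      omega
    rw [hs, Finset.sum_insert, Finset.sum_insert]
    · have h1 : |((-((R + 1 : ℕ) : ℤ) : ℤ) : ℝ)| = (R : ℝ) + 1 := by
        push_cast; rw [abs_neg, abs_of_nonneg]; positivity
      have h2 : |((((R + 1 : ℕ) : ℤ) : ℤ) : ℝ)| = (R : ℝ) + 1 := by
        push_cast; rw [abs_of_nonneg]; positivity
      rw [h1, h2]
      have h3 : exp (-(α * ((R : ℝ)))) = exp (-(α * ((R : ℝ) + 1))) * exp α := by
        rw [← exp_add]; congr 1; ring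
      have h4 : α + 1 ≤ exp α := add_one_le_exp α
      have h5 : 0 < exp (-(α * ((R : ℝ) + 1))) := exp_pos _
      rw [h3] at ih
      push_cast
      set e := exp (-(α * ((R : ℝ) + 1)))
      -- The subtracted term in the bound lets the induction close: its drop pays for the two new
      -- summands, since α ≤ exp α - 1.
      have h6 : e ≤ 1 / α * (e * exp α - e) := by
        rw [div_mul_eq_mul_div, le_div_iff₀ hα]; nlinarith
      have h7 : 2 / α * (1 - e) = 2 / α * (1 - e * exp α) + 2 * (1 / α * (e * exp α - e)) := by ring
      rw [h7]; linarith
    · simp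
    · simp only [Finset.mem_insert, Finset.mem_Icc]; omega

/-- Integer vectors in a weighted `ℓ¹` ball: a counting bound by exponential weights. -/
theorem exists_finset_weighted_ball [DecidableEq ι] (s : Finset ι) (α : ι → ℝ) (hα : ∀ c, 0 < α c)
    (M : ℝ) :
    ∃ F : Finset (ι → ℤ),
      (∀ z : ι → ℤ, (∀ c, c ∉ s → z c = 0) → ∑ c ∈ s, α c * |(z c : ℝ)| ≤ M → z ∈ F) ∧
      (F.card : ℝ) ≤ exp M * ∏ c ∈ s, (1 + 2 / α c) := by
  classical
  let B : ι → Finset ℤ := fun c =>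
    if c ∈ s then Finset.Icc (-(⌊M / α c⌋₊ : ℤ)) ⌊M / α c⌋₊ else {0}
  refine ⟨(Fintype.piFinset B).filter fun z => ∑ c ∈ s, α c * |(z c : ℝ)| ≤ M, ?_, ?_⟩
  · intro z hz hM
    refine Finset.mem_filter.2 ⟨Fintype.mem_piFinset.2 fun c => ?_, hM⟩
    by_cases hc : c ∈ s
    · simp only [B, hc, if_true, Finset.mem_Icc]
      have h1 : α c * |(z c : ℝ)| ≤ M :=
        (Finset.single_le_sum (f := fun c => α c * |(z c : ℝ)|)
          (fun c _ => mul_nonneg (hα c).le (abs_nonneg _)) hc).trans hM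
      have h2 : ((z c).natAbs : ℝ) ≤ M / α c := by
        rw [le_div_iff₀ (hα c), mul_comm, Nat.cast_natAbs, Int.cast_abs]; exact h1
      have h3 := Nat.le_floor h2
      omega
    · simp [B, hc, hz c hc]
  -- Chernoff's trick for counting: on the ball the weight exp (M - Σ α |z|) is at least one, and
  -- the weights factor over the coordinates. The box B only makes the sum finite.
  · have h1 : ∀ z ∈ (Fintype.piFinset B).filter (fun z => ∑ c ∈ s, α c * |(z c : ℝ)| ≤ M),
        (1 : ℝ) ≤ exp M * ∏ c, (if c ∈ s then exp (-(α c * |(z c : ℝ)|)) else 1) := by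
      intro z hz
      have hM := (Finset.mem_filter.1 hz).2
      rw [Finset.prod_ite_mem, Finset.univ_inter, ← exp_sum, ← exp_add, Finset.sum_neg_distrib]
      exact one_le_exp (by linarith)
    calc (((Fintype.piFinset B).filter fun z => ∑ c ∈ s, α c * |(z c : ℝ)| ≤ M).card : ℝ)
        = ∑ z ∈ (Fintype.piFinset B).filter (fun z => ∑ c ∈ s, α c * |(z c : ℝ)| ≤ M), (1 : ℝ) := by
          simp
      _ ≤ ∑ z ∈ (Fintype.piFinset B).filter (fun z => ∑ c ∈ s, α c * |(z c : ℝ)| ≤ M),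
            exp M * ∏ c, (if c ∈ s then exp (-(α c * |(z c : ℝ)|)) else 1) :=
          Finset.sum_le_sum h1
      _ ≤ ∑ z ∈ Fintype.piFinset B,
            exp M * ∏ c, (if c ∈ s then exp (-(α c * |(z c : ℝ)|)) else 1) := by
          refine Finset.sum_le_sum_of_subset_of_nonneg (Finset.filter_subset _ _) fun z _ _ => ?_
          refine mul_nonneg (exp_pos _).le (Finset.prod_nonneg fun c _ => ?_)
          split_ifs <;> positivity
      _ = exp M * ∏ c, ∑ z ∈ B c, (if c ∈ s then exp (-(α c * |(z : ℝ)|)) else 1) := by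
          rw [← Finset.mul_sum,
            Finset.prod_univ_sum B fun c z => if c ∈ s then exp (-(α c * |(z : ℝ)|)) else (1 : ℝ)]
      _ ≤ exp M * ∏ c, (if c ∈ s then 1 + 2 / α c else 1) := by
          gcongr with c _
          by_cases hc : c ∈ s
          · simp only [B, hc, if_true]
            refine (sum_exp_neg_abs_le (hα c) _).trans ?_
            have := exp_pos (-(α c * (⌊M / α c⌋₊ : ℝ)))
            have h2 : 0 < 2 / α c := div_pos two_pos (hα c)
            nlinarith
          · simp [B, hc]
      _ = exp M * ∏ c ∈ s, (1 + 2 / α c) := by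
          rw [Finset.prod_ite_mem, Finset.univ_inter]

/-- The squared distance of the ellipsoid with semi-axes `b`. -/
def dsq (b u v : ι → ℝ) : ℝ := ∑ c, b c ^ 2 * (u c - v c) ^ 2

/-- The Euclidean norm of the `j`-th block of coordinates. -/
noncomputable def blk (k : ι → ℕ) (u : ι → ℝ) (j : ℕ) : ℝ :=
  √(∑ c with k c = j, u c ^ 2)

/-- The quantized norm of the `j`-th block, in units of `2⁻ʲ`. -/
noncomputable def blkScale (k : ι → ℕ) (u : ι → ℝ) (j : ℕ) : ℕ := ⌊blk k u j * 2 ^ j⌋₊ + 1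

/-- The width of the cells of level `l` in the direction `c`. -/
noncomputable def mesh (k : ι → ℕ) (l : ℕ) (u : ι → ℝ) (c : ι) : ℝ :=
  (1 / 4) ^ (l - k c) * (blkScale k u (k c) / 2 ^ k c)
    / √((Finset.univ.filter fun c' => k c' = k c).card : ℝ)

/-- The cell of level `l` containing `u`: only the blocks below `l` are resolved. -/
noncomputable def code (k : ι → ℕ) (l : ℕ) (u : ι → ℝ) : (Fin l → ℕ) × (ι → ℤ) :=
  (fun j => blkScale k u j, fun c => if k c < l then ⌊u c / mesh k l u c⌋ else 0)

/-- The logarithmic number of cells of level `l`. -/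
def codeLen (k : ι → ℕ) (l : ℕ) : ℝ := ∑ c, 5 * ((l - k c : ℕ) : ℝ) + (l : ℝ) ^ 2

variable {k : ι → ℕ} {u v : ι → ℝ}

theorem blk_nonneg (j : ℕ) : 0 ≤ blk k u j := sqrt_nonneg _

theorem blk_sq (j : ℕ) : blk k u j ^ 2 = ∑ c with k c = j, u c ^ 2 :=
  sq_sqrt (Finset.sum_nonneg fun _ _ => sq_nonneg _)

theorem blk_sq_le (hu : ∑ c, u c ^ 2 ≤ 1) (j : ℕ) : blk k u j ≤ 1 := by
  have : blk k u j ^ 2 ≤ 1 := by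
    rw [blk_sq]
    exact (Finset.sum_le_sum_of_subset_of_nonneg (Finset.filter_subset _ _)
      fun _ _ _ => sq_nonneg _).trans hu
  nlinarith [blk_nonneg (k := k) (u := u) j]

theorem blk_le_scale (j : ℕ) : blk k u j ≤ blkScale k u j / 2 ^ j := by
  rw [le_div_iff₀ (by positivity)]
  unfold blkScale
  push_cast
  exact (Nat.lt_floor_add_one _).le

theorem scale_le_blk (j : ℕ) : (blkScale k u j : ℝ) / 2 ^ j ≤ blk k u j + (1 / 2) ^ j := by
  rw [div_le_iff₀ (by positivity), add_mul, ← mul_pow]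
  unfold blkScale
  push_cast
  have := Nat.floor_le (mul_nonneg (blk_nonneg (k := k) (u := u) j) (by positivity : (0 : ℝ) ≤ 2 ^ j))
  norm_num
  linarith

theorem scale_pos (j : ℕ) : (0 : ℝ) < blkScale k u j / 2 ^ j := by
  unfold blkScale; push_cast; positivity

theorem scale_mem (hu : ∑ c, u c ^ 2 ≤ 1) (j : ℕ) : blkScale k u j ∈ Finset.Icc 1 (2 ^ j + 1) := by
  unfold blkScale
  rw [Finset.mem_Icc]
  refine ⟨by omega, Nat.succ_le_succ ?_⟩
  refine Nat.floor_le_of_le ?_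
  push_cast
  have : (0 : ℝ) < 2 ^ j := by positivity
  nlinarith [blk_sq_le (k := k) hu j]

theorem card_block_pos (c : ι) :
    (0 : ℝ) < ((Finset.univ.filter fun c' => k c' = k c).card : ℝ) := by
  exact_mod_cast Finset.card_pos.2 ⟨c, by simp⟩

theorem mesh_pos (l : ℕ) (c : ι) : 0 < mesh k l u c := by
  have h1 := scale_pos (k := k) (u := u) (k c)
  have h2 := sqrt_pos.2 (card_block_pos (k := k) c)
  unfold mesh
  positivity

theorem codeLen_nonneg (l : ℕ) : 0 ≤ codeLen k l := by
  unfold codeLen; positivity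

theorem codeLen_mono : Monotone (codeLen k) := by
  intro l m h
  unfold codeLen
  gcongr

/-- The weighted `ℓ¹` norm of the cell indices. -/
theorem sum_code_le (l : ℕ) :
    ∑ c with k c < l, (1 / 4 : ℝ) ^ (l - k c) * |((code k l u).2 c : ℝ)|
      ≤ ∑ c with k c < l, (2 : ℝ) := by
  have h1 : ∀ c ∈ Finset.univ.filter (fun c => k c < l),
      (1 / 4 : ℝ) ^ (l - k c) * |((code k l u).2 c : ℝ)| ≤
        3 / 2 + ((Finset.univ.filter fun c' => k c' = k c).card : ℝ) * u c ^ 2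
          / (blkScale k u (k c) / 2 ^ k c) ^ 2 / 2 := by
    intro c hc
    have hc' : k c < l := (Finset.mem_filter.1 hc).2
    have hz : (code k l u).2 c = ⌊u c / mesh k l u c⌋ := by simp [code, hc']
    rw [hz]
    set N := ((Finset.univ.filter fun c' => k c' = k c).card : ℝ)
    have hN : 0 < N := card_block_pos c
    set S := (blkScale k u (k c) : ℝ) / 2 ^ k c with hS
    have hS0 : 0 < S := scale_pos _
    set α := (1 / 4 : ℝ) ^ (l - k c) with hα
    have hα0 : 0 < α := by positivity
    have hα1 : α ≤ 1 := pow_le_one₀ (by norm_num) (by norm_num)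
    have hm : mesh k l u c = α * S / √N := rfl
    have hfl : |((⌊u c / mesh k l u c⌋ : ℤ) : ℝ)| ≤ |u c / mesh k l u c| + 1 := by
      have h1 := Int.floor_le (u c / mesh k l u c)
      have h2 := Int.lt_floor_add_one (u c / mesh k l u c)
      rw [abs_le]
      constructor
      · linarith [neg_abs_le (u c / mesh k l u c)]
      · linarith [le_abs_self (u c / mesh k l u c)]
    have hab : |u c / mesh k l u c| = |u c| * √N / (α * S) := by
      rw [abs_div, abs_of_pos (mesh_pos l c), hm]
      field_simp
    rw [hab] at hfl
    have hsN := sq_sqrt hN.le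
    -- The weight α cancels the refinement factor of the mesh; then 2t ≤ 1 + t² trades the absolute
    -- value for a square, which the norm of the block controls.
    calc α * |((⌊u c / mesh k l u c⌋ : ℤ) : ℝ)| ≤ α * (|u c| * √N / (α * S) + 1) := by gcongr
      _ = |u c| * √N / S + α := by field_simp
      _ ≤ (1 + (|u c| * √N / S) ^ 2) / 2 + 1 := by
          nlinarith [sq_nonneg (|u c| * √N / S - 1)]
      _ = 3 / 2 + N * u c ^ 2 / S ^ 2 / 2 := by
          rw [div_pow, mul_pow, hsN, sq_abs]; ring
  refine (Finset.sum_le_sum h1).trans ?_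
  rw [Finset.sum_add_distrib]
  have h2 : ∑ c with k c < l, ((Finset.univ.filter fun c' => k c' = k c).card : ℝ) * u c ^ 2
          / (blkScale k u (k c) / 2 ^ k c) ^ 2 / 2 ≤ ∑ c with k c < l, (1 / 2 : ℝ) := by
    have hmaps : ∀ c ∈ Finset.univ.filter (fun c => k c < l), k c ∈ Finset.range l := by
      intro c hc; simpa using hc
    rw [← Finset.sum_fiberwise_of_maps_to hmaps, ← Finset.sum_fiberwise_of_maps_to hmaps]
    refine Finset.sum_le_sum fun j hj => ?_
    have hj' : j < l := Finset.mem_range.1 hj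
    have hf : (Finset.univ.filter (fun c => k c < l)).filter (fun c => k c = j)
        = Finset.univ.filter (fun c => k c = j) := by
      ext c; simp only [Finset.mem_filter, Finset.mem_univ, true_and]
      constructor
      · exact fun h => h.2
      · intro h; exact ⟨h ▸ hj', h⟩
    rw [hf]
    have h3 : ∑ c with k c = j, ((Finset.univ.filter fun c' => k c' = k c).card : ℝ) * u c ^ 2
          / (blkScale k u (k c) / 2 ^ k c) ^ 2 / 2
        = ∑ c with k c = j, u c ^ 2 * (((Finset.univ.filter fun c' => k c' = j).card : ℝ)
          / (blkScale k u j / 2 ^ j) ^ 2 / 2) := by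
      refine Finset.sum_congr rfl fun c hc => ?_
      rw [(Finset.mem_filter.1 hc).2]; ring
    rw [h3, ← Finset.sum_mul, ← blk_sq, Finset.sum_const, nsmul_eq_mul]
    have hS := scale_pos (k := k) (u := u) j
    have h4 := blk_le_scale (k := k) (u := u) j
    have h5 := blk_nonneg (k := k) (u := u) j
    set S := (blkScale k u j : ℝ) / 2 ^ j
    -- The quantized norm dominates the true one, so each block contributes at most half its
    -- cardinality.
    have h6 : blk k u j ^ 2 / S ^ 2 ≤ 1 := by
      rw [div_le_one (by positivity)]; gcongr
    set N := ((Finset.univ.filter fun c' => k c' = j).card : ℝ)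
    have hN : 0 ≤ N := Nat.cast_nonneg _
    calc blk k u j ^ 2 * (N / S ^ 2 / 2) = (blk k u j ^ 2 / S ^ 2) * (N * (1 / 2)) := by ring
      _ ≤ 1 * (N * (1 / 2)) := by gcongr
      _ = N * (1 / 2) := one_mul _
  refine (add_le_add le_rfl h2).trans (le_of_eq ?_)
  rw [← Finset.sum_add_distrib]
  norm_num

/-- The number of cells of level `l` meeting the unit ball. -/
theorem exists_codes (k : ι → ℕ) (l : ℕ) :
    ∃ F : Finset ((Fin l → ℕ) × (ι → ℤ)),
      (∀ u : ι → ℝ, ∑ c, u c ^ 2 ≤ 1 → code k l u ∈ F) ∧ (F.card : ℝ) ≤ exp (codeLen k l) := by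
  classical
  obtain ⟨F, hF, hcard⟩ := exists_finset_weighted_ball (Finset.univ.filter fun c => k c < l)
    (fun c => (1 / 4 : ℝ) ^ (l - k c)) (fun c => by positivity) (∑ c with k c < l, (2 : ℝ))
  refine ⟨(Fintype.piFinset fun j : Fin l => Finset.Icc 1 (2 ^ (j : ℕ) + 1)) ×ˢ F, ?_, ?_⟩
  · intro u hu
    refine Finset.mem_product.2 ⟨Fintype.mem_piFinset.2 fun j => scale_mem hu j, hF _ ?_ ?_⟩
    · intro c hc
      have : ¬ k c < l := by simpa using hc
      simp [code, this]
    · exact sum_code_le l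
  · rw [Finset.card_product, Fintype.card_piFinset]
    push_cast
    have he : (2 : ℝ) ≤ exp 1 := by linarith [add_one_le_exp (1 : ℝ)]
    -- Each of the l quantized norms takes at most 2 ^ l ≤ exp l values; this is the term l ^ 2 of
    -- `codeLen`.
    have h1 : ∏ j : Fin l, ((Finset.Icc 1 (2 ^ (j : ℕ) + 1)).card : ℝ) ≤ exp ((l : ℝ) ^ 2) := by
      have : ∀ j : Fin l, ((Finset.Icc 1 (2 ^ (j : ℕ) + 1)).card : ℝ) ≤ exp l := by
        intro j
        rw [Nat.card_Icc]
        have h2 : ((2 ^ (j : ℕ) + 1 + 1 - 1 : ℕ) : ℝ) ≤ 2 ^ ((j : ℕ) + 1) := by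
          have : 1 ≤ 2 ^ (j : ℕ) := Nat.one_le_two_pow
          have h3 : (2 ^ (j : ℕ) + 1 + 1 - 1 : ℕ) ≤ 2 ^ ((j : ℕ) + 1) := by rw [pow_succ]; omega
          exact_mod_cast h3
        calc ((2 ^ (j : ℕ) + 1 + 1 - 1 : ℕ) : ℝ) ≤ 2 ^ ((j : ℕ) + 1) := h2
          _ ≤ 2 ^ l := pow_le_pow_right₀ (by norm_num) j.2
          _ ≤ exp 1 ^ l := by gcongr
          _ = exp l := by rw [← exp_nat_mul, mul_one]
      calc ∏ j : Fin l, ((Finset.Icc 1 (2 ^ (j : ℕ) + 1)).card : ℝ) ≤ ∏ _j : Fin l, exp l :=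
            Finset.prod_le_prod (fun _ _ => Nat.cast_nonneg _) fun j _ => this j
        _ = exp ((l : ℝ) ^ 2) := by
            rw [Finset.prod_const, Finset.card_univ, Fintype.card_fin, ← exp_nat_mul]
            congr 1; ring
    have h2 : ∏ c with k c < l, (1 + 2 / (1 / 4 : ℝ) ^ (l - k c))
        ≤ exp (∑ c with k c < l, 3 * ((l - k c : ℕ) : ℝ)) := by
      rw [exp_sum]
      refine Finset.prod_le_prod (fun c _ => by positivity) fun c hc => ?_
      have hc' : k c < l := (Finset.mem_filter.1 hc).2
      obtain ⟨i, hi⟩ : ∃ i, l - k c = i + 1 := ⟨l - k c - 1, by omega⟩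
      rw [hi]
      have h16 : (16 : ℝ) ≤ exp 3 := by
        have := exp_one_gt_d9
        have h3 : exp 3 = exp 1 ^ 3 := by rw [← exp_nat_mul]; norm_num
        rw [h3]
        calc (16 : ℝ) ≤ 2.7 ^ 3 := by norm_num
          _ ≤ exp 1 ^ 3 := by gcongr; linarith
      have h4 : (1 : ℝ) ≤ 4 ^ i := one_le_pow₀ (by norm_num)
      calc 1 + 2 / (1 / 4 : ℝ) ^ (i + 1) = 1 + 8 * 4 ^ i := by
            rw [one_div, inv_pow, div_inv_eq_mul, pow_succ]; ring
        _ ≤ 16 * (4 ^ i * 4 ^ i) := by nlinarith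
        _ = 16 ^ (i + 1) := by rw [← mul_pow, pow_succ]; norm_num; ring
        _ ≤ exp 3 ^ (i + 1) := by gcongr
        _ = exp (3 * ((i + 1 : ℕ) : ℝ)) := by rw [← exp_nat_mul, mul_comm]
    calc (∏ j : Fin l, ((Finset.Icc 1 (2 ^ (j : ℕ) + 1)).card : ℝ)) * (F.card : ℝ)
        ≤ exp ((l : ℝ) ^ 2) * (exp (∑ c with k c < l, (2 : ℝ))
            * exp (∑ c with k c < l, 3 * ((l - k c : ℕ) : ℝ))) := by
          gcongr
          exact hcard.trans (by gcongr)
      _ = exp ((l : ℝ) ^ 2 + (∑ c with k c < l, (2 : ℝ)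
            + ∑ c with k c < l, 3 * ((l - k c : ℕ) : ℝ))) := by rw [exp_add, exp_add]
      _ ≤ exp (codeLen k l) := by
          refine exp_le_exp.2 ?_
          unfold codeLen
          rw [← Finset.sum_add_distrib, add_comm]
          gcongr
          -- The radius of the weighted ball costs 2 per coordinate and the geometric sums cost 3 (l
          -- - k c); the coefficient 5 absorbs both because l - k c ≥ 1.
          calc ∑ c with k c < l, (2 + 3 * ((l - k c : ℕ) : ℝ))
              ≤ ∑ c with k c < l, 5 * ((l - k c : ℕ) : ℝ) := by
                refine Finset.sum_le_sum fun c hc => ?_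
                have hc' : k c < l := (Finset.mem_filter.1 hc).2
                have : (1 : ℝ) ≤ ((l - k c : ℕ) : ℝ) := by exact_mod_cast (by omega : 1 ≤ l - k c)
                linarith
            _ ≤ _ := Finset.sum_le_sum_of_subset_of_nonneg (Finset.filter_subset _ _)
                fun _ _ _ => by positivity

end Chaining

/-! ### Distances to the representatives, summed over the levels -/

section Chaining

variable {ι : Type*} [Fintype ι] {k : ι → ℕ} {b u v : ι → ℝ}

/-- The part of the squared norm of the ellipsoid due to the blocks from `l` on. -/
def tailSq (k : ι → ℕ) (b : ι → ℝ) (l : ℕ) (u : ι → ℝ) : ℝ :=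
  ∑ c with l ≤ k c, b c ^ 2 * u c ^ 2

theorem tailSq_nonneg (l : ℕ) : 0 ≤ tailSq k b l u := by unfold tailSq; positivity

theorem four_pow_mul {i l : ℕ} (h : i ≤ l) : (4 : ℝ) ^ l * (1 / 4) ^ i = 4 ^ (l - i) := by
  obtain ⟨m, rfl⟩ := Nat.exists_eq_add_of_le h
  rw [Nat.add_sub_cancel_left, pow_add, mul_comm, ← mul_assoc, ← mul_pow]; norm_num

theorem four_pow_mul' {i l : ℕ} (h : l ≤ i) : (4 : ℝ) ^ l * (1 / 4) ^ i = (1 / 4) ^ (i - l) := by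
  obtain ⟨m, rfl⟩ := Nat.exists_eq_add_of_le h
  rw [Nat.add_sub_cancel_left, pow_add, ← mul_assoc, ← mul_pow]; norm_num

/-- The resolved part of the squared diameter of a cell. -/
theorem head_le (hb : ∀ c, 0 ≤ b c ∧ b c ≤ (1 / 2) ^ k c) {l : ℕ} (h : code k l u = code k l v) :
    4 ^ l * ∑ c with k c < l, b c ^ 2 * (u c - v c) ^ 2
      ≤ ∑ j ∈ Finset.range l, (1 / 4 : ℝ) ^ (l - j) * (blkScale k u j / 2 ^ j) ^ 2 := by
  have hmaps : ∀ c ∈ Finset.univ.filter (fun c => k c < l), k c ∈ Finset.range l := by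
    intro c hc; simpa using hc
  rw [← Finset.sum_fiberwise_of_maps_to hmaps, Finset.mul_sum]
  refine Finset.sum_le_sum fun j hj => ?_
  have hj' : j < l := Finset.mem_range.1 hj
  have hf : (Finset.univ.filter (fun c => k c < l)).filter (fun c => k c = j)
      = Finset.univ.filter (fun c => k c = j) := by
    ext c; simp only [Finset.mem_filter, Finset.mem_univ, true_and]
    exact ⟨fun h => h.2, fun h => ⟨h ▸ hj', h⟩⟩
  rw [hf]
  set N := ((Finset.univ.filter fun c' => k c' = j).card : ℝ) with hN
  set S := (blkScale k u j : ℝ) / 2 ^ j with hS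
  have hscale : blkScale k v j = blkScale k u j :=
    (congrFun (congrArg Prod.fst h) (⟨j, hj'⟩ : Fin l)).symm
  have h1 : ∀ c ∈ Finset.univ.filter (fun c => k c = j), b c ^ 2 * (u c - v c) ^ 2
      ≤ (1 / 4) ^ j * ((1 / 16) ^ (l - j) * S ^ 2 / N) := by
    intro c hc
    have hc' : k c = j := (Finset.mem_filter.1 hc).2
    have hNpos : 0 < N := by
      have := card_block_pos (k := k) c
      rwa [hc'] at this
    -- Equal codes give equal quantized norms, hence equal meshes; only then do equal floors bound
    -- the difference by one mesh.
    have hmv : mesh k l v c = mesh k l u c := by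
      unfold mesh; rw [hc', hscale]
    have hm : mesh k l u c ^ 2 = (1 / 16) ^ (l - j) * S ^ 2 / N := by
      unfold mesh
      rw [hc', div_pow, mul_pow, ← hS, ← hN, sq_sqrt hNpos.le, ← pow_mul, mul_comm _ 2, pow_mul]
      norm_num
    have hz : ⌊u c / mesh k l u c⌋ = ⌊v c / mesh k l u c⌋ := by
      have := congrFun (congrArg Prod.snd h) c
      simpa [code, hc', hj', hmv] using this
    have h2 := Int.abs_sub_lt_one_of_floor_eq_floor hz
    have hmp := mesh_pos (k := k) (u := u) l c
    rw [← sub_div, abs_div, abs_of_pos hmp, div_lt_one hmp] at h2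
    have h3 : (u c - v c) ^ 2 ≤ mesh k l u c ^ 2 := sq_le_sq' (by linarith [neg_abs_le (u c - v c)])
      ((le_abs_self _).trans h2.le)
    have h4 : b c ^ 2 ≤ (1 / 4) ^ j := by
      calc b c ^ 2 ≤ ((1 / 2) ^ k c) ^ 2 := pow_le_pow_left₀ (hb c).1 (hb c).2 2
        _ = (1 / 4) ^ j := by rw [hc', ← pow_mul, mul_comm, pow_mul]; norm_num
    rw [← hm]
    gcongr
  calc (4 : ℝ) ^ l * ∑ c with k c = j, b c ^ 2 * (u c - v c) ^ 2
      ≤ 4 ^ l * ∑ c with k c = j, (1 / 4) ^ j * ((1 / 16) ^ (l - j) * S ^ 2 / N) := by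
        exact mul_le_mul_of_nonneg_left (Finset.sum_le_sum h1) (by positivity)
    _ = (4 ^ l * (1 / 4) ^ j) * (1 / 16) ^ (l - j) * S ^ 2 * (N / N) := by
        rw [Finset.sum_const, nsmul_eq_mul]; ring
    -- For an empty block N / N is 0, not 1.
    _ ≤ (4 ^ l * (1 / 4) ^ j) * (1 / 16) ^ (l - j) * S ^ 2 * 1 := by
        gcongr; exact div_self_le_one N
    _ = (1 / 4) ^ (l - j) * S ^ 2 := by
        rw [four_pow_mul hj'.le, ← mul_pow]; norm_num

/-- The distance of a point to the representative of its cell. -/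
theorem dsq_le_of_code_eq (hb : ∀ c, 0 ≤ b c ∧ b c ≤ (1 / 2) ^ k c) {l : ℕ}
    (h : code k l u = code k l v) (ht : tailSq k b l v ≤ tailSq k b l u + (1 / 16) ^ l) :
    4 ^ l * dsq b u v
      ≤ ∑ j ∈ Finset.range l, (1 / 4 : ℝ) ^ (l - j) * (blkScale k u j / 2 ^ j) ^ 2
        + 4 * ∑ c, (if l ≤ k c then (1 / 4 : ℝ) ^ (k c - l) else 0) * u c ^ 2
        + 2 * (1 / 4) ^ l := by
  have hsplit : dsq b u v = ∑ c with k c < l, b c ^ 2 * (u c - v c) ^ 2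
      + ∑ c with l ≤ k c, b c ^ 2 * (u c - v c) ^ 2 := by
    unfold dsq
    rw [← Finset.sum_filter_add_sum_filter_not Finset.univ (fun c => k c < l)]
    simp only [not_lt]
  -- The unresolved coordinates of u and v are unrelated, so only their sizes are added; `ht`
  -- charges the tail of v to that of u.
  have h1 : ∑ c with l ≤ k c, b c ^ 2 * (u c - v c) ^ 2
      ≤ 4 * tailSq k b l u + 2 * (1 / 16) ^ l := by
    calc ∑ c with l ≤ k c, b c ^ 2 * (u c - v c) ^ 2
        ≤ ∑ c with l ≤ k c, (2 * (b c ^ 2 * u c ^ 2) + 2 * (b c ^ 2 * v c ^ 2)) := by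
          refine Finset.sum_le_sum fun c _ => ?_
          nlinarith [mul_nonneg (sq_nonneg (b c)) (sq_nonneg (u c + v c))]
      _ = 2 * tailSq k b l u + 2 * tailSq k b l v := by
          rw [Finset.sum_add_distrib, ← Finset.mul_sum, ← Finset.mul_sum]; rfl
      _ ≤ _ := by linarith
  have h2 : 4 ^ l * tailSq k b l u
      ≤ ∑ c, (if l ≤ k c then (1 / 4 : ℝ) ^ (k c - l) else 0) * u c ^ 2 := by
    unfold tailSq
    rw [Finset.mul_sum, Finset.sum_filter]
    refine Finset.sum_le_sum fun c _ => ?_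
    split_ifs with hc
    · have h4 : b c ^ 2 ≤ (1 / 4) ^ k c := by
        calc b c ^ 2 ≤ ((1 / 2) ^ k c) ^ 2 := pow_le_pow_left₀ (hb c).1 (hb c).2 2
          _ = (1 / 4) ^ k c := by rw [← pow_mul, mul_comm, pow_mul]; norm_num
      rw [← four_pow_mul' hc, ← mul_assoc]
      gcongr
    · simp
  have h3 : (4 : ℝ) ^ l * (1 / 16) ^ l = (1 / 4) ^ l := by rw [← mul_pow]; norm_num
  rw [hsplit, mul_add]
  refine add_le_add (head_le hb h) ((mul_le_mul_of_nonneg_left h1 (by positivity)).trans ?_) |>.trans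
    (le_of_eq (add_assoc _ _ _).symm)
  calc (4 : ℝ) ^ l * (4 * tailSq k b l u + 2 * (1 / 16) ^ l)
      = 4 * (4 ^ l * tailSq k b l u) + 2 * (4 ^ l * (1 / 16) ^ l) := by ring
    _ ≤ _ := by rw [h3]; gcongr

theorem sum_quarter_pow_le (L : ℕ) : ∑ l ∈ Finset.range L, (1 / 4 : ℝ) ^ l ≤ 4 / 3 := by
  have h : ∑ l ∈ Finset.range L, (1 / 4 : ℝ) ^ l = 4 / 3 - 4 / 3 * (1 / 4) ^ L := by
    induction L with
    | zero => simp
    | succ L ih => rw [Finset.sum_range_succ, ih, pow_succ]; ring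
  rw [h]
  have : (0 : ℝ) < (1 / 4) ^ L := by positivity
  linarith

theorem sum_ite_quarter_pow_le (K L : ℕ) :
    ∑ l ∈ Finset.range L, (if l ≤ K then (1 / 4 : ℝ) ^ (K - l) else 0) ≤ 4 / 3 := by
  rw [← Finset.sum_filter]
  calc ∑ l ∈ (Finset.range L).filter (fun l => l ≤ K), (1 / 4 : ℝ) ^ (K - l)
      ≤ ∑ l ∈ Finset.range (K + 1), (1 / 4 : ℝ) ^ (K - l) := by
        refine Finset.sum_le_sum_of_subset_of_nonneg (fun l hl => ?_) fun _ _ _ => by positivity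
        have := (Finset.mem_filter.1 hl).2
        exact Finset.mem_range.2 (by omega)
    _ = ∑ l ∈ Finset.range (K + 1), (1 / 4 : ℝ) ^ l :=
        Finset.sum_range_reflect (fun l => (1 / 4 : ℝ) ^ l) (K + 1)
    _ ≤ _ := sum_quarter_pow_le _

/-- The quantization error of block j is at most 2⁻ʲ, which is square summable, and the blocks
partition the coordinates of a vector of the unit ball. -/
theorem sum_scale_sq_le (hu : ∑ c, u c ^ 2 ≤ 1) (L : ℕ) :
    ∑ j ∈ Finset.range L, ((blkScale k u j : ℝ) / 2 ^ j) ^ 2 ≤ 14 / 3 := by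
  classical
  have h1 : ∀ j ∈ Finset.range L, ((blkScale k u j : ℝ) / 2 ^ j) ^ 2
      ≤ 2 * blk k u j ^ 2 + 2 * (1 / 4) ^ j := by
    intro j _
    have h2 : ((1 / 2 : ℝ) ^ j) ^ 2 = (1 / 4) ^ j := by rw [← pow_mul, mul_comm, pow_mul]; norm_num
    have h3 := pow_le_pow_left₀ (scale_pos (k := k) (u := u) j).le (scale_le_blk j) 2
    nlinarith [sq_nonneg (blk k u j - (1 / 2) ^ j)]
  refine (Finset.sum_le_sum h1).trans ?_
  rw [Finset.sum_add_distrib, ← Finset.mul_sum, ← Finset.mul_sum]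
  have h4 : ∑ j ∈ Finset.range L, blk k u j ^ 2 ≤ 1 := by
    simp only [blk_sq]
    rw [← Finset.sum_biUnion]
    · exact (Finset.sum_le_sum_of_subset_of_nonneg (Finset.subset_univ _)
        fun _ _ _ => sq_nonneg _).trans hu
    · intro i _ j _ hij
      refine Finset.disjoint_left.2 fun c hc hc' => hij ?_
      rw [← (Finset.mem_filter.1 hc).2, ← (Finset.mem_filter.1 hc').2]
  linarith [sum_quarter_pow_le L]

/-- The inner sums obey A (l + 1) = (A l + s l) / 4; adding up this recursion gives the constant
1/3. -/
theorem sum_conv_le (s : ℕ → ℝ) (hs : ∀ j, 0 ≤ s j) (L : ℕ) :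
    ∑ l ∈ Finset.range L, ∑ j ∈ Finset.range l, (1 / 4 : ℝ) ^ (l - j) * s j
      ≤ 1 / 3 * ∑ j ∈ Finset.range L, s j := by
  set A : ℕ → ℝ := fun l => ∑ j ∈ Finset.range l, (1 / 4 : ℝ) ^ (l - j) * s j with hA
  have hrec : ∀ l, A (l + 1) = (A l + s l) / 4 := by
    intro l
    simp only [hA]
    rw [Finset.sum_range_succ, add_div, Finset.sum_div]
    congr 1
    · refine Finset.sum_congr rfl fun j hj => ?_
      have : l + 1 - j = (l - j) + 1 := by have := Finset.mem_range.1 hj; omega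
      rw [this, pow_succ]; ring
    · simp; ring
  have h : ∑ l ∈ Finset.range L, A l + 4 / 3 * A L = 1 / 3 * ∑ j ∈ Finset.range L, s j := by
    induction L with
    | zero => simp [hA]
    | succ L ih => rw [Finset.sum_range_succ, Finset.sum_range_succ, hrec]; linarith
  have : 0 ≤ A L := Finset.sum_nonneg fun j _ => mul_nonneg (by positivity) (hs j)
  linarith

/-- The weighted sum of the squared distances to the representatives of all levels. -/
theorem sum_dsq_le (hb : ∀ c, 0 ≤ b c ∧ b c ≤ (1 / 2) ^ k c) (hu : ∑ c, u c ^ 2 ≤ 1)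
    (w : ℕ → ι → ℝ) (hw : ∀ l, code k l u = code k l (w l))
    (ht : ∀ l, tailSq k b l (w l) ≤ tailSq k b l u + (1 / 16) ^ l) (L : ℕ) :
    ∑ l ∈ Finset.range L, 4 ^ l * dsq b u (w l) ≤ 10 := by
  refine (Finset.sum_le_sum fun l _ => dsq_le_of_code_eq hb (hw l) (ht l)).trans ?_
  rw [Finset.sum_add_distrib, Finset.sum_add_distrib, ← Finset.mul_sum, ← Finset.mul_sum,
    Finset.sum_comm (s := Finset.range L) (t := Finset.univ)]
  -- The three contributions are at most 14/9, 16/3 and 8/3, whose sum is below 10.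
  have h1 := sum_conv_le (fun j => ((blkScale k u j : ℝ) / 2 ^ j) ^ 2) (fun _ => sq_nonneg _) L
  have h2 := sum_scale_sq_le (k := k) hu L
  have h3 := sum_quarter_pow_le L
  have h4 : ∑ c, ∑ l ∈ Finset.range L, (if l ≤ k c then (1 / 4 : ℝ) ^ (k c - l) else 0) * u c ^ 2
      ≤ 4 / 3 := by
    calc ∑ c, ∑ l ∈ Finset.range L, (if l ≤ k c then (1 / 4 : ℝ) ^ (k c - l) else 0) * u c ^ 2
        ≤ ∑ c, 4 / 3 * u c ^ 2 := by
          refine Finset.sum_le_sum fun c _ => ?_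
          rw [← Finset.sum_mul]
          exact mul_le_mul_of_nonneg_right (sum_ite_quarter_pow_le _ _) (sq_nonneg _)
      _ ≤ 4 / 3 := by rw [← Finset.mul_sum]; linarith
  linarith

theorem sum_half_pow_le (L : ℕ) : ∑ l ∈ Finset.range L, (1 / 2 : ℝ) ^ l ≤ 2 := by
  have h : ∑ l ∈ Finset.range L, (1 / 2 : ℝ) ^ l = 2 - 2 * (1 / 2) ^ L := by
    induction L with
    | zero => simp
    | succ L ih => rw [Finset.sum_range_succ, ih, pow_succ]; ring
  rw [h]
  have : (0 : ℝ) < (1 / 2) ^ L := by positivity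
  linarith

theorem sum_half_pow_mul_le (L : ℕ) :
    ∑ l ∈ Finset.range L, (1 / 2 : ℝ) ^ l * ((l : ℝ) + 1) ≤ 4 := by
  have h : ∑ l ∈ Finset.range L, (1 / 2 : ℝ) ^ l * ((l : ℝ) + 1)
      = 4 - 2 * (L + 2) * (1 / 2) ^ L := by
    induction L with
    | zero => norm_num
    | succ L ih => rw [Finset.sum_range_succ, ih, pow_succ]; push_cast; ring
  rw [h]
  have : (0 : ℝ) ≤ 2 * (L + 2) * (1 / 2) ^ L := by positivity
  linarith

theorem sum_half_pow_mul_sq_le (L : ℕ) :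
    ∑ l ∈ Finset.range L, (1 / 2 : ℝ) ^ l * ((l : ℝ) + 1) ^ 2 ≤ 12 := by
  have h : ∑ l ∈ Finset.range L, (1 / 2 : ℝ) ^ l * ((l : ℝ) + 1) ^ 2
      = 12 - 2 * ((L : ℝ) ^ 2 + 4 * L + 6) * (1 / 2) ^ L := by
    induction L with
    | zero => norm_num
    | succ L ih => rw [Finset.sum_range_succ, ih, pow_succ]; push_cast; ring
  rw [h]
  have : (0 : ℝ) ≤ 2 * ((L : ℝ) ^ 2 + 4 * L + 6) * (1 / 2) ^ L := by positivity
  linarith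

/-- The terms with l < K vanish, and shifting the index by K extracts r ^ K. This turns code lengths
into Σ r ^ k c, comparable to Σ b² for r = 1/4 and to Σ b for r = 1/2. -/
theorem sum_pow_mul_sub_le {r : ℝ} (hr : 0 ≤ r) (hr' : r ≤ 1 / 2) (K L : ℕ) :
    ∑ l ∈ Finset.range L, r ^ l * ((l + 1 - K : ℕ) : ℝ) ≤ 4 * r ^ K := by
  induction K generalizing L with
  | zero =>
    refine (Finset.sum_le_sum fun l _ => ?_).trans ((sum_half_pow_mul_le L).trans (by simp))
    push_cast [Nat.sub_zero]
    gcongr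
  | succ K ih =>
    cases L with
    | zero => simp; positivity
    | succ L =>
      rw [Finset.sum_range_succ']
      have h0 : ((0 + 1 - (K + 1) : ℕ) : ℝ) = 0 := by
        have : 0 + 1 - (K + 1) = 0 := by omega
        rw [this]; simp
      rw [h0, mul_zero, add_zero]
      calc ∑ l ∈ Finset.range L, r ^ (l + 1) * ((l + 1 + 1 - (K + 1) : ℕ) : ℝ)
          = r * ∑ l ∈ Finset.range L, r ^ l * ((l + 1 - K : ℕ) : ℝ) := by
            rw [Finset.mul_sum]
            refine Finset.sum_congr rfl fun l _ => ?_
            rw [Nat.add_sub_add_right, pow_succ]; ring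
        _ ≤ r * (4 * r ^ K) := by gcongr; exact ih L
        _ = 4 * r ^ (K + 1) := by rw [pow_succ]; ring

/-- The deviation level of the links between the levels `l` and `l + 1`. -/
def linkLevel (k : ι → ℕ) (y : ℝ) (l : ℕ) : ℝ := 2 * codeLen k (l + 1) + y + l + 2

theorem linkLevel_nonneg {y : ℝ} (hy : 0 ≤ y) (l : ℕ) : 0 ≤ linkLevel k y l := by
  have := codeLen_nonneg (k := k) (l + 1)
  unfold linkLevel; positivity

theorem sum_linkLevel_le {r : ℝ} (hr : 0 ≤ r) (hr' : r ≤ 1 / 2) {y : ℝ} (hy : 0 ≤ y) (L : ℕ) :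
    ∑ l ∈ Finset.range L, r ^ l * linkLevel k y l ≤ 40 * (∑ c, r ^ k c + y + 1) := by
  have hpow : ∀ l : ℕ, r ^ l ≤ (1 / 2) ^ l := fun l => pow_le_pow_left₀ hr hr' l
  have h1 : ∑ l ∈ Finset.range L, r ^ l * (∑ c, 5 * ((l + 1 - k c : ℕ) : ℝ))
      ≤ ∑ c, 20 * r ^ k c := by
    simp only [Finset.mul_sum]
    rw [Finset.sum_comm]
    refine Finset.sum_le_sum fun c _ => ?_
    have := sum_pow_mul_sub_le hr hr' (k c) L
    calc ∑ l ∈ Finset.range L, r ^ l * (5 * ((l + 1 - k c : ℕ) : ℝ))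
        = 5 * ∑ l ∈ Finset.range L, r ^ l * ((l + 1 - k c : ℕ) : ℝ) := by
          rw [Finset.mul_sum]; exact Finset.sum_congr rfl fun _ _ => by ring
      _ ≤ _ := by linarith
  have h2 : ∑ l ∈ Finset.range L, r ^ l * ((l : ℝ) + 1) ^ 2 ≤ 12 :=
    (Finset.sum_le_sum fun l _ => mul_le_mul_of_nonneg_right (hpow l) (sq_nonneg _)).trans
      (sum_half_pow_mul_sq_le L)
  have h3 : ∑ l ∈ Finset.range L, r ^ l * ((l : ℝ) + 1) ≤ 4 :=
    (Finset.sum_le_sum fun l _ => mul_le_mul_of_nonneg_right (hpow l) (by positivity)).trans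
      (sum_half_pow_mul_le L)
  have h4 : ∑ l ∈ Finset.range L, r ^ l ≤ 2 :=
    (Finset.sum_le_sum fun l _ => hpow l).trans (sum_half_pow_le L)
  have h5 : ∑ l ∈ Finset.range L, r ^ l * linkLevel k y l
      = 2 * ∑ l ∈ Finset.range L, r ^ l * (∑ c, 5 * ((l + 1 - k c : ℕ) : ℝ))
        + 2 * ∑ l ∈ Finset.range L, r ^ l * ((l : ℝ) + 1) ^ 2
        + ∑ l ∈ Finset.range L, r ^ l * ((l : ℝ) + 1) + (y + 1) * ∑ l ∈ Finset.range L, r ^ l := by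
    rw [Finset.mul_sum, Finset.mul_sum, Finset.mul_sum, ← Finset.sum_add_distrib,
      ← Finset.sum_add_distrib, ← Finset.sum_add_distrib]
    refine Finset.sum_congr rfl fun l _ => ?_
    unfold linkLevel codeLen
    push_cast
    ring
  rw [h5]
  have h6 : (y + 1) * ∑ l ∈ Finset.range L, r ^ l ≤ (y + 1) * 2 := by gcongr
  have h7 : 0 ≤ ∑ c, r ^ k c := Finset.sum_nonneg fun c _ => pow_nonneg hr _
  rw [← Finset.mul_sum] at h1
  linarith

end Chaining

/-! ### Generic chaining for Bernstein increments -/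

section Chaining

variable {ι : Type*} [Fintype ι] {k : ι → ℕ} {b : ι → ℝ}

/-- Representatives must lie in the index set, where the process is defined. A point of least tail
need not exist in a cell, hence the slack (1/16) ^ l. At level 0 there is a single cell, and t₀
serves because its tail is zero. -/
theorem exists_representatives {T : Type*} (U : T → ι → ℝ) (t₀ : T) (hU₀ : U t₀ = 0)
    (k : ι → ℕ) (b : ι → ℝ) :
    ∃ rep : (l : ℕ) → (Fin l → ℕ) × (ι → ℤ) → T, (∀ κ, rep 0 κ = t₀) ∧
      ∀ l t, code k l (U t) = code k l (U (rep l (code k l (U t)))) ∧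
        tailSq k b l (U (rep l (code k l (U t)))) ≤ tailSq k b l (U t) + (1 / 16) ^ l := by
  have h : ∀ (l : ℕ) (κ : (Fin l → ℕ) × (ι → ℤ)), ∃ v : T, (l = 0 → v = t₀) ∧
      ∀ t, code k l (U t) = κ → κ = code k l (U v) ∧
        tailSq k b l (U v) ≤ tailSq k b l (U t) + (1 / 16) ^ l := by
    intro l κ
    rcases Nat.eq_zero_or_pos l with rfl | hl
    · refine ⟨t₀, fun _ => rfl, fun t ht => ⟨?_, ?_⟩⟩
      · rw [← ht]
        refine Prod.ext (Subsingleton.elim _ _) ?_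
        simp [code]
      · have h0 : tailSq k b 0 (U t₀) = 0 := by simp [tailSq, hU₀]
        have := tailSq_nonneg (k := k) (b := b) (u := U t) 0
        rw [h0]; positivity
    · by_cases hκ : ∃ t, code k l (U t) = κ
      · set A : Set ℝ := (fun t => tailSq k b l (U t)) '' {t | code k l (U t) = κ} with hA
        have hne : A.Nonempty := by
          obtain ⟨t, ht⟩ := hκ
          exact ⟨_, t, ht, rfl⟩
        have hbdd : BddBelow A := ⟨0, by rintro _ ⟨t, _, rfl⟩; exact tailSq_nonneg l⟩
        obtain ⟨_, ⟨v, hv, rfl⟩, hlt⟩ := Real.lt_sInf_add_pos hne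
          (by positivity : (0 : ℝ) < (1 / 16) ^ l)
        refine ⟨v, fun h => by omega, fun t ht => ⟨hv.symm, hlt.le.trans ?_⟩⟩
        have := csInf_le hbdd (show tailSq k b l (U t) ∈ A from ⟨t, ht, rfl⟩)
        linarith
      · exact ⟨t₀, fun _ => rfl, fun t ht => absurd ⟨t, ht⟩ hκ⟩
  choose rep h0 hrep using h
  exact ⟨rep, fun κ => h0 0 κ rfl, fun l t => hrep l _ t rfl⟩

theorem dsq_nonneg (b u v : ι → ℝ) : 0 ≤ dsq b u v := by unfold dsq; positivity

theorem dsq_le_add (b u v w : ι → ℝ) : dsq b v w ≤ 2 * dsq b u v + 2 * dsq b u w := by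
  unfold dsq
  rw [Finset.mul_sum, Finset.mul_sum, ← Finset.sum_add_distrib]
  refine Finset.sum_le_sum fun c _ => ?_
  nlinarith [mul_nonneg (sq_nonneg (b c)) (sq_nonneg (u c - v c + (u c - w c)))]

/-- With positive semi-axes the ellipsoid distance controls every coordinate, here at rate 2⁻ˡ. -/
theorem tendsto_of_dsq_le (hb : ∀ c, 0 < b c) {u : ι → ℝ} {w : ℕ → ι → ℝ}
    (h : ∀ l, 4 ^ l * dsq b u (w l) ≤ 10) : Tendsto w atTop (𝓝 u) := by
  refine tendsto_pi_nhds.2 fun c => ?_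
  rw [tendsto_iff_norm_sub_tendsto_zero]
  refine squeeze_zero (g := fun l : ℕ => 4 / b c * (1 / 2) ^ l) (fun _ => norm_nonneg _)
    (fun l => ?_) ?_
  · have h1 : b c ^ 2 * (u c - w l c) ^ 2 ≤ dsq b u (w l) :=
      Finset.single_le_sum (f := fun c => b c ^ 2 * (u c - w l c) ^ 2)
        (fun c _ => by positivity) (Finset.mem_univ c)
    have h2 := (mul_le_mul_of_nonneg_left h1 (by positivity : (0 : ℝ) ≤ 4 ^ l)).trans (h l)
    have h4 : (4 : ℝ) ^ l = (2 ^ l) ^ 2 := by rw [← pow_mul, mul_comm, pow_mul]; norm_num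
    rw [h4] at h2
    have h5 : (2 ^ l * (b c * |w l c - u c|)) ^ 2 ≤ 4 ^ 2 := by
      rw [mul_pow, mul_pow, sq_abs]; nlinarith
    have h6 := abs_le_of_sq_le_sq h5 (by norm_num)
    have h7 := (le_abs_self _).trans h6
    rw [Real.norm_eq_abs, one_div, inv_pow, div_mul_eq_mul_div, le_div_iff₀ (hb c),
      ← div_eq_mul_inv, le_div_iff₀ (by positivity)]
    linarith
  · have := tendsto_pow_atTop_nhds_zero_of_lt_one (by norm_num : (0 : ℝ) ≤ 1 / 2) (by norm_num)
    simpa using this.const_mul (4 / b c)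

/-- **Generic chaining on an ellipsoid.** A process indexed by a part of the unit ball, whose
increments have Bernstein tails with respect to the distance `√(dsq b)`, is bounded in terms of
`∑ b²` (Gaussian part) and `∑ b` (exponential part), without logarithmic factors. -/
theorem ellipsoid_chaining {T Ω : Type*} [MeasurableSpace Ω] (μ : Measure Ω) (b : ι → ℝ)
    (hb : ∀ c, 0 < b c ∧ b c ≤ 1) (U : T → ι → ℝ) (hU : ∀ t, ∑ c, U t c ^ 2 ≤ 1) (t₀ : T)
    (hU₀ : U t₀ = 0) (X : T → Ω → ℝ) (ν γ : ℝ) (hν : 0 ≤ ν) (hγ : 0 ≤ γ)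
    (htail : ∀ s t y, 0 ≤ y → μ {w | √(dsq b (U s) (U t)) * (ν * √y + γ * y) < |X s w - X t w|}
      ≤ ENNReal.ofReal (4 * exp (-y)))
    (hcont : ∀ w t (s : ℕ → T), Tendsto (fun l => U (s l)) atTop (𝓝 (U t)) →
      Tendsto (fun l => X (s l) w) atTop (𝓝 (X t w)))
    {y : ℝ} (hy : 0 ≤ y) :
    μ {w | ∃ t, 400 * (ν * √(∑ c, b c ^ 2 + y + 1) + γ * (∑ c, b c + y + 1)) < |X t w - X t₀ w|}
      ≤ ENNReal.ofReal (exp (-y)) := by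
  have hk : ∀ c, ∃ j : ℕ, (1 / 2 : ℝ) ^ (j + 1) < b c ∧ b c ≤ (1 / 2) ^ j := fun c =>
    exists_nat_pow_near_of_lt_one (hb c).1 (hb c).2 (by norm_num) (by norm_num)
  choose k hk1 hk2 using hk
  have hbk : ∀ c, 0 ≤ b c ∧ b c ≤ (1 / 2) ^ k c := fun c => ⟨(hb c).1.le, hk2 c⟩
  obtain ⟨rep, hrep0, hrep⟩ := exists_representatives U t₀ hU₀ k b
  choose F hF hFcard using exists_codes k
  set bad : (l : ℕ) → (Fin l → ℕ) × (ι → ℤ) → (Fin (l + 1) → ℕ) × (ι → ℤ) → Set Ω :=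
    fun l κ κ' => {w | √(dsq b (U (rep l κ)) (U (rep (l + 1) κ'))) *
      (ν * √(linkLevel k y l) + γ * linkLevel k y l)
        < |X (rep l κ) w - X (rep (l + 1) κ') w|} with hbad
  -- A countable union of link events covers deviations over an arbitrary index set, so the supremum
  -- need not be measurable: if no link event occurs, telescoping and continuity bound X t - X t₀
  -- for every t at once.
  have hsub : {w | ∃ t, 400 * (ν * √(∑ c, b c ^ 2 + y + 1) + γ * (∑ c, b c + y + 1))
      < |X t w - X t₀ w|} ⊆ ⋃ l, ⋃ κ ∈ F l ×ˢ F (l + 1), bad l κ.1 κ.2 := by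
    rintro w ⟨t, ht⟩
    by_contra hw
    refine absurd ht (not_lt.2 ?_)
    set P : ℕ → T := fun l => rep l (code k l (U t)) with hP
    have hstep : ∀ l, |X (P l) w - X (P (l + 1)) w| ≤ √(dsq b (U (P l)) (U (P (l + 1)))) *
        (ν * √(linkLevel k y l) + γ * linkLevel k y l) := by
      intro l
      by_contra hlt
      refine hw (mem_iUnion.2 ⟨l, mem_iUnion₂.2 ⟨(code k l (U t), code k (l + 1) (U t)),
        Finset.mem_product.2 ⟨hF _ _ (hU t), hF _ _ (hU t)⟩, ?_⟩⟩)
      exact not_le.1 hlt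
    have hsum : ∀ L, ∑ l ∈ Finset.range L, 4 ^ l * dsq b (U t) (U (P l)) ≤ 10 :=
      fun L => sum_dsq_le hbk (hU t) (fun l => U (P l)) (fun l => (hrep l t).1)
        (fun l => (hrep l t).2) L
    have hone : ∀ l, 4 ^ l * dsq b (U t) (U (P l)) ≤ 10 := fun l =>
      (Finset.single_le_sum (f := fun l => 4 ^ l * dsq b (U t) (U (P l)))
        (fun l _ => mul_nonneg (by positivity) (dsq_nonneg _ _ _))
        (Finset.mem_range.2 l.lt_succ_self)).trans (hsum (l + 1))
    have hlim : Tendsto (fun l => |X (P l) w - X t₀ w|) atTop (𝓝 |X t w - X t₀ w|) :=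
      ((hcont w t P (tendsto_of_dsq_le (fun c => (hb c).1) hone)).sub_const _).abs
    refine le_of_tendsto' hlim fun L => ?_
    have hP0 : P 0 = t₀ := hrep0 _
    set δ : ℕ → ℝ := fun l => √(dsq b (U (P l)) (U (P (l + 1)))) with hδ
    have hδ0 : ∀ l, 0 ≤ δ l := fun l => sqrt_nonneg _
    -- A link passes through the point itself: 2 * 10 from level l and 10 / 2 from level l + 1.
    have hδsq : ∑ l ∈ Finset.range L, (2 ^ l * δ l) ^ 2 ≤ 25 := by
      have h1 : ∀ l ∈ Finset.range L, (2 ^ l * δ l) ^ 2 ≤ 2 * (4 ^ l * dsq b (U t) (U (P l)))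
          + 1 / 2 * (4 ^ (l + 1) * dsq b (U t) (U (P (l + 1)))) := by
        intro l _
        have h4 : (4 : ℝ) ^ (l + 1) = 4 * 4 ^ l := pow_succ' _ _
        have h5 : ((2 : ℝ) ^ l) ^ 2 = 4 ^ l := by rw [← pow_mul, mul_comm, pow_mul]; norm_num
        rw [mul_pow, hδ, sq_sqrt (dsq_nonneg _ _ _), h4, h5]
        have := mul_le_mul_of_nonneg_left (dsq_le_add b (U t) (U (P l)) (U (P (l + 1))))
          (by positivity : (0 : ℝ) ≤ 4 ^ l)
        linarith
      refine (Finset.sum_le_sum h1).trans ?_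
      rw [Finset.sum_add_distrib, ← Finset.mul_sum, ← Finset.mul_sum]
      have h2 := hsum L
      have h3 := hsum (L + 1)
      rw [Finset.sum_range_succ'] at h3
      have h4 : 0 ≤ 4 ^ 0 * dsq b (U t) (U (P 0)) := mul_nonneg (by positivity) (dsq_nonneg _ _ _)
      linarith
    have hy0 : ∀ l, 0 ≤ linkLevel k y l := fun l => linkLevel_nonneg hy l
    -- Cauchy–Schwarz across the levels: the factors 2 ^ l δ l are square summable, and the
    -- deviation levels weighted by (1/4) ^ l add up to the order of Σ b² + y + 1.
    have hG : ∑ l ∈ Finset.range L, δ l * √(linkLevel k y l)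
        ≤ 400 * √(∑ c, b c ^ 2 + y + 1) := by
      calc ∑ l ∈ Finset.range L, δ l * √(linkLevel k y l)
          = ∑ l ∈ Finset.range L, (2 ^ l * δ l) * ((1 / 2) ^ l * √(linkLevel k y l)) := by
            refine Finset.sum_congr rfl fun l _ => ?_
            have : (2 : ℝ) ^ l * (1 / 2) ^ l = 1 := by rw [← mul_pow]; norm_num
            linear_combination (-(δ l * √(linkLevel k y l))) * this
        _ ≤ √(∑ l ∈ Finset.range L, (2 ^ l * δ l) ^ 2)
            * √(∑ l ∈ Finset.range L, ((1 / 2) ^ l * √(linkLevel k y l)) ^ 2) :=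
            Real.sum_mul_le_sqrt_mul_sqrt _ _ _
        _ ≤ √25 * √(160 * (∑ c, b c ^ 2 + y + 1)) := by
            gcongr
            calc ∑ l ∈ Finset.range L, ((1 / 2) ^ l * √(linkLevel k y l)) ^ 2
                = ∑ l ∈ Finset.range L, (1 / 4 : ℝ) ^ l * linkLevel k y l := by
                  refine Finset.sum_congr rfl fun l _ => ?_
                  rw [mul_pow, sq_sqrt (hy0 l), ← pow_mul, mul_comm l 2, pow_mul]; norm_num
              _ ≤ 40 * (∑ c, (1 / 4) ^ k c + y + 1) :=
                  sum_linkLevel_le (by norm_num) (by norm_num) hy L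
              _ ≤ 40 * (∑ c, 4 * b c ^ 2 + 4 * y + 4) := by
                  have : ∑ c, (1 / 4 : ℝ) ^ k c ≤ ∑ c, 4 * b c ^ 2 := by
                    refine Finset.sum_le_sum fun c _ => ?_
                    have h1 := pow_le_pow_left₀ (by positivity) (hk1 c).le 2
                    have h2 : ((1 / 2 : ℝ) ^ (k c + 1)) ^ 2 = (1 / 4) ^ k c / 4 := by
                      rw [← pow_mul, mul_comm _ 2, pow_mul, pow_succ]; norm_num; ring
                    linarith
                  linarith
              _ = _ := by rw [← Finset.mul_sum]; ring
        _ ≤ 400 * √(∑ c, b c ^ 2 + y + 1) := by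
            rw [sqrt_mul (by norm_num), ← mul_assoc]
            gcongr
            rw [← sqrt_mul (by norm_num)]
            exact sqrt_le_iff.2 ⟨by norm_num, by norm_num⟩
    -- Here the termwise bound δ l ≤ 5 (1/2) ^ l is enough, and the weights (1/2) ^ l lead to Σ b.
    have hE : ∑ l ∈ Finset.range L, δ l * linkLevel k y l ≤ 400 * (∑ c, b c + y + 1) := by
      have h5 : ∀ l ∈ Finset.range L, δ l * linkLevel k y l
          ≤ 5 * ((1 / 2) ^ l * linkLevel k y l) := by
        intro l hl
        have h1 : (2 ^ l * δ l) ^ 2 ≤ 5 ^ 2 := by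
          refine (Finset.single_le_sum (f := fun l => (2 ^ l * δ l) ^ 2)
            (fun l _ => sq_nonneg _) hl).trans (hδsq.trans (by norm_num))
        have h2 := (le_abs_self _).trans (abs_le_of_sq_le_sq h1 (by norm_num))
        have h3 : δ l ≤ 5 * (1 / 2) ^ l := by
          rw [one_div, inv_pow, ← div_eq_mul_inv, le_div_iff₀ (by positivity)]; linarith
        nlinarith [mul_le_mul_of_nonneg_right h3 (hy0 l)]
      refine (Finset.sum_le_sum h5).trans ?_
      rw [← Finset.mul_sum]
      have h6 := sum_linkLevel_le (k := k) (r := 1 / 2) (by norm_num) le_rfl hy L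
      have h7 : ∑ c, (1 / 2 : ℝ) ^ k c ≤ 2 * ∑ c, b c := by
        rw [Finset.mul_sum]
        refine Finset.sum_le_sum fun c _ => ?_
        have := (hk1 c).le
        rw [pow_succ] at this
        linarith
      linarith
    calc |X (P L) w - X t₀ w| ≤ ∑ l ∈ Finset.range L, |X (P l) w - X (P (l + 1)) w| := by
          have h1 : X (P L) w - X t₀ w
              = ∑ l ∈ Finset.range L, (X (P (l + 1)) w - X (P l) w) := by
            rw [Finset.sum_range_sub (fun l => X (P l) w), hP0]
          rw [h1]
          refine (Finset.abs_sum_le_sum_abs _ _).trans (le_of_eq ?_)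
          exact Finset.sum_congr rfl fun l _ => abs_sub_comm _ _
      _ ≤ ∑ l ∈ Finset.range L, δ l * (ν * √(linkLevel k y l) + γ * linkLevel k y l) :=
          Finset.sum_le_sum fun l _ => hstep l
      _ = ν * ∑ l ∈ Finset.range L, δ l * √(linkLevel k y l)
          + γ * ∑ l ∈ Finset.range L, δ l * linkLevel k y l := by
          rw [Finset.mul_sum, Finset.mul_sum, ← Finset.sum_add_distrib]
          exact Finset.sum_congr rfl fun _ _ => by ring
      _ ≤ ν * (400 * √(∑ c, b c ^ 2 + y + 1)) + γ * (400 * (∑ c, b c + y + 1)) := by gcongr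
      _ = _ := by ring
  -- In `linkLevel`, twice the code length pays for the pairs of cells, l makes the sum over the
  -- levels geometric, and 2 absorbs the factor 4 of the tail bound.
  have hlevel : ∀ l, μ (⋃ κ ∈ F l ×ˢ F (l + 1), bad l κ.1 κ.2)
      ≤ ENNReal.ofReal (4 * exp (-y - 2) * exp (-1) ^ l) := by
    intro l
    calc μ (⋃ κ ∈ F l ×ˢ F (l + 1), bad l κ.1 κ.2)
        ≤ ∑ κ ∈ F l ×ˢ F (l + 1), μ (bad l κ.1 κ.2) := measure_biUnion_finset_le _ _
      _ ≤ ∑ κ ∈ F l ×ˢ F (l + 1), ENNReal.ofReal (4 * exp (-linkLevel k y l)) :=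
          Finset.sum_le_sum fun κ _ => htail _ _ _ (linkLevel_nonneg hy l)
      _ = ENNReal.ofReal (((F l).card * (F (l + 1)).card : ℝ) * (4 * exp (-linkLevel k y l))) := by
          rw [Finset.sum_const, Finset.card_product, nsmul_eq_mul, ← Nat.cast_mul,
            ENNReal.ofReal_mul (Nat.cast_nonneg _), ENNReal.ofReal_natCast]
      _ ≤ _ := by
          refine ENNReal.ofReal_le_ofReal ?_
          calc ((F l).card * (F (l + 1)).card : ℝ) * (4 * exp (-linkLevel k y l))
              ≤ (exp (codeLen k (l + 1)) * exp (codeLen k (l + 1)))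
                * (4 * exp (-linkLevel k y l)) := by
                gcongr
                · exact (hFcard l).trans (exp_le_exp.2 (codeLen_mono l.le_succ))
                · exact hFcard (l + 1)
            _ = 4 * exp (-y - 2) * exp (-1) ^ l := by
                rw [← exp_nat_mul, mul_assoc 4, ← exp_add, ← exp_add, mul_left_comm, ← exp_add]
                congr 2
                unfold linkLevel; ring
  have he : exp (-1) ≤ 0.37 := by
    have := exp_neg_one_lt_d9; linarith
  have he0 := exp_pos (-1)
  have hsummable : Summable fun l : ℕ => 4 * exp (-y - 2) * exp (-1) ^ l :=
    (summable_geometric_of_lt_one he0.le (by linarith)).mul_left _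
  calc μ {w | ∃ t, 400 * (ν * √(∑ c, b c ^ 2 + y + 1) + γ * (∑ c, b c + y + 1))
        < |X t w - X t₀ w|}
      ≤ μ (⋃ l, ⋃ κ ∈ F l ×ˢ F (l + 1), bad l κ.1 κ.2) := measure_mono hsub
    _ ≤ ∑' l, μ (⋃ κ ∈ F l ×ˢ F (l + 1), bad l κ.1 κ.2) := measure_iUnion_le _
    _ ≤ ∑' l, ENNReal.ofReal (4 * exp (-y - 2) * exp (-1) ^ l) := ENNReal.tsum_le_tsum hlevel
    _ = ENNReal.ofReal (∑' l, 4 * exp (-y - 2) * exp (-1) ^ l) :=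
        (ENNReal.ofReal_tsum_of_nonneg (fun l => by positivity) hsummable).symm
    _ ≤ ENNReal.ofReal (exp (-y)) := by
        refine ENNReal.ofReal_le_ofReal ?_
        rw [tsum_mul_left, tsum_geometric_of_lt_one he0.le (by linarith)]
        have h2 : exp (-y - 2) = exp (-y) * (exp (-1) * exp (-1)) := by
          rw [← exp_add, ← exp_add]; congr 1; ring
        rw [h2, ← div_eq_mul_inv, div_le_iff₀ (by linarith)]
        have h3 : 4 * (exp (-1) * exp (-1)) ≤ 1 - exp (-1) := by nlinarith
        calc 4 * (exp (-y) * (exp (-1) * exp (-1))) = exp (-y) * (4 * (exp (-1) * exp (-1))) := by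
              ring
          _ ≤ _ := by gcongr

end Chaining

/-! ### Exponential moments of increments, and Bernstein's inequality -/

section ExpMoments

variable {𝓨 : Type*} [MeasurableSpace 𝓨] {P : Measure 𝓨} {ν g : ℝ}

/-- X is recovered as a logarithm of the integrable function exp (g X); this supplies the
measurability of gradients and Hessians, which is not assumed separately. -/
theorem ExpMoment.aemeasurable {X : 𝓨 → ℝ} (h : ExpMoment P X ν g) (hg : 0 < g) :
    AEMeasurable X P := by
  have h1 := (h g (abs_of_pos hg).le).1.aemeasurable
  have h2 := (Real.measurable_log.comp_aemeasurable h1).const_mul g⁻¹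
  refine h2.congr (Eventually.of_forall fun y => ?_)
  simp only [Function.comp, log_exp]
  field_simp

theorem ExpMoment.lintegral_le [IsProbabilityMeasure P] {X : 𝓨 → ℝ} (h : ExpMoment P X ν g) {t : ℝ}
    (ht : |t| ≤ g) :
    ∫⁻ y, ENNReal.ofReal (exp (t * X y)) ∂P ≤ ENNReal.ofReal (exp (ν ^ 2 * t ^ 2 / 2)) := by
  obtain ⟨hi, hc⟩ := h t ht
  rw [← ofReal_integral_eq_lintegral_ofReal hi (Eventually.of_forall fun _ => (exp_pos _).le)]
  refine ENNReal.ofReal_le_ofReal ?_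
  exact (log_le_iff_le_exp (mgf_pos hi)).1 hc

/-- The form suited to Fatou's lemma: integrability of the limit follows from the bound itself. -/
theorem expMoment_of_lintegral_le [IsProbabilityMeasure P] {X : 𝓨 → ℝ} (hX : AEMeasurable X P)
    (h : ∀ t : ℝ, |t| ≤ g →
      ∫⁻ y, ENNReal.ofReal (exp (t * X y)) ∂P ≤ ENNReal.ofReal (exp (ν ^ 2 * t ^ 2 / 2))) :
    ExpMoment P X ν g := by
  intro t ht
  have hi : Integrable (fun y => exp (t * X y)) P := by
    refine ⟨(measurable_exp.comp_aemeasurable (hX.const_mul t)).aestronglyMeasurable, ?_⟩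
    rw [hasFiniteIntegral_iff_ofReal (Eventually.of_forall fun _ => (exp_pos _).le)]
    exact (h t ht).trans_lt ENNReal.ofReal_lt_top
  refine ⟨hi, (log_le_iff_le_exp (mgf_pos hi)).2 ?_⟩
  have := h t ht
  rwa [← ofReal_integral_eq_lintegral_ofReal hi (Eventually.of_forall fun _ => (exp_pos _).le),
    ENNReal.ofReal_le_ofReal_iff (exp_pos _).le] at this

theorem ExpMoment.neg {X : 𝓨 → ℝ} (h : ExpMoment P X ν g) : ExpMoment P (fun y => -X y) ν g := by
  intro t ht
  obtain ⟨h1, h2⟩ := h (-t) (by rwa [abs_neg])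
  refine ⟨by simpa using h1, ?_⟩
  have : cgf (fun y => -X y) P t = cgf X P (-t) := by simp [cgf, mgf]
  rw [this]; simpa using h2

/-- Riemann sums of a continuous derivative converge to the increment. -/
theorem tendsto_riemann_sum {φ φ' : ℝ → ℝ} (hφ : ∀ t ∈ Icc (0 : ℝ) 1, HasDerivAt φ (φ' t) t)
    (hc : ContinuousOn φ' (Icc 0 1)) :
    Tendsto (fun N : ℕ => ∑ k ∈ Finset.range (N + 1), ((N : ℝ) + 1)⁻¹ * φ' (k / (N + 1)))
      atTop (𝓝 (φ 1 - φ 0)) := by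
  have hu := isCompact_Icc.uniformContinuousOn_of_continuous hc
  rw [Metric.uniformContinuousOn_iff] at hu
  rw [Metric.tendsto_atTop]
  intro ε hε
  obtain ⟨δ, hδ, hδ'⟩ := hu (ε / 2) (by positivity)
  obtain ⟨N₀, hN₀⟩ := exists_nat_gt δ⁻¹
  refine ⟨N₀, fun N hN => ?_⟩
  have hNpos : (0 : ℝ) < N + 1 := by positivity
  have hNδ : ((N : ℝ) + 1)⁻¹ < δ := by
    rw [inv_lt_comm₀ hNpos hδ]
    have : (N₀ : ℝ) ≤ N := by exact_mod_cast hN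
    linarith
  have htel : φ 1 - φ 0 = ∑ k ∈ Finset.range (N + 1),
      (φ ((k + 1 : ℕ) / (N + 1)) - φ (k / (N + 1))) := by
    rw [Finset.sum_range_sub (fun k : ℕ => φ (k / (N + 1)))]
    push_cast
    rw [div_self hNpos.ne', zero_div]
  have hterm : ∀ k ∈ Finset.range (N + 1),
      |((N : ℝ) + 1)⁻¹ * φ' (k / (N + 1)) - (φ ((k + 1 : ℕ) / (N + 1)) - φ (k / (N + 1)))|
        ≤ ((N : ℝ) + 1)⁻¹ * (ε / 2) := by
    intro k hk
    have hk' : (k : ℝ) + 1 ≤ N + 1 := by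
      have := Finset.mem_range.1 hk
      exact_mod_cast this
    have hlt : (k : ℝ) / (N + 1) < (k + 1 : ℕ) / (N + 1) := by
      push_cast; gcongr; linarith
    have hmem0 : 0 ≤ (k : ℝ) / (N + 1) := by positivity
    have hmem1 : ((k + 1 : ℕ) : ℝ) / (N + 1) ≤ 1 := by
      rw [div_le_one hNpos]; push_cast; exact hk'
    have hlen : ((k + 1 : ℕ) : ℝ) / (N + 1) - k / (N + 1) = ((N : ℝ) + 1)⁻¹ := by
      push_cast; field_simp; ring
    -- The mean value theorem writes the increment over a subinterval as its length times φ' c;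
    -- uniform continuity compares c with the left endpoint.
    obtain ⟨c, hc1, hc2⟩ := exists_hasDerivAt_eq_slope φ φ' hlt
      (fun t ht => (hφ t ⟨hmem0.trans ht.1, ht.2.trans hmem1⟩).continuousAt.continuousWithinAt)
      (fun t ht => hφ t ⟨hmem0.trans ht.1.le, ht.2.le.trans hmem1⟩)
    have h1 : φ ((k + 1 : ℕ) / (N + 1)) - φ (k / (N + 1)) = ((N : ℝ) + 1)⁻¹ * φ' c := by
      rw [hc2, hlen]; field_simp
    rw [h1, ← mul_sub, abs_mul, abs_of_pos (inv_pos.2 hNpos)]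
    gcongr
    have h2 := hδ' (k / (N + 1)) ⟨hmem0, hlt.le.trans hmem1⟩ c
      ⟨hmem0.trans hc1.1.le, hc1.2.le.trans hmem1⟩ (by
        rw [Real.dist_eq, abs_sub_comm, abs_of_pos (by linarith [hc1.1])]
        linarith [hc1.2])
    exact h2.le
  rw [Real.dist_eq, htel, ← Finset.sum_sub_distrib]
  calc |∑ k ∈ Finset.range (N + 1), (((N : ℝ) + 1)⁻¹ * φ' (k / (N + 1))
          - (φ ((k + 1 : ℕ) / (N + 1)) - φ (k / (N + 1))))|
      ≤ ∑ k ∈ Finset.range (N + 1), ((N : ℝ) + 1)⁻¹ * (ε / 2) :=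
        (Finset.abs_sum_le_sum_abs _ _).trans (Finset.sum_le_sum hterm)
    _ = ε / 2 := by
        rw [Finset.sum_const, Finset.card_range, nsmul_eq_mul]; push_cast; field_simp
    _ < ε := by linarith

/-- Exponential moments of the derivative along a segment pass to the increment. -/
theorem expMoment_increment [IsProbabilityMeasure P] (hg : 0 < g) {φ φ' : 𝓨 → ℝ → ℝ}
    (hφ : ∀ y, ∀ t ∈ Icc (0 : ℝ) 1, HasDerivAt (φ y) (φ' y t) t)
    (hc : ∀ y, ContinuousOn (φ' y) (Icc 0 1))
    (hexp : ∀ t ∈ Icc (0 : ℝ) 1, ExpMoment P (fun y => φ' y t) ν g) :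
    ExpMoment P (fun y => φ y 1 - φ y 0) ν g := by
  set R : ℕ → 𝓨 → ℝ := fun N y =>
    ∑ k ∈ Finset.range (N + 1), ((N : ℝ) + 1)⁻¹ * φ' y (k / (N + 1)) with hR
  have hlim : ∀ y, Tendsto (fun N => R N y) atTop (𝓝 (φ y 1 - φ y 0)) :=
    fun y => tendsto_riemann_sum (hφ y) (hc y)
  have hmem : ∀ N : ℕ, ∀ k ∈ Finset.range (N + 1), (k : ℝ) / (N + 1) ∈ Icc (0 : ℝ) 1 := by
    intro N k hk
    have hk' : (k : ℝ) ≤ N := by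
      have := Finset.mem_range.1 hk
      exact_mod_cast Nat.lt_succ_iff.1 this
    exact ⟨by positivity, by rw [div_le_one (by positivity)]; linarith⟩
  have hRm : ∀ N, AEMeasurable (R N) P := fun N =>
    Finset.aemeasurable_fun_sum _ fun k hk =>
      ((hexp _ (hmem N k hk)).aemeasurable hg).const_mul _
  refine expMoment_of_lintegral_le (aemeasurable_of_tendsto_metrizable_ae' hRm
    (Eventually.of_forall hlim)) fun t ht => ?_
  have hexpm : ∀ N, AEMeasurable (fun y => ENNReal.ofReal (exp (t * R N y))) P := fun N =>
    (measurable_exp.comp_aemeasurable ((hRm N).const_mul t)).ennreal_ofReal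
  have hpt : ∀ y, ENNReal.ofReal (exp (t * (φ y 1 - φ y 0)))
      = liminf (fun N => ENNReal.ofReal (exp (t * R N y))) atTop := by
    intro y
    refine (Tendsto.liminf_eq ?_).symm
    exact (ENNReal.continuous_ofReal.tendsto _).comp
      ((continuous_exp.tendsto _).comp ((hlim y).const_mul t))
  simp only [hpt]
  -- Fatou reduces the bound to Riemann sums. By convexity of exp, their exponential moments are at
  -- most an average of those of the derivative, which all obey the same bound.
  refine (lintegral_liminf_le' hexpm).trans ?_
  refine liminf_le_of_le (by isBoundedDefault) fun c hcN => ?_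
  obtain ⟨N, hN⟩ := hcN.exists
  refine hN.trans ?_
  have hpos : (0 : ℝ) < (N : ℝ) + 1 := by positivity
  calc ∫⁻ y, ENNReal.ofReal (exp (t * R N y)) ∂P
      ≤ ∫⁻ y, ∑ k ∈ Finset.range (N + 1), ENNReal.ofReal ((N : ℝ) + 1)⁻¹ *
          ENNReal.ofReal (exp (t * φ' y (k / (N + 1)))) ∂P := by
        refine lintegral_mono fun y => ?_
        simp only [← ENNReal.ofReal_mul (inv_pos.2 hpos).le]
        rw [← ENNReal.ofReal_sum_of_nonneg (fun k _ => by positivity)]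
        refine ENNReal.ofReal_le_ofReal ?_
        have := convexOn_exp.map_sum_le (t := Finset.range (N + 1)) (w := fun _ => ((N : ℝ) + 1)⁻¹)
          (p := fun k => t * φ' y (k / (N + 1))) (fun _ _ => (inv_pos.2 hpos).le)
          (by rw [Finset.sum_const, Finset.card_range, nsmul_eq_mul]; push_cast; field_simp)
          (fun _ _ => mem_univ _)
        simp only [smul_eq_mul] at this
        refine le_trans (le_of_eq ?_) this
        rw [hR]
        simp only [Finset.mul_sum]
        congr 1
        exact Finset.sum_congr rfl fun _ _ => by ring
    _ = ∑ k ∈ Finset.range (N + 1), ENNReal.ofReal ((N : ℝ) + 1)⁻¹ *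
          ∫⁻ y, ENNReal.ofReal (exp (t * φ' y (k / (N + 1)))) ∂P := by
        have hm : ∀ k ∈ Finset.range (N + 1),
            AEMeasurable (fun y => ENNReal.ofReal (exp (t * φ' y (k / (N + 1))))) P := fun k hk =>
          (measurable_exp.comp_aemeasurable
            (((hexp _ (hmem N k hk)).aemeasurable hg).const_mul t)).ennreal_ofReal
        rw [lintegral_finsetSum' _ fun k hk => (hm k hk).const_mul _]
        exact Finset.sum_congr rfl fun k hk => lintegral_const_mul'' _ (hm k hk)
    _ ≤ ∑ k ∈ Finset.range (N + 1), ENNReal.ofReal ((N : ℝ) + 1)⁻¹ *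
          ENNReal.ofReal (exp (ν ^ 2 * t ^ 2 / 2)) := by
        refine Finset.sum_le_sum fun k hk => ?_
        gcongr
        exact (hexp _ (hmem N k hk)).lintegral_le ht
    _ = ENNReal.ofReal (exp (ν ^ 2 * t ^ 2 / 2)) := by
        rw [Finset.sum_const, Finset.card_range, nsmul_eq_mul, ← mul_assoc,
          ← ENNReal.ofReal_natCast, ← ENNReal.ofReal_mul (Nat.cast_nonneg _)]
        push_cast
        rw [mul_inv_cancel₀ hpos.ne', ENNReal.ofReal_one, one_mul]

variable {Ω : Type*} [MeasurableSpace Ω] {Pr : Measure Ω} [IsProbabilityMeasure Pr]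
  {n : ℕ} {Y : Fin n → Ω → 𝓨}

/-- Chernoff's bound for a sum of i.i.d. variables with exponential moments. -/
theorem iid_upper_tail [IsProbabilityMeasure P] (hY : ∀ i, Measurable (Y i)) (hmap : ∀ i, Measure.map (Y i) Pr = P)
    (hind : iIndepFun Y Pr) {X : 𝓨 → ℝ} (hg : 0 < g) (hX : ExpMoment P X ν g) {t : ℝ} (ht : 0 ≤ t)
    (htg : t ≤ g) (s : ℝ) :
    Pr {w | s ≤ ∑ i, X (Y i w)} ≤ ENNReal.ofReal (exp (-t * s + n * (ν ^ 2 * t ^ 2 / 2))) := by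
  have hXm := hX.aemeasurable hg
  -- Composition preserves independence for measurable functions, so X is replaced by a measurable
  -- version; equality P-a.e. transfers to each observation.
  set X' := hXm.mk X with hX'
  have hX'm : Measurable X' := hXm.measurable_mk
  have hae : ∀ i, ∀ᵐ w ∂Pr, X (Y i w) = X' (Y i w) := by
    intro i
    have : ∀ᵐ y ∂(Measure.map (Y i) Pr), X y = X' y := by rw [hmap i]; exact hXm.ae_eq_mk
    exact ae_of_ae_map (hY i).aemeasurable this
  have hind' : iIndepFun (fun i w => X' (Y i w)) Pr := hind.comp (fun _ => X') fun _ => hX'm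
  have hm : ∀ i, Measurable fun w => X' (Y i w) := fun i => hX'm.comp (hY i)
  obtain ⟨hi, hcgf⟩ := hX t (by rwa [abs_of_nonneg ht])
  have hi' : Integrable (fun y => exp (t * X' y)) P :=
    hi.congr (hXm.ae_eq_mk.mono fun y hy => by simp only [hy, hX'])
  have hint : ∀ i ∈ Finset.univ, Integrable (fun w => exp (t * X' (Y i w))) Pr := by
    intro i _
    have h1 : Integrable (fun y => exp (t * X' y)) (Measure.map (Y i) Pr) := by rwa [hmap i]
    exact h1.comp_measurable (hY i)
  have hsum := hind'.integrable_exp_mul_sum hm hint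
  have hch := measure_ge_le_exp_mul_mgf (μ := Pr) s ht hsum
  rw [hind'.mgf_sum hm] at hch
  have hmgf : ∀ i, mgf (fun w => X' (Y i w)) Pr t ≤ exp (ν ^ 2 * t ^ 2 / 2) := by
    intro i
    have h1 : mgf (fun w => X' (Y i w)) Pr t = mgf X P t := by
      unfold mgf
      rw [integral_congr_ae (hXm.ae_eq_mk.mono fun y hy => by simp only [hy, hX'] :
        (fun y => exp (t * X y)) =ᵐ[P] fun y => exp (t * X' y)), ← hmap i,
        integral_map (hY i).aemeasurable (by rw [hmap i]; exact hi'.aestronglyMeasurable)]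
    rw [h1]
    exact (log_le_iff_le_exp (mgf_pos hi)).1 hcgf
  have hprod : ∏ i, mgf (fun w => X' (Y i w)) Pr t ≤ exp (n * (ν ^ 2 * t ^ 2 / 2)) := by
    calc ∏ i, mgf (fun w => X' (Y i w)) Pr t ≤ ∏ _i : Fin n, exp (ν ^ 2 * t ^ 2 / 2) :=
          Finset.prod_le_prod (fun _ _ => mgf_nonneg) fun i _ => hmgf i
      _ = _ := by rw [Finset.prod_const, Finset.card_univ, Fintype.card_fin, ← exp_nat_mul]
  have hset : Pr {w | s ≤ ∑ i, X (Y i w)}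
      = Pr {w | s ≤ (∑ i, fun w => X' (Y i w)) w} := by
    refine measure_congr ?_
    filter_upwards [ae_all_iff.2 hae] with w hw
    have : ∑ i, X (Y i w) = (∑ i, fun w => X' (Y i w)) w := by
      rw [Finset.sum_apply]; exact Finset.sum_congr rfl fun i _ => hw i
    change (s ≤ ∑ i, X (Y i w)) = (s ≤ (∑ i, fun w => X' (Y i w)) w)
    rw [this]
  rw [hset, ← ofReal_measureReal]
  refine ENNReal.ofReal_le_ofReal (hch.trans ?_)
  rw [exp_add]
  gcongr

/-- Bernstein's bound for a sum of i.i.d. variables with exponential moments. -/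
theorem iid_tail [IsProbabilityMeasure P] (hY : ∀ i, Measurable (Y i)) (hmap : ∀ i, Measure.map (Y i) Pr = P)
    (hind : iIndepFun Y Pr) {X : 𝓨 → ℝ} (hν : 1 ≤ ν) (hg : 0 < g) (hX : ExpMoment P X ν g)
    (hn : 0 < n) {y : ℝ} (hy : 0 ≤ y) :
    Pr {w | √n * (√2 * ν * √y + (g * √n)⁻¹ * y) < |∑ i, X (Y i w)|}
      ≤ ENNReal.ofReal (2 * exp (-y)) := by
  have hN : 0 < √(n : ℝ) := sqrt_pos.2 (by exact_mod_cast hn)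
  have hNN : √(n : ℝ) ^ 2 = n := sq_sqrt (Nat.cast_nonneg n)
  set N := √(n : ℝ)
  set r := √2 * √y with hr
  have hr0 : 0 ≤ r := by positivity
  have hrr : r ^ 2 = 2 * y := by rw [hr, mul_pow, sq_sqrt (by norm_num), sq_sqrt hy]
  have hs : N * (√2 * ν * √y + (g * N)⁻¹ * y) = N * ν * r + y / g := by
    rw [hr]; field_simp
  rw [hs]
  have hν0 : 0 < ν := by linarith
  -- The Gaussian choice is t = r / (ν √n). When it exceeds g, the endpoint t = g is taken and the
  -- term y / g provides the required decay.
  obtain ⟨t, ht0, htg, ht⟩ : ∃ t : ℝ, 0 ≤ t ∧ t ≤ g ∧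
      -t * (N * ν * r + y / g) + n * (ν ^ 2 * t ^ 2 / 2) ≤ -y := by
    rw [← hNN]
    rcases le_total r (ν * N * g) with h | h
    · refine ⟨r / (ν * N), by positivity, by rw [div_le_iff₀ (by positivity)]; linarith, ?_⟩
      have h1 : -(r / (ν * N)) * (N * ν * r + y / g) + N ^ 2 * (ν ^ 2 * (r / (ν * N)) ^ 2 / 2)
          = - (r ^ 2) / 2 - r / (ν * N) * (y / g) := by field_simp; ring
      rw [h1, hrr]
      have : 0 ≤ r / (ν * N) * (y / g) := by positivity
      linarith
    · refine ⟨g, hg.le, le_rfl, ?_⟩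
      have h1 : g * (y / g) = y := by field_simp
      have h2 : (ν * N * g) * (ν * N * g) ≤ (ν * N * g) * r := by gcongr
      have h3 : 0 ≤ ν * N * g * r := by positivity
      nlinarith
  have hone : ∀ {X : 𝓨 → ℝ}, ExpMoment P X ν g →
      Pr {w | N * ν * r + y / g ≤ ∑ i, X (Y i w)} ≤ ENNReal.ofReal (exp (-y)) := fun hX =>
    (iid_upper_tail hY hmap hind hg hX ht0 htg _).trans
      (ENNReal.ofReal_le_ofReal (exp_le_exp.2 ht))
  calc Pr {w | N * ν * r + y / g < |∑ i, X (Y i w)|}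
      ≤ Pr ({w | N * ν * r + y / g ≤ ∑ i, X (Y i w)} ∪
          {w | N * ν * r + y / g ≤ ∑ i, -X (Y i w)}) := by
        refine measure_mono fun w hw => ?_
        have hw' : N * ν * r + y / g < |∑ i, X (Y i w)| := hw
        rcases lt_abs.1 hw' with h | h
        · exact Or.inl h.le
        · refine Or.inr ?_
          change N * ν * r + y / g ≤ ∑ i, -X (Y i w)
          rw [Finset.sum_neg_distrib]; exact h.le
    _ ≤ ENNReal.ofReal (exp (-y)) + ENNReal.ofReal (exp (-y)) :=
        (measure_union_le _ _).trans (add_le_add (hone hX) (hone hX.neg))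
    _ = _ := by rw [← ENNReal.ofReal_add (exp_pos _).le (exp_pos _).le, two_mul]

end ExpMoments

/-! ### Matrices as operators, and the spectral decomposition of B_G^{1/2} -/

section Operators

variable {p : ℕ}

theorem op_mul_apply (M N : Mat p) (x : Vec p) : op (M * N) x = op M (op N x) := by
  simp [op]

theorem op_one_apply (x : Vec p) : op (1 : Mat p) x = x := by simp [op]

theorem op_add_apply (M N : Mat p) (x : Vec p) : op (M + N) x = op M x + op N x := by simp [op]

theorem op_sub_apply (M N : Mat p) (x : Vec p) : op (M - N) x = op M x - op N x := by simp [op]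

theorem op_neg_apply (M : Mat p) (x : Vec p) : op (-M) x = -op M x := by simp [op]

theorem op_smul_apply (r : ℝ) (M : Mat p) (x : Vec p) : op (r • M) x = r • op M x := by simp [op]

theorem inner_op_comm {M : Mat p} (hM : M.IsHermitian) (x y : Vec p) :
    inner ℝ (op M x) y = inner ℝ x (op M y) := by
  have h : star (op M) = op M := by
    unfold op
    rw [← map_star, Matrix.star_eq_conjTranspose, hM.eq]
  calc inner ℝ (op M x) y = inner ℝ (star (op M) x) y := by rw [h]
    _ = inner ℝ x (op M y) := ContinuousLinearMap.adjoint_inner_left _ _ _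

theorem inner_op_self_nonneg {M : Mat p} (hM : M.PosSemidef) (x : Vec p) :
    0 ≤ inner ℝ x (op M x) := by
  unfold op
  rw [Matrix.inner_toEuclideanCLM]
  simpa using (Matrix.posSemidef_iff_dotProduct_mulVec.1 hM).2 x.ofLp

theorem inner_op_self_pos {M : Mat p} (hM : M.PosDef) {x : Vec p} (hx : x ≠ 0) :
    0 < inner ℝ x (op M x) := by
  unfold op
  rw [Matrix.inner_toEuclideanCLM]
  simpa using (Matrix.posDef_iff_dotProduct_mulVec.1 hM).2 (x := x.ofLp) (by simpa using hx)

theorem posDef_of_inner_pos {M : Mat p} (hM : M.IsHermitian)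
    (h : ∀ x : Vec p, x ≠ 0 → 0 < inner ℝ x (op M x)) : M.PosDef := by
  refine Matrix.posDef_iff_dotProduct_mulVec.2 ⟨hM, fun x hx => ?_⟩
  have := h (WithLp.toLp 2 x) (by simpa using hx)
  unfold op at this
  rw [Matrix.inner_toEuclideanCLM] at this
  simpa using this

theorem norm_op_sq {M : Mat p} (hM : M.IsHermitian) (x : Vec p) :
    ‖op M x‖ ^ 2 = inner ℝ x (op (M * M) x) := by
  rw [← real_inner_self_eq_norm_sq, inner_op_comm hM, op_mul_apply]

theorem trace_mul_self_eq {S : Mat p} (hS : S.IsHermitian) :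
    (S * S).trace = ∑ c, hS.eigenvalues c ^ 2 := by
  conv_lhs => rw [hS.spectral_theorem]
  rw [← map_mul, Matrix.diagonal_mul_diagonal, Unitary.conjStarAlgAut_apply,
    Matrix.trace_mul_cycle, Unitary.coe_star_mul_self, one_mul, Matrix.trace_diagonal]
  simp [sq]

theorem op_eigenvectorBasis {S : Mat p} (hS : S.IsHermitian) (c : Fin p) :
    op S (hS.eigenvectorBasis c) = hS.eigenvalues c • hS.eigenvectorBasis c := by
  have h := hS.mulVec_eigenvectorBasis c
  unfold op
  ext i
  rw [Matrix.ofLp_toEuclideanCLM, h]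
  rfl

variable {Q v₀ : Mat p} {a : ℝ} {n : ℕ}

/-- A positive multiple of Q dominates the definite matrix n v₀²; Q is symmetric because the
difference and v₀² are. -/
theorem posDef_of_ident (hv : v₀.PosDef) (hn : 0 < n) (ha : 0 < a)
    (h : (a ^ 2 • Q - (n : ℝ) • (v₀ * v₀)).PosSemidef) : Q.PosDef := by
  have hvv : ((n : ℝ) • (v₀ * v₀)).IsHermitian := by
    unfold Matrix.IsHermitian
    rw [Matrix.conjTranspose_smul, Matrix.conjTranspose_mul, hv.1.eq]; simp
  have hQ : Q.IsHermitian := by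
    have h1 : Q = (a ^ 2)⁻¹ • ((a ^ 2 • Q - (n : ℝ) • (v₀ * v₀)) + (n : ℝ) • (v₀ * v₀)) := by
      rw [sub_add_cancel, smul_smul, inv_mul_cancel₀ (by positivity), one_smul]
    have h2 := h.1.add hvv
    unfold Matrix.IsHermitian at h2 ⊢
    conv_lhs => rw [h1]
    rw [Matrix.conjTranspose_smul, h2]
    conv_rhs => rw [h1]
    simp
  refine posDef_of_inner_pos hQ fun x hx => ?_
  have h1 := inner_op_self_nonneg h x
  rw [op_sub_apply, op_smul_apply, op_smul_apply, inner_sub_right, inner_smul_right,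
    inner_smul_right, ← norm_op_sq hv.1] at h1
  have h2 : op v₀ x ≠ 0 := by
    intro h0
    have := inner_op_self_pos hv hx
    rw [h0, inner_zero_right] at this
    exact lt_irrefl _ this
  have h3 : 0 < (n : ℝ) * ‖op v₀ x‖ ^ 2 := by
    have : (0 : ℝ) < n := by exact_mod_cast hn
    have := norm_pos_iff.2 h2
    positivity
  have h4 : 0 < a ^ 2 * inner ℝ x (op Q x) := by linarith
  exact pos_of_mul_pos_right h4 (by positivity)

theorem posDef_sqrt {Q : Mat p} (hQ : Q.PosDef) : (CFC.sqrt Q).PosDef :=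
  Matrix.isStrictlyPositive_iff_posDef.1
    (IsStrictlyPositive.sqrt Q (Matrix.isStrictlyPositive_iff_posDef.2 hQ))

theorem sqrt_mul_self_eq {Q : Mat p} (hQ : Q.PosDef) : CFC.sqrt Q * CFC.sqrt Q = Q :=
  CFC.sqrt_mul_sqrt_self Q (Matrix.nonneg_iff_posSemidef.2 hQ.posSemidef)

theorem op_mul_inv_apply {M : Mat p} (hM : M.PosDef) (x : Vec p) : op M (op M⁻¹ x) = x := by
  rw [← op_mul_apply, Matrix.mul_nonsing_inv _ ((Matrix.isUnit_iff_isUnit_det _).1 hM.isUnit),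
    op_one_apply]

theorem op_inv_mul_apply {M : Mat p} (hM : M.PosDef) (x : Vec p) : op M⁻¹ (op M x) = x := by
  rw [← op_mul_apply, Matrix.nonsing_inv_mul _ ((Matrix.isUnit_iff_isUnit_det _).1 hM.isUnit),
    op_one_apply]

/-- The spectral data of `B = D⁻¹ (n v₀²) D⁻¹`, with `D = Q^{1/2}`: an orthonormal basis and the
square roots of the eigenvalues. -/
theorem exists_spectral_data (hv : v₀.PosDef) (hn : 0 < n) (ha : 0 < a)
    (h : (a ^ 2 • Q - (n : ℝ) • (v₀ * v₀)).PosSemidef) :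
    ∃ (e : OrthonormalBasis (Fin p) ℝ (Vec p)) (s : Fin p → ℝ),
      (∀ c, 0 < s c ∧ s c ≤ a) ∧
      ∑ c, s c = (CFC.sqrt ((CFC.sqrt Q)⁻¹ * ((n : ℝ) • (v₀ * v₀)) * (CFC.sqrt Q)⁻¹)).trace ∧
      ∑ c, s c ^ 2 = ((CFC.sqrt Q)⁻¹ * ((n : ℝ) • (v₀ * v₀)) * (CFC.sqrt Q)⁻¹).trace ∧
      ∀ w, n * ‖op v₀ (op (CFC.sqrt Q)⁻¹ w)‖ ^ 2 = ∑ c, s c ^ 2 * inner ℝ (e c) w ^ 2 := by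
  have hQ := posDef_of_ident hv hn ha h
  have hD := posDef_sqrt hQ
  have hDD := sqrt_mul_self_eq hQ
  set D := CFC.sqrt Q
  have hDi := hD.inv
  set B := D⁻¹ * ((n : ℝ) • (v₀ * v₀)) * D⁻¹ with hB
  have hBin : ∀ w, inner ℝ w (op B w) = n * ‖op v₀ (op D⁻¹ w)‖ ^ 2 := by
    intro w
    rw [hB, op_mul_apply, op_mul_apply, ← inner_op_comm hDi.1, op_smul_apply, inner_smul_right,
      ← norm_op_sq hv.1]
  have hBH : B.IsHermitian := by
    unfold Matrix.IsHermitian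
    rw [hB, Matrix.conjTranspose_mul, Matrix.conjTranspose_mul, Matrix.conjTranspose_smul,
      Matrix.conjTranspose_mul, hv.1.eq, hDi.1.eq, Matrix.mul_assoc]
    simp
  have hBP : B.PosDef := by
    refine posDef_of_inner_pos hBH fun x hx => ?_
    rw [hBin]
    have h1 : op D⁻¹ x ≠ 0 := fun h0 => hx (by rw [← op_mul_inv_apply hD x, h0, map_zero])
    have h2 : op v₀ (op D⁻¹ x) ≠ 0 := by
      intro h0
      have := inner_op_self_pos hv h1
      rw [h0, inner_zero_right] at this
      exact lt_irrefl _ this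
    have := norm_pos_iff.2 h2
    have : (0 : ℝ) < n := by exact_mod_cast hn
    positivity
  have hS := posDef_sqrt hBP
  have hSS := sqrt_mul_self_eq hBP
  set S := CFC.sqrt B
  have hw : ∀ w, n * ‖op v₀ (op D⁻¹ w)‖ ^ 2
      = ∑ c, hS.1.eigenvalues c ^ 2 * inner ℝ (hS.1.eigenvectorBasis c) w ^ 2 := by
    intro w
    rw [← hBin, ← hSS, ← norm_op_sq hS.1, ← OrthonormalBasis.sum_sq_norm_inner_right
      hS.1.eigenvectorBasis]
    refine Finset.sum_congr rfl fun c _ => ?_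
    rw [← inner_op_comm hS.1, op_eigenvectorBasis, inner_smul_left, Real.norm_eq_abs, sq_abs,
      mul_pow]
    simp
  refine ⟨hS.1.eigenvectorBasis, hS.1.eigenvalues, fun c => ⟨hS.eigenvalues_pos c, ?_⟩, ?_, ?_, hw⟩
  -- The bound s c ≤ a is identifiability tested on D⁻¹ applied to a unit eigenvector, where D²
  -- takes the value 1.
  · have h1 := hw (hS.1.eigenvectorBasis c)
    have h2 : ∑ c', hS.1.eigenvalues c' ^ 2
        * inner ℝ (hS.1.eigenvectorBasis c') (hS.1.eigenvectorBasis c) ^ 2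
          = hS.1.eigenvalues c ^ 2 := by
      rw [Finset.sum_eq_single c]
      · rw [real_inner_self_eq_norm_sq, hS.1.eigenvectorBasis.norm_eq_one]; ring
      · intro c' _ hc'
        rw [hS.1.eigenvectorBasis.inner_eq_zero hc']; ring
      · simp
    rw [h2] at h1
    have h3 := inner_op_self_nonneg h (op D⁻¹ (hS.1.eigenvectorBasis c))
    rw [op_sub_apply, op_smul_apply, op_smul_apply, inner_sub_right, inner_smul_right,
      inner_smul_right, ← norm_op_sq hv.1, ← hDD, ← norm_op_sq hD.1, op_mul_inv_apply hD,
      hS.1.eigenvectorBasis.norm_eq_one, h1] at h3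
    exact (le_abs_self _).trans (abs_le_of_sq_le_sq (by linarith) ha.le)
  · rw [hS.1.trace_eq_sum_eigenvalues]; simp
  · rw [← hSS, trace_mul_self_eq hS.1]

theorem inner_op_hess (f : Vec p → ℝ) (θ γ₁ γ₂ : Vec p) :
    inner ℝ γ₁ (op (hess f θ) γ₂) = fderiv ℝ (fderiv ℝ f) θ γ₁ γ₂ := by
  have h : ∀ γ : Vec p, γ = ∑ i, γ i • EuclideanSpace.single i (1 : ℝ) := by
    intro γ
    ext j
    simp [Finset.sum_apply, Pi.single_apply]
  unfold op
  rw [Matrix.inner_toEuclideanCLM]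
  conv_rhs => rw [h γ₁, h γ₂]
  simp only [map_sum, map_smul, _root_.sum_apply, _root_.smul_apply,
    smul_eq_mul, dotProduct, Matrix.mulVec, hess, Matrix.of_apply]
  simp only [Finset.mul_sum]
  rw [Finset.sum_comm]
  exact Finset.sum_congr rfl fun i _ => Finset.sum_congr rfl fun j _ => by ring

end Operators

/-! ### Derivatives along segments -/

section Calculus

variable {p : ℕ} {O : Set (Vec p)} {f : Vec p → ℝ} {θ h γ : Vec p}

theorem inner_gradient_eq (f : Vec p → ℝ) (θ γ : Vec p) :
    inner ℝ γ (gradient f θ) = fderiv ℝ f θ γ := by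
  rw [real_inner_comm]
  exact InnerProductSpace.toDual_symm_apply

theorem hasDerivAt_line (θ h : Vec p) (t : ℝ) : HasDerivAt (fun t : ℝ => θ + t • h) h t := by
  simpa using ((hasDerivAt_id t).smul_const h).const_add θ

theorem hasDerivAt_comp_line (hO : IsOpen O) (hf : ContDiffOn ℝ 2 f O) {t : ℝ}
    (ht : θ + t • h ∈ O) :
    HasDerivAt (fun t : ℝ => f (θ + t • h)) (fderiv ℝ f (θ + t • h) h) t := by
  have h1 : HasFDerivAt f (fderiv ℝ f (θ + t • h)) (θ + t • h) :=
    ((hf.contDiffAt (hO.mem_nhds ht)).differentiableAt (by norm_num)).hasFDerivAt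
  exact h1.comp_hasDerivAt t (hasDerivAt_line θ h t)

theorem contDiffOn_fderiv_one (hO : IsOpen O) (hf : ContDiffOn ℝ 2 f O) :
    ContDiffOn ℝ 1 (fderiv ℝ f) O :=
  hf.fderiv_of_isOpen hO (by norm_num)

theorem hasDerivAt_fderiv_comp_line (hO : IsOpen O) (hf : ContDiffOn ℝ 2 f O) {t : ℝ}
    (ht : θ + t • h ∈ O) :
    HasDerivAt (fun t : ℝ => fderiv ℝ f (θ + t • h) γ)
      (fderiv ℝ (fderiv ℝ f) (θ + t • h) h γ) t := by
  have h1 : HasFDerivAt (fderiv ℝ f) (fderiv ℝ (fderiv ℝ f) (θ + t • h)) (θ + t • h) :=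
    (((contDiffOn_fderiv_one hO hf).contDiffAt (hO.mem_nhds ht)).differentiableAt
      (by norm_num)).hasFDerivAt
  have h2 := h1.comp_hasDerivAt t (hasDerivAt_line θ h t)
  have h3 := ((ContinuousLinearMap.apply ℝ ℝ γ).hasFDerivAt
    (x := fderiv ℝ f (θ + t • h))).comp_hasDerivAt t h2
  exact h3

theorem continuousOn_fderiv_line (hO : IsOpen O) (hf : ContDiffOn ℝ 2 f O) {s : Set ℝ}
    (hs : ∀ t ∈ s, θ + t • h ∈ O) (γ : Vec p) :
    ContinuousOn (fun t : ℝ => fderiv ℝ f (θ + t • h) γ) s := fun _ ht =>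
  (hasDerivAt_fderiv_comp_line hO hf (hs _ ht)).continuousAt.continuousWithinAt

theorem continuousOn_fderiv_fderiv_line (hO : IsOpen O) (hf : ContDiffOn ℝ 2 f O) {s : Set ℝ}
    (hs : ∀ t ∈ s, θ + t • h ∈ O) (γ : Vec p) :
    ContinuousOn (fun t : ℝ => fderiv ℝ (fderiv ℝ f) (θ + t • h) h γ) s := by
  have h1 : ContinuousOn (fderiv ℝ (fderiv ℝ f)) O :=
    (contDiffOn_fderiv_one hO hf).continuousOn_fderiv_of_isOpen hO le_rfl
  have h2 : ContinuousOn (fun t : ℝ => fderiv ℝ (fderiv ℝ f) (θ + t • h)) s :=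
    h1.comp (by fun_prop) hs
  exact (h2.clm_apply continuousOn_const).clm_apply continuousOn_const

end Calculus

/-! ### Exponential moments for increments of the likelihood and of its gradient -/

section Model

variable {𝓨 : Type*} [MeasurableSpace 𝓨] {p n : ℕ} {Θ : Set (Vec p)} {P : Measure 𝓨}
  {ℓ : 𝓨 → Vec p → ℝ} {G v₀ : Mat p} {θs : Vec p} {ν g ω δ a u₀ : ℝ} {b : ℝ → ℝ}

theorem zeta_eq_sum (P : Measure 𝓨) (ℓ : 𝓨 → Vec p → ℝ) (ys : Fin n → 𝓨) :
    zeta P ℓ ys = fun θ => ∑ i, zetaOne P ℓ (ys i) θ := by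
  funext θ
  simp [zeta, zetaOne, logLik, Finset.sum_sub_distrib]

theorem penLogLik_eq (G : Mat p) (P : Measure 𝓨) (ℓ : 𝓨 → Vec p → ℝ) (ys : Fin n → 𝓨) :
    penLogLik G ℓ ys = fun θ => meanPenLogLik n G P ℓ θ + zeta P ℓ ys θ := by
  funext θ
  simp only [penLogLik, meanPenLogLik, zeta]
  ring

namespace IIDConditions

variable (h : IIDConditions Θ P ℓ n G v₀ θs ν g ω δ a u₀ b)

include h

theorem contDiffOn_zetaOne (y : 𝓨) : ContDiffOn ℝ 2 (zetaOne P ℓ y) (interior Θ) :=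
  (h.contDiffOn y).sub h.contDiffOn_mean

theorem contDiffOn_zeta (ys : Fin n → 𝓨) : ContDiffOn ℝ 2 (zeta P ℓ ys) (interior Θ) := by
  rw [zeta_eq_sum]
  exact ContDiffOn.sum fun i _ => h.contDiffOn_zetaOne (ys i)

theorem contDiffOn_meanPenLogLik : ContDiffOn ℝ 2 (meanPenLogLik n G P ℓ) (interior Θ) := by
  unfold meanPenLogLik
  refine (contDiffOn_const.mul h.contDiffOn_mean).sub (ContDiff.contDiffOn ?_)
  exact ((op G).contDiff.norm_sq ℝ).div_const 2

theorem fderiv_zeta (ys : Fin n → 𝓨) {θ : Vec p} (hθ : θ ∈ interior Θ) (γ : Vec p) :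
    fderiv ℝ (zeta P ℓ ys) θ γ = ∑ i, fderiv ℝ (zetaOne P ℓ (ys i)) θ γ := by
  rw [zeta_eq_sum, fderiv_fun_sum fun i _ => ((h.contDiffOn_zetaOne (ys i)).contDiffAt
    (isOpen_interior.mem_nhds hθ)).differentiableAt (by norm_num)]
  simp

theorem target_mem_interior (hu₀ : 0 < u₀) : θs ∈ interior Θ := by
  refine h.local_subset ?_
  change ‖op (rootInfo n G P ℓ θs) (θs - θs)‖ ≤ u₀ * √n
  rw [sub_self, map_zero, norm_zero]
  positivity

theorem posDef_penInfo (hn : 0 < n) (ha : 0 < a) : (penInfo n G P ℓ θs).PosDef :=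
  posDef_of_ident h.posDef hn ha h.ident

theorem posDef_rootInfo (hn : 0 < n) (ha : 0 < a) : (rootInfo n G P ℓ θs).PosDef :=
  posDef_sqrt (h.posDef_penInfo hn ha)

/-- The interior of Θ is convex, so the gradient condition holds along the whole segment, with the
fixed direction θ - θ'. -/
theorem expMoment_zetaOne_sub [IsProbabilityMeasure P] (hg : 0 < g) {θ θ' : Vec p}
    (hθ : θ ∈ interior Θ) (hθ' : θ' ∈ interior Θ) :
    ExpMoment P (fun y => (zetaOne P ℓ y θ - zetaOne P ℓ y θ') / ‖op v₀ (θ - θ')‖) ν g := by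
  have hseg : ∀ t ∈ Icc (0 : ℝ) 1, θ' + t • (θ - θ') ∈ interior Θ := fun t ht =>
    h.convex.interior.add_smul_sub_mem hθ' hθ ht
  have := expMoment_increment (P := P) (ν := ν) hg
    (φ := fun y t => zetaOne P ℓ y (θ' + t • (θ - θ')) / ‖op v₀ (θ - θ')‖)
    (φ' := fun y t => fderiv ℝ (zetaOne P ℓ y) (θ' + t • (θ - θ')) (θ - θ') / ‖op v₀ (θ - θ')‖)
    (fun y t ht => (hasDerivAt_comp_line isOpen_interior (h.contDiffOn_zetaOne y)
      (hseg t ht)).div_const _)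
    (fun y => (continuousOn_fderiv_line isOpen_interior (h.contDiffOn_zetaOne y) hseg _).div_const _)
    (fun t ht => by
      have := h.expMoment_grad _ (hseg t ht) (θ - θ')
      simpa only [inner_gradient_eq] using this)
  simpa [← sub_div] using this

/-- The local set is the preimage of a ball under D_G, hence convex, so the Hessian condition holds
along the segment, with directions θ - θ' and γ. -/
theorem expMoment_fderiv_sub [IsProbabilityMeasure P] (hg : 0 < g) {θ θ' γ : Vec p}
    (hθ : θ ∈ localSet n G P ℓ θs (u₀ * √n)) (hθ' : θ' ∈ localSet n G P ℓ θs (u₀ * √n)) :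
    ExpMoment P (fun y => (fderiv ℝ (zetaOne P ℓ y) θ γ - fderiv ℝ (zetaOne P ℓ y) θ' γ)
      / (ω * (‖op v₀ (θ - θ')‖ * ‖op v₀ γ‖))) ν g := by
  have hconv : Convex ℝ (localSet n G P ℓ θs (u₀ * √n)) := by
    have : localSet n G P ℓ θs (u₀ * √n) = (fun θ => op (rootInfo n G P ℓ θs) θ) ⁻¹'
        Metric.closedBall (op (rootInfo n G P ℓ θs) θs) (u₀ * √n) := by
      ext θ
      change ‖op (rootInfo n G P ℓ θs) (θ - θs)‖ ≤ u₀ * √n ↔ _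
      rw [mem_preimage, mem_closedBall_iff_norm, map_sub]
    rw [this]
    exact (convex_closedBall _ _).linear_preimage (op (rootInfo n G P ℓ θs)).toLinearMap
  have hseg : ∀ t ∈ Icc (0 : ℝ) 1, θ' + t • (θ - θ') ∈ localSet n G P ℓ θs (u₀ * √n) :=
    fun t ht => hconv.add_smul_sub_mem hθ' hθ ht
  have hseg' : ∀ t ∈ Icc (0 : ℝ) 1, θ' + t • (θ - θ') ∈ interior Θ := fun t ht =>
    h.local_subset (hseg t ht)
  have := expMoment_increment (P := P) (ν := ν) hg
    (φ := fun y t => fderiv ℝ (zetaOne P ℓ y) (θ' + t • (θ - θ')) γ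
      / (ω * (‖op v₀ (θ - θ')‖ * ‖op v₀ γ‖)))
    (φ' := fun y t => fderiv ℝ (fderiv ℝ (zetaOne P ℓ y)) (θ' + t • (θ - θ')) (θ - θ') γ
      / (ω * (‖op v₀ (θ - θ')‖ * ‖op v₀ γ‖)))
    (fun y t ht => (hasDerivAt_fderiv_comp_line isOpen_interior (h.contDiffOn_zetaOne y)
      (hseg' t ht)).div_const _)
    (fun y => (continuousOn_fderiv_fderiv_line isOpen_interior (h.contDiffOn_zetaOne y)
      hseg' _).div_const _)
    (fun t ht => by
      have := h.expMoment_hess _ (hseg t ht) (θ - θ') γ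
      simp only [inner_op_hess] at this
      convert this using 2 with y
      rw [div_mul_eq_div_div, div_eq_mul_inv _ ω]
      ring)
  simpa [← sub_div] using this

end IIDConditions

/-- The deviation function of a normalized sum of `n` variables with exponential moments. -/
noncomputable def bern (ν g : ℝ) (n : ℕ) (y : ℝ) : ℝ := √2 * ν * √y + (g * √n)⁻¹ * y

variable {Ω : Type*} [MeasurableSpace Ω] {Pr : Measure Ω} [IsProbabilityMeasure Pr]
  {Y : Fin n → Ω → 𝓨}

/-- For κ = 0 the quotient F / κ is 0 by convention and its exponential moments say nothing; `hF0`
covers this case. -/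
theorem iid_tail_scaled [IsProbabilityMeasure P] (hY : ∀ i, Measurable (Y i))
    (hmap : ∀ i, Measure.map (Y i) Pr = P) (hind : iIndepFun Y Pr) (hν : 1 ≤ ν) (hg : 0 < g)
    (hn : 0 < n) {F : 𝓨 → ℝ} {κ B : ℝ} (hκ : 0 ≤ κ) (hF : ExpMoment P (fun y => F y / κ) ν g)
    (hF0 : κ = 0 → ∀ y, F y = 0) (hB : κ * √n ≤ B) {y : ℝ} (hy : 0 ≤ y) :
    Pr {w | B * bern ν g n y < |∑ i, F (Y i w)|} ≤ ENNReal.ofReal (2 * exp (-y)) := by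
  refine (measure_mono fun w hw => ?_).trans (iid_tail hY hmap hind hν hg hF hn hy)
  have hb0 : 0 ≤ bern ν g n y := by unfold bern; positivity
  have hw' : κ * √n * bern ν g n y < |∑ i, F (Y i w)| :=
    (mul_le_mul_of_nonneg_right hB hb0).trans_lt hw
  change √n * bern ν g n y < |∑ i, F (Y i w) / κ|
  rcases hκ.eq_or_lt with h0 | hpos
  · simp [hF0 h0.symm, ← h0] at hw'
  · rw [← Finset.sum_div, abs_div, abs_of_pos hpos, lt_div_iff₀ hpos]
    linarith

end Model

/-! ### Uniform deviations of the likelihood process and of the score -/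

section Model

variable {𝓨 : Type*} [MeasurableSpace 𝓨] {p n : ℕ} {Θ : Set (Vec p)} {P : Measure 𝓨}
  {ℓ : 𝓨 → Vec p → ℝ} {G v₀ : Mat p} {θs : Vec p} {ν g ω δ a u₀ : ℝ} {b : ℝ → ℝ}
  {Ω : Type*} [MeasurableSpace Ω] {Pr : Measure Ω}
  {Y : Fin n → Ω → 𝓨}

/-- The orthonormal basis `e` and the positive numbers `s ≤ a` diagonalize
`(D_G⁻¹ (n v₀²) D_G⁻¹)^{1/2}`. -/
structure SpectralData (n : ℕ) (G v₀ : Mat p) (P : Measure 𝓨) (ℓ : 𝓨 → Vec p → ℝ) (θs : Vec p)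
    (a : ℝ) (e : OrthonormalBasis (Fin p) ℝ (Vec p)) (s : Fin p → ℝ) : Prop where
  pos : ∀ c, 0 < s c
  le : ∀ c, s c ≤ a
  sum_eq : ∑ c, s c = penEntropy n G v₀ P ℓ θs
  sum_sq_eq : ∑ c, s c ^ 2 = effDim n G v₀ P ℓ θs
  norm_sq : ∀ w, n * ‖op v₀ (op (rootInfo n G P ℓ θs)⁻¹ w)‖ ^ 2
    = ∑ c, s c ^ 2 * inner ℝ (e c) w ^ 2

/-- The deviation bound of `ellipsoid_chaining` in terms of the effective dimension `d` and the
entropy `E`. -/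
noncomputable def chainBound (ν g : ℝ) (n : ℕ) (d E y : ℝ) : ℝ :=
  400 * (√2 * ν * √(d + y + 1) + (g * √n)⁻¹ * (E + y + 1))

theorem exists_spectralData (h : IIDConditions Θ P ℓ n G v₀ θs ν g ω δ a u₀ b) (hn : 0 < n)
    (ha : 0 < a) : ∃ e s, SpectralData n G v₀ P ℓ θs a e s := by
  obtain ⟨e, s, h1, h2, h3, h4⟩ := exists_spectral_data h.posDef hn ha h.ident
  exact ⟨e, s, fun c => (h1 c).1, fun c => (h1 c).2, h2, h3, h4⟩

namespace SpectralData

variable {e : OrthonormalBasis (Fin p) ℝ (Vec p)} {s : Fin p → ℝ}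
  (hs : SpectralData n G v₀ P ℓ θs a e s)

include hs

theorem axes (ha : 0 < a) (c : Fin p) : 0 < s c / a ∧ s c / a ≤ 1 :=
  ⟨div_pos (hs.pos c) ha, (div_le_one ha).2 (hs.le c)⟩

theorem norm_le (hn : 0 < n) (ha : 0 < a) (w : Vec p) :
    ‖op v₀ (op (rootInfo n G P ℓ θs)⁻¹ w)‖ ≤ a / √n * ‖w‖ := by
  have hN : (0 : ℝ) < n := by exact_mod_cast hn
  have h1 : n * ‖op v₀ (op (rootInfo n G P ℓ θs)⁻¹ w)‖ ^ 2 ≤ a ^ 2 * ‖w‖ ^ 2 := by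
    rw [hs.norm_sq, ← OrthonormalBasis.sum_sq_norm_inner_right e, Finset.mul_sum]
    refine Finset.sum_le_sum fun c _ => ?_
    rw [Real.norm_eq_abs, sq_abs]
    have := pow_le_pow_left₀ (hs.pos c).le (hs.le c) 2
    gcongr
  have h2 : (√n * ‖op v₀ (op (rootInfo n G P ℓ θs)⁻¹ w)‖) ^ 2 ≤ (a * ‖w‖) ^ 2 := by
    rw [mul_pow, mul_pow, sq_sqrt hN.le]; exact h1
  have h3 := (le_abs_self _).trans (abs_le_of_sq_le_sq h2 (by positivity))
  rw [div_mul_eq_mul_div, le_div_iff₀ (sqrt_pos.2 hN)]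
  linarith

/-- The link between the model and chaining: the scale ‖v₀ ·‖ of the exponential moments is exactly
an ellipsoid distance in the eigenbasis. Division by r puts the vicinity into the unit ball, and
division by a puts the semi-axes into (0, 1]. -/
theorem norm_eq_sqrt_dsq (hn : 0 < n) (ha : 0 < a) {r : ℝ} (hr : 0 < r) (w w' : Vec p) :
    ‖op v₀ (op (rootInfo n G P ℓ θs)⁻¹ (w - w'))‖ * √n
      = r * a * √(dsq (fun c => s c / a) (fun c => inner ℝ (e c) w / r)
          (fun c => inner ℝ (e c) w' / r)) := by
  have h1 : dsq (fun c => s c / a) (fun c => inner ℝ (e c) w / r) (fun c => inner ℝ (e c) w' / r)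
      = n * ‖op v₀ (op (rootInfo n G P ℓ θs)⁻¹ (w - w'))‖ ^ 2 / (r * a) ^ 2 := by
    rw [hs.norm_sq, Finset.sum_div]
    refine Finset.sum_congr rfl fun c _ => ?_
    rw [inner_sub_right]
    field_simp
  rw [h1, sqrt_div (by positivity), sqrt_sq (by positivity), sqrt_mul (Nat.cast_nonneg _),
    sqrt_sq (norm_nonneg _)]
  field_simp

end SpectralData

theorem sum_sq_coord_le (e : OrthonormalBasis (Fin p) ℝ (Vec p)) {r : ℝ} (hr : 0 < r) {w : Vec p} (hw : ‖w‖ ≤ r) :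
    ∑ c, (inner ℝ (e c) w / r) ^ 2 ≤ 1 := by
  simp only [div_pow]
  rw [← Finset.sum_div, div_le_one (by positivity)]
  have := OrthonormalBasis.sum_sq_norm_inner_right e w
  simp only [Real.norm_eq_abs, sq_abs] at this
  rw [this]
  gcongr

theorem sum_coord_smul (e : OrthonormalBasis (Fin p) ℝ (Vec p)) {r : ℝ} (hr : 0 < r) (w : Vec p) :
    r • ∑ c, (inner ℝ (e c) w / r) • e c = w := by
  rw [Finset.smul_sum]
  simp only [smul_smul]
  conv_rhs => rw [← e.sum_repr' w]
  refine Finset.sum_congr rfl fun c _ => ?_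
  congr 1
  field_simp

theorem tendsto_of_coord (e : OrthonormalBasis (Fin p) ℝ (Vec p)) {r : ℝ} (hr : 0 < r)
    {w : ℕ → Vec p} {w' : Vec p}
    (h : Tendsto (fun l c => inner ℝ (e c) (w l) / r) atTop (𝓝 fun c => inner ℝ (e c) w' / r)) :
    Tendsto w atTop (𝓝 w') := by
  have h1 : Continuous fun u : Fin p → ℝ => r • ∑ c, u c • e c := by fun_prop
  have h2 := (h1.tendsto _).comp h
  simp only [sum_coord_smul e hr] at h2
  refine h2.congr fun l => ?_
  exact sum_coord_smul e hr (w l)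

section Processes

variable [IsProbabilityMeasure P] [IsProbabilityMeasure Pr]
  {e : OrthonormalBasis (Fin p) ℝ (Vec p)} {s : Fin p → ℝ}

/-- Uniform deviations of the log-likelihood process over a vicinity of the target. -/
theorem zeta_deviation (h : IIDConditions Θ P ℓ n G v₀ θs ν g ω δ a u₀ b)
    (hs : SpectralData n G v₀ P ℓ θs a e s) (hY : ∀ i, Measurable (Y i))
    (hmap : ∀ i, Measure.map (Y i) Pr = P) (hind : iIndepFun Y Pr) (hν : 1 ≤ ν) (hg : 0 < g)
    (ha : 0 < a) (hu₀ : 0 < u₀) (hn : 0 < n) {r : ℝ} (hr : 0 < r) {y : ℝ} (hy : 0 ≤ y) :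
    Pr {w | ∃ θ ∈ interior Θ, ‖op (rootInfo n G P ℓ θs) (θ - θs)‖ ≤ r ∧
      r * a * chainBound ν g n (effDim n G v₀ P ℓ θs / a ^ 2) (penEntropy n G v₀ P ℓ θs / a) y
        < |zeta P ℓ (fun i => Y i w) θ - zeta P ℓ (fun i => Y i w) θs|}
      ≤ ENNReal.ofReal (exp (-y)) := by
  have hDpos := h.posDef_rootInfo hn ha
  have hθs := h.target_mem_interior hu₀
  set D := rootInfo n G P ℓ θs with hD
  let T := {θ : Vec p // θ ∈ interior Θ ∧ ‖op D (θ - θs)‖ ≤ r}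
  let t₀ : T := ⟨θs, hθs, by rw [sub_self, map_zero, norm_zero]; exact hr.le⟩
  have hra : 0 < r * a := by positivity
  have hmain := ellipsoid_chaining Pr (fun c => s c / a) (hs.axes ha)
    (fun (t : T) c => inner ℝ (e c) (op D (t.1 - θs)) / r)
    (fun t => sum_sq_coord_le e hr t.2.2) t₀ (by funext c; simp [t₀])
    (fun t w => zeta P ℓ (fun i => Y i w) t.1 / (r * a)) (√2 * ν) (g * √n)⁻¹
    (by positivity) (by positivity) ?_ ?_ hy
  · refine (measure_mono ?_).trans hmain
    rintro w ⟨θ, hθ, hθr, hlt⟩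
    refine ⟨⟨θ, hθ, hθr⟩, ?_⟩
    rw [← sub_div, abs_div, abs_of_pos hra, lt_div_iff₀ hra, ← hs.sum_eq, ← hs.sum_sq_eq] at *
    have h1 : ∑ c, (s c / a) ^ 2 = (∑ c, s c ^ 2) / a ^ 2 := by
      simp only [div_pow]; rw [Finset.sum_div]
    have h2 : ∑ c, s c / a = (∑ c, s c) / a := by rw [Finset.sum_div]
    rw [h1, h2]
    unfold chainBound at hlt
    rw [mul_comm]
    exact hlt
  · intro t t' y hy
    have hsub : t.1 - t'.1 = op D⁻¹ (op D (t.1 - θs) - op D (t'.1 - θs)) := by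
      rw [← map_sub, sub_sub_sub_cancel_right, op_inv_mul_apply hDpos]
    have hnorm := hs.norm_eq_sqrt_dsq hn ha hr (op D (t.1 - θs)) (op D (t'.1 - θs))
    rw [← hD, ← hsub] at hnorm
    have htail := iid_tail_scaled hY hmap hind hν hg hn (norm_nonneg (op v₀ (t.1 - t'.1)))
      (h.expMoment_zetaOne_sub hg t.2.1 t'.2.1) (fun h0 y => ?_) hnorm.le hy
    · refine (measure_mono fun w hw => ?_).trans (htail.trans (ENNReal.ofReal_le_ofReal ?_))
      · change _ < |zeta P ℓ (fun i => Y i w) t.1 / (r * a)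
          - zeta P ℓ (fun i => Y i w) t'.1 / (r * a)| at hw
        rw [← sub_div, abs_div, abs_of_pos hra, lt_div_iff₀ hra, zeta_eq_sum] at hw
        change _ < |∑ i, (zetaOne P ℓ (Y i w) t.1 - zetaOne P ℓ (Y i w) t'.1)|
        rw [Finset.sum_sub_distrib]
        refine lt_of_le_of_lt (le_of_eq ?_) hw
        unfold bern
        ring
      · have := exp_pos (-y); linarith
    · have h1 : t.1 - t'.1 = 0 := by
        by_contra hne
        have := inner_op_self_pos h.posDef hne
        rw [norm_eq_zero.1 h0, inner_zero_right] at this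
        exact lt_irrefl _ this
      rw [sub_eq_zero.1 h1, sub_self]
  · intro w t tl htl
    have h1 := tendsto_of_coord e hr htl
    have h2 : Tendsto (fun l => (tl l).1) atTop (𝓝 t.1) := by
      have h3 : Continuous fun x : Vec p => θs + op D⁻¹ x := by fun_prop
      have h4 := (h3.tendsto _).comp h1
      simp only [Function.comp_def, op_inv_mul_apply hDpos, add_sub_cancel] at h4
      exact h4
    exact (((h.contDiffOn_zeta fun i => Y i w).continuousOn.continuousAt
      (isOpen_interior.mem_nhds t.2.1)).tendsto.comp h2).div_const _

/-- Deviations of the norm of the normalized score. -/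
theorem score_deviation (h : IIDConditions Θ P ℓ n G v₀ θs ν g ω δ a u₀ b)
    (hs : SpectralData n G v₀ P ℓ θs a e s) (hY : ∀ i, Measurable (Y i))
    (hmap : ∀ i, Measure.map (Y i) Pr = P) (hind : iIndepFun Y Pr) (hν : 1 ≤ ν) (hg : 0 < g)
    (ha : 0 < a) (hu₀ : 0 < u₀) (hn : 0 < n) {y : ℝ} (hy : 0 ≤ y) :
    Pr {w | ∃ γ : Vec p, ‖γ‖ ≤ 1 ∧
      a * chainBound ν g n (effDim n G v₀ P ℓ θs / a ^ 2) (penEntropy n G v₀ P ℓ θs / a) y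
        < |fderiv ℝ (zeta P ℓ (fun i => Y i w)) θs (op (rootInfo n G P ℓ θs)⁻¹ γ)|}
      ≤ ENNReal.ofReal (exp (-y)) := by
  have hDpos := h.posDef_rootInfo hn ha
  have hθs := h.target_mem_interior hu₀
  set D := rootInfo n G P ℓ θs with hD
  let T := {γ : Vec p // ‖γ‖ ≤ 1}
  let t₀ : T := ⟨0, by simp⟩
  have hmain := ellipsoid_chaining Pr (fun c => s c / a) (hs.axes ha)
    (fun (t : T) c => inner ℝ (e c) t.1 / 1)
    (fun t => sum_sq_coord_le e one_pos t.2) t₀ (by funext c; simp [t₀])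
    (fun t w => fderiv ℝ (zeta P ℓ (fun i => Y i w)) θs (op D⁻¹ t.1) / a) (√2 * ν) (g * √n)⁻¹
    (by positivity) (by positivity) ?_ ?_ hy
  · refine (measure_mono ?_).trans hmain
    rintro w ⟨γ, hγ, hlt⟩
    refine ⟨⟨γ, hγ⟩, ?_⟩
    rw [← hs.sum_eq, ← hs.sum_sq_eq] at hlt
    rw [← sub_div, abs_div, abs_of_pos ha, lt_div_iff₀ ha]
    have h1 : ∑ c, (s c / a) ^ 2 = (∑ c, s c ^ 2) / a ^ 2 := by
      simp only [div_pow]; rw [Finset.sum_div]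
    have h2 : ∑ c, s c / a = (∑ c, s c) / a := by rw [Finset.sum_div]
    rw [h1, h2]
    unfold chainBound at hlt
    rw [mul_comm]
    simpa [t₀] using hlt
  · intro t t' y hy
    have hnorm := hs.norm_eq_sqrt_dsq hn ha one_pos t.1 t'.1
    rw [← hD] at hnorm
    have htail := iid_tail_scaled (P := P) (ν := ν) hY hmap hind hν hg hn
      (F := fun y => fderiv ℝ (zetaOne P ℓ y) θs (op D⁻¹ (t.1 - t'.1)))
      (norm_nonneg (op v₀ (op D⁻¹ (t.1 - t'.1))))
      (by simpa only [inner_gradient_eq] using h.expMoment_grad θs hθs (op D⁻¹ (t.1 - t'.1)))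
      (fun h0 y => ?_) hnorm.le hy
    · refine (measure_mono fun w hw => ?_).trans (htail.trans (ENNReal.ofReal_le_ofReal ?_))
      · change _ < |fderiv ℝ (zeta P ℓ (fun i => Y i w)) θs (op D⁻¹ t.1) / a
          - fderiv ℝ (zeta P ℓ (fun i => Y i w)) θs (op D⁻¹ t'.1) / a| at hw
        rw [← sub_div, ← map_sub, ← map_sub, abs_div, abs_of_pos ha, lt_div_iff₀ ha,
          h.fderiv_zeta _ hθs] at hw
        refine lt_of_le_of_lt (le_of_eq ?_) hw
        unfold bern
        ring
      · have := exp_pos (-y); linarith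
    · have h1 : op D⁻¹ (t.1 - t'.1) = 0 := by
        by_contra hne
        have := inner_op_self_pos h.posDef hne
        rw [norm_eq_zero.1 h0, inner_zero_right] at this
        exact lt_irrefl _ this
      simp only [h1, map_zero]
  · intro w t tl htl
    have h1 := tendsto_of_coord e one_pos htl
    have h3 : Continuous fun x : Vec p =>
        fderiv ℝ (zeta P ℓ (fun i => Y i w)) θs (op D⁻¹ x) / a := by fun_prop
    exact (h3.tendsto _).comp h1

end Processes

end Model

/-! ### Uniform deviations of the gradient process -/

section Model

variable {𝓨 : Type*} [MeasurableSpace 𝓨] {p n : ℕ} {Θ : Set (Vec p)} {P : Measure 𝓨}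
  {ℓ : 𝓨 → Vec p → ℝ} {G v₀ : Mat p} {θs : Vec p} {ν g ω δ a u₀ : ℝ} {b : ℝ → ℝ}
  {Ω : Type*} [MeasurableSpace Ω] {Pr : Measure Ω} {Y : Fin n → Ω → 𝓨}
  [IsProbabilityMeasure P] [IsProbabilityMeasure Pr]
  {e : OrthonormalBasis (Fin p) ℝ (Vec p)} {s : Fin p → ℝ}

theorem op_eq_zero_of_posDef {M : Mat p} (hM : M.PosDef) {x : Vec p} (h : op M x = 0) : x = 0 := by
  by_contra hne
  have := inner_op_self_pos hM hne
  rw [h, inner_zero_right] at this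
  exact lt_irrefl _ this

theorem add_le_sqrt_two_mul {A B : ℝ} (hA : 0 ≤ A) (hB : 0 ≤ B) : √A + √B ≤ √2 * √(A + B) := by
  rw [← sqrt_mul (by norm_num)]
  refine le_sqrt_of_sq_le ?_
  nlinarith [sq_nonneg (√A - √B), sq_sqrt hA, sq_sqrt hB]

/-- Uniform deviations of the gradient process over a vicinity of the target. -/
theorem gradient_deviation (h : IIDConditions Θ P ℓ n G v₀ θs ν g ω δ a u₀ b)
    (hs : SpectralData n G v₀ P ℓ θs a e s) (hY : ∀ i, Measurable (Y i))
    (hmap : ∀ i, Measure.map (Y i) Pr = P) (hind : iIndepFun Y Pr) (hν : 1 ≤ ν) (hg : 0 < g)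
    (hω : 0 < ω) (ha : 0 < a) (hn : 0 < n) {r : ℝ} (hr : 0 < r)
    (hru : r ≤ u₀ * √n) {y : ℝ} (hy : 0 ≤ y) :
    Pr {w | ∃ θ γ : Vec p, ‖op (rootInfo n G P ℓ θs) (θ - θs)‖ ≤ r ∧ ‖γ‖ ≤ 1 ∧
      2 * ω * a ^ 2 * r / √n * chainBound ν g n (2 * (effDim n G v₀ P ℓ θs / a ^ 2))
          (2 * (penEntropy n G v₀ P ℓ θs / a)) y
        < |fderiv ℝ (zeta P ℓ (fun i => Y i w)) θ (op (rootInfo n G P ℓ θs)⁻¹ γ)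
          - fderiv ℝ (zeta P ℓ (fun i => Y i w)) θs (op (rootInfo n G P ℓ θs)⁻¹ γ)|}
      ≤ ENNReal.ofReal (exp (-y)) := by
  have hDpos := h.posDef_rootInfo hn ha
  have hloc : ∀ θ : Vec p, ‖op (rootInfo n G P ℓ θs) (θ - θs)‖ ≤ r →
      θ ∈ localSet n G P ℓ θs (u₀ * √n) := fun θ hθ => le_trans hθ hru
  have hint : ∀ θ : Vec p, ‖op (rootInfo n G P ℓ θs) (θ - θs)‖ ≤ r → θ ∈ interior Θ :=
    fun θ hθ => h.local_subset (hloc θ hθ)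
  have hnormle := hs.norm_le hn ha
  have hnormeq := fun {r : ℝ} (hr : 0 < r) w w' => hs.norm_eq_sqrt_dsq hn ha hr w w'
  set D := rootInfo n G P ℓ θs with hD
  have hN : 0 < √(n : ℝ) := sqrt_pos.2 (by exact_mod_cast hn)
  set N := √(n : ℝ) with hNdef
  have hθs : ‖op D (θs - θs)‖ ≤ r := by rw [sub_self, map_zero, norm_zero]; exact hr.le
  let T := {x : Vec p × Vec p // ‖op D (x.1 - θs)‖ ≤ r ∧ ‖x.2‖ ≤ 1}
  let t₀ : T := ⟨(θs, 0), hθs, by simp⟩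
  have h2 : (0 : ℝ) < √2 := by positivity
  have hr2 : 0 < √2 * r := by positivity
  set Λ := 2 * ω * a ^ 2 * r / N with hΛ
  have hΛpos : 0 < Λ := by positivity
  have hF0 : ∀ {x γ : Vec p}, ω * (‖op v₀ x‖ * ‖op v₀ γ‖) = 0 → x = 0 ∨ γ = 0 := by
    intro x γ h0
    rcases mul_eq_zero.1 h0 with h1 | h1
    · exact absurd h1 hω.ne'
    · rcases mul_eq_zero.1 h1 with h1 | h1
      · exact Or.inl (op_eq_zero_of_posDef h.posDef (norm_eq_zero.1 h1))
      · exact Or.inr (op_eq_zero_of_posDef h.posDef (norm_eq_zero.1 h1))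
  set c₁ : Vec p → Fin p → ℝ := fun θ c => inner ℝ (e c) (op D (θ - θs)) / (√2 * r) with hc₁
  set c₂ : Vec p → Fin p → ℝ := fun γ c => inner ℝ (e c) γ / √2 with hc₂
  -- The index is the pair (θ, γ), so the semi-axes are taken twice; dividing by √2 keeps the joint
  -- coordinates in the unit ball.
  have hmain := ellipsoid_chaining Pr (Sum.elim (fun c => s c / a) fun c => s c / a)
    (by rintro (c | c) <;> exact hs.axes ha c)
    (fun (t : T) => Sum.elim (c₁ t.1.1) (c₂ t.1.2)) ?_ t₀
    (by funext c; rcases c with c | c <;> simp [t₀, hc₁, hc₂])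
    (fun t w => (fderiv ℝ (zeta P ℓ (fun i => Y i w)) t.1.1 (op D⁻¹ t.1.2)
      - fderiv ℝ (zeta P ℓ (fun i => Y i w)) θs (op D⁻¹ t.1.2)) / Λ) (√2 * ν) (g * N)⁻¹
    (by positivity) (by positivity) ?_ ?_ hy
  · refine (measure_mono ?_).trans hmain
    rintro w ⟨θ, γ, hθ, hγ, hlt⟩
    refine ⟨⟨(θ, γ), hθ, hγ⟩, ?_⟩
    rw [← hs.sum_eq, ← hs.sum_sq_eq] at hlt
    rw [← sub_div, abs_div, abs_of_pos hΛpos, lt_div_iff₀ hΛpos]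
    have h1 : ∑ c, (s c / a) ^ 2 = (∑ c, s c ^ 2) / a ^ 2 := by
      simp only [div_pow]; rw [Finset.sum_div]
    have h2 : ∑ c, s c / a = (∑ c, s c) / a := by rw [Finset.sum_div]
    rw [Fintype.sum_sum_type, Fintype.sum_sum_type]
    simp only [Sum.elim_inl, Sum.elim_inr]
    rw [h1, h2, ← two_mul, ← two_mul, mul_comm]
    unfold chainBound at hlt
    simpa [t₀] using hlt
  · intro t
    rw [Fintype.sum_sum_type]
    simp only [Sum.elim_inl, Sum.elim_inr, hc₁, hc₂, div_pow, mul_pow,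
      sq_sqrt (by norm_num : (0 : ℝ) ≤ 2)]
    have h3 := sum_sq_coord_le e hr t.2.1
    have h4 := sum_sq_coord_le e one_pos t.2.2
    simp only [div_pow, div_one] at h3 h4
    have h5 : ∑ c, inner ℝ (e c) (op D (t.1.1 - θs)) ^ 2 / (2 * r ^ 2)
        = (∑ c, inner ℝ (e c) (op D (t.1.1 - θs)) ^ 2 / r ^ 2) / 2 := by
      rw [Finset.sum_div]; exact Finset.sum_congr rfl fun c _ => by rw [div_div, mul_comm]
    have h6 : ∑ c, inner ℝ (e c) t.1.2 ^ 2 / 2 = (∑ c, inner ℝ (e c) t.1.2 ^ 2) / 2 := by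
      rw [Finset.sum_div]
    rw [h5, h6]
    linarith
  · intro t t' y hy
    -- The increment splits into a change of θ with γ fixed, and a change of γ at θ' relative to the
    -- target. Each part has tail 2 exp (-y), whence the factor 4 in the hypothesis of
    -- `ellipsoid_chaining`.
    have hpart1 : ω * (‖op v₀ (t.1.1 - t'.1.1)‖ * ‖op v₀ (op D⁻¹ t.1.2)‖) * N
        ≤ Λ * (√(dsq (fun c => s c / a) (c₁ t.1.1) (c₁ t'.1.1)) / √2) := by
      have hsub : t.1.1 - t'.1.1 = op D⁻¹ (op D (t.1.1 - θs) - op D (t'.1.1 - θs)) := by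
        rw [← map_sub, sub_sub_sub_cancel_right, op_inv_mul_apply hDpos]
      have h3 := hnormeq hr2 (op D (t.1.1 - θs)) (op D (t'.1.1 - θs))
      rw [← hsub] at h3
      have h4 : ‖op v₀ (op D⁻¹ t.1.2)‖ ≤ a / N :=
        (hnormle t.1.2).trans (mul_le_of_le_one_right (by positivity) t.2.2)
      calc ω * (‖op v₀ (t.1.1 - t'.1.1)‖ * ‖op v₀ (op D⁻¹ t.1.2)‖) * N
          = ω * ‖op v₀ (op D⁻¹ t.1.2)‖ * (‖op v₀ (t.1.1 - t'.1.1)‖ * N) := by ring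
        _ ≤ ω * (a / N) * (‖op v₀ (t.1.1 - t'.1.1)‖ * N) := by gcongr
        _ = Λ * (√(dsq (fun c => s c / a) (c₁ t.1.1) (c₁ t'.1.1)) * (√2 / 2)) := by
            rw [h3, hΛ, hc₁]; ring
        _ = _ := by rw [sqrt_div_self, div_eq_mul_inv _ √2]
    have hpart2 : ω * (‖op v₀ (t'.1.1 - θs)‖ * ‖op v₀ (op D⁻¹ (t.1.2 - t'.1.2))‖) * N
        ≤ Λ * (√(dsq (fun c => s c / a) (c₂ t.1.2) (c₂ t'.1.2)) / √2) := by
      have h3 := hnormeq h2 t.1.2 t'.1.2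
      have h4 : ‖op v₀ (t'.1.1 - θs)‖ ≤ a / N * r := by
        have := hnormle (op D (t'.1.1 - θs))
        rw [op_inv_mul_apply hDpos] at this
        exact this.trans (by gcongr; exact t'.2.1)
      calc ω * (‖op v₀ (t'.1.1 - θs)‖ * ‖op v₀ (op D⁻¹ (t.1.2 - t'.1.2))‖) * N
          = ω * ‖op v₀ (t'.1.1 - θs)‖ * (‖op v₀ (op D⁻¹ (t.1.2 - t'.1.2))‖ * N) := by ring
        _ ≤ ω * (a / N * r) * (‖op v₀ (op D⁻¹ (t.1.2 - t'.1.2))‖ * N) := by gcongr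
        _ = Λ * (√(dsq (fun c => s c / a) (c₂ t.1.2) (c₂ t'.1.2)) * (√2 / 2)) := by
            rw [h3, hΛ, hc₂]; ring
        _ = _ := by rw [sqrt_div_self, div_eq_mul_inv _ √2]
    have htail1 := iid_tail_scaled (P := P) (ν := ν) hY hmap hind hν hg hn
      (F := fun y => fderiv ℝ (zetaOne P ℓ y) t.1.1 (op D⁻¹ t.1.2)
        - fderiv ℝ (zetaOne P ℓ y) t'.1.1 (op D⁻¹ t.1.2)) (by positivity)
      (h.expMoment_fderiv_sub hg (hloc _ t.2.1) (hloc _ t'.2.1)) (fun h0 y => by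
        rcases hF0 h0 with h1 | h1
        · rw [sub_eq_zero.1 h1, sub_self]
        · rw [h1, map_zero, map_zero, sub_self]) hpart1 hy
    have htail2 := iid_tail_scaled (P := P) (ν := ν) hY hmap hind hν hg hn
      (F := fun y => fderiv ℝ (zetaOne P ℓ y) t'.1.1 (op D⁻¹ (t.1.2 - t'.1.2))
        - fderiv ℝ (zetaOne P ℓ y) θs (op D⁻¹ (t.1.2 - t'.1.2))) (by positivity)
      (h.expMoment_fderiv_sub hg (hloc _ t'.2.1) (hloc _ hθs)) (fun h0 y => by
        rcases hF0 h0 with h1 | h1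
        · rw [sub_eq_zero.1 h1, sub_self]
        · rw [h1, map_zero, map_zero, sub_self]) hpart2 hy
    refine le_trans (measure_mono fun w hw => ?_) ((measure_union_le _ _).trans
      ((add_le_add htail1 htail2).trans (le_of_eq ?_)))
    · by_contra hcon
      rw [mem_union, not_or] at hcon
      have h5 : |∑ i, (fderiv ℝ (zetaOne P ℓ (Y i w)) t.1.1 (op D⁻¹ t.1.2)
          - fderiv ℝ (zetaOne P ℓ (Y i w)) t'.1.1 (op D⁻¹ t.1.2))|
          ≤ Λ * (√(dsq (fun c => s c / a) (c₁ t.1.1) (c₁ t'.1.1)) / √2) * bern ν g n y :=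
        not_lt.1 hcon.1
      have h6 : |∑ i, (fderiv ℝ (zetaOne P ℓ (Y i w)) t'.1.1 (op D⁻¹ (t.1.2 - t'.1.2))
          - fderiv ℝ (zetaOne P ℓ (Y i w)) θs (op D⁻¹ (t.1.2 - t'.1.2)))|
          ≤ Λ * (√(dsq (fun c => s c / a) (c₂ t.1.2) (c₂ t'.1.2)) / √2) * bern ν g n y :=
        not_lt.1 hcon.2
      rw [Finset.sum_sub_distrib, ← h.fderiv_zeta _ (hint _ t.2.1),
        ← h.fderiv_zeta _ (hint _ t'.2.1)] at h5
      rw [Finset.sum_sub_distrib, ← h.fderiv_zeta _ (hint _ t'.2.1),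
        ← h.fderiv_zeta _ (hint _ hθs)] at h6
      change (_ : ℝ) < _ at hw
      refine absurd hw (not_lt.2 ?_)
      rw [← sub_div, abs_div, abs_of_pos hΛpos, div_le_iff₀ hΛpos]
      have hdsq : dsq (Sum.elim (fun c => s c / a) fun c => s c / a)
          (Sum.elim (c₁ t.1.1) (c₂ t.1.2)) (Sum.elim (c₁ t'.1.1) (c₂ t'.1.2))
          = dsq (fun c => s c / a) (c₁ t.1.1) (c₁ t'.1.1)
            + dsq (fun c => s c / a) (c₂ t.1.2) (c₂ t'.1.2) := by
        unfold dsq; rw [Fintype.sum_sum_type]; rfl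
      rw [hdsq]
      have h7 := add_le_sqrt_two_mul (dsq_nonneg (fun c => s c / a) (c₁ t.1.1) (c₁ t'.1.1))
        (dsq_nonneg (fun c => s c / a) (c₂ t.1.2) (c₂ t'.1.2))
      have hb0 : 0 ≤ bern ν g n y := by unfold bern; positivity
      have hbern : √2 * ν * √y + (g * N)⁻¹ * y = bern ν g n y := rfl
      rw [hbern]
      simp only [map_sub] at h6 ⊢
      set A := √(dsq (fun c => s c / a) (c₁ t.1.1) (c₁ t'.1.1))
      set B := √(dsq (fun c => s c / a) (c₂ t.1.2) (c₂ t'.1.2))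
      set z := zeta P ℓ fun i => Y i w
      calc |fderiv ℝ z t.1.1 (op D⁻¹ t.1.2) - fderiv ℝ z θs (op D⁻¹ t.1.2)
            - (fderiv ℝ z t'.1.1 (op D⁻¹ t'.1.2) - fderiv ℝ z θs (op D⁻¹ t'.1.2))|
          = |(fderiv ℝ z t.1.1 (op D⁻¹ t.1.2) - fderiv ℝ z t'.1.1 (op D⁻¹ t.1.2))
            + (fderiv ℝ z t'.1.1 (op D⁻¹ t.1.2) - fderiv ℝ z t'.1.1 (op D⁻¹ t'.1.2)
              - (fderiv ℝ z θs (op D⁻¹ t.1.2) - fderiv ℝ z θs (op D⁻¹ t'.1.2)))| := by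
            congr 1; ring
        _ ≤ Λ * (A / √2) * bern ν g n y + Λ * (B / √2) * bern ν g n y :=
            (abs_add_le _ _).trans (add_le_add h5 h6)
        _ = ((A + B) / √2) * (bern ν g n y * Λ) := by ring
        _ ≤ _ := by
            rw [mul_assoc]
            gcongr
            rw [div_le_iff₀ h2]; linarith
    · rw [← ENNReal.ofReal_add (by positivity) (by positivity)]
      congr 1; ring
  · intro w t tl htl
    have hl : Tendsto (fun l => c₁ (tl l).1.1) atTop (𝓝 (c₁ t.1.1)) := by
      have h3 : Continuous fun (u : Fin p ⊕ Fin p → ℝ) (c : Fin p) => u (Sum.inl c) := by fun_prop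
      exact (h3.tendsto _).comp htl
    have hrr : Tendsto (fun l => c₂ (tl l).1.2) atTop (𝓝 (c₂ t.1.2)) := by
      have h3 : Continuous fun (u : Fin p ⊕ Fin p → ℝ) (c : Fin p) => u (Sum.inr c) := by fun_prop
      exact (h3.tendsto _).comp htl
    have hγ := tendsto_of_coord e h2 hrr
    have hw := tendsto_of_coord e hr2 hl
    have hθ : Tendsto (fun l => (tl l).1.1) atTop (𝓝 t.1.1) := by
      have h3 : Continuous fun x : Vec p => θs + op D⁻¹ x := by fun_prop
      have h4 := (h3.tendsto _).comp hw
      simp only [Function.comp_def, op_inv_mul_apply hDpos, add_sub_cancel] at h4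
      exact h4
    have hγ' : Tendsto (fun l => op D⁻¹ (tl l).1.2) atTop (𝓝 (op D⁻¹ t.1.2)) :=
      ((op D⁻¹).continuous.tendsto _).comp hγ
    have hfd : Tendsto (fun l => fderiv ℝ (zeta P ℓ (fun i => Y i w)) (tl l).1.1) atTop
        (𝓝 (fderiv ℝ (zeta P ℓ (fun i => Y i w)) t.1.1)) :=
      ((contDiffOn_fderiv_one isOpen_interior (h.contDiffOn_zeta _)).continuousOn.continuousAt
        (isOpen_interior.mem_nhds (hint _ t.2.1))).tendsto.comp hθ
    have happ : Tendsto (fun l => fderiv ℝ (zeta P ℓ (fun i => Y i w)) (tl l).1.1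
        (op D⁻¹ (tl l).1.2)) atTop
        (𝓝 (fderiv ℝ (zeta P ℓ (fun i => Y i w)) t.1.1 (op D⁻¹ t.1.2))) :=
      ((isBoundedBilinearMap_apply (𝕜 := ℝ) (E := Vec p) (F := ℝ)).continuous.tendsto
        (_, _)).comp (hfd.prodMk_nhds hγ')
    exact (happ.sub (((fderiv ℝ (zeta P ℓ (fun i => Y i w)) θs).continuous.tendsto
      _).comp hγ')).div_const _

end Model

/-! ### Linearization of the gradient; Fisher and Wilks expansions -/

theorem abs_sqrt_sub_le {A W d : ℝ} (hA : 0 ≤ A) (hW : 0 ≤ W) (hd : 0 ≤ d)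
    (h : |A - W ^ 2| ≤ d * W) : |√A - W| ≤ d := by
  rcases hW.eq_or_lt with rfl | hpos
  · have h0 : A = 0 := by
      have : |A| ≤ 0 := by simpa using h
      exact abs_nonpos_iff.1 this
    simpa [h0] using hd
  · have h1 : A - W ^ 2 = (√A - W) * (√A + W) := by
      have := sq_sqrt hA
      linear_combination -this
    rw [h1, abs_mul, abs_of_nonneg (by positivity : 0 ≤ √A + W)] at h
    have h2 : |√A - W| * W ≤ |√A - W| * (√A + W) := by
      gcongr
      linarith [sqrt_nonneg A]
    exact le_of_mul_le_mul_right (h2.trans h) hpos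

section Model

variable {𝓨 : Type*} [MeasurableSpace 𝓨] {p n : ℕ} {Θ : Set (Vec p)} {P : Measure 𝓨}
  {ℓ : 𝓨 → Vec p → ℝ} {G v₀ : Mat p} {θs : Vec p} {ν g ω δ a u₀ : ℝ} {b : ℝ → ℝ}

theorem inner_op_penInfo (hG : G.IsSymm) (θ x γ : Vec p) :
    inner ℝ x (op (penInfo n G P ℓ θ) γ)
      = -(n * fderiv ℝ (fderiv ℝ (meanLogLik P ℓ)) θ x γ) + inner ℝ (op G x) (op G γ) := by
  have hG' : G.IsHermitian := by
    unfold Matrix.IsHermitian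
    rw [Matrix.conjTranspose_eq_transpose_of_trivial]; exact hG
  unfold penInfo fisherInfo
  rw [op_add_apply, op_smul_apply, op_neg_apply, op_mul_apply, inner_add_right, inner_smul_right,
    inner_neg_right, inner_op_hess, ← inner_op_comm hG']
  ring

namespace IIDConditions

variable (h : IIDConditions Θ P ℓ n G v₀ θs ν g ω δ a u₀ b)

include h

theorem fderiv_meanPenLogLik {θ : Vec p} (hθ : θ ∈ interior Θ) (γ : Vec p) :
    fderiv ℝ (meanPenLogLik n G P ℓ) θ γ
      = n * fderiv ℝ (meanLogLik P ℓ) θ γ - inner ℝ (op G θ) (op G γ) := by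
  have h1 : HasFDerivAt (meanLogLik P ℓ) (fderiv ℝ (meanLogLik P ℓ) θ) θ :=
    ((h.contDiffOn_mean.contDiffAt (isOpen_interior.mem_nhds hθ)).differentiableAt
      (by norm_num)).hasFDerivAt
  have h2 := (h1.const_mul (n : ℝ)).sub (((op G).hasFDerivAt (x := θ)).norm_sq.mul_const (1 / 2))
  have h3 : (fun θ => (n : ℝ) * meanLogLik P ℓ θ) - (fun θ => ‖op G θ‖ ^ 2 * (1 / 2))
      = meanPenLogLik n G P ℓ := by
    funext θ; simp only [Pi.sub_apply, meanPenLogLik]; ring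
  have h4 : HasFDerivAt (meanPenLogLik n G P ℓ) _ θ := h3 ▸ h2
  rw [h4.fderiv]
  simp

theorem fderiv_mean_target (hu₀ : 0 < u₀) : fderiv ℝ (meanPenLogLik n G P ℓ) θs = 0 :=
  (h.target_max.isLocalMax (mem_interior_iff_mem_nhds.1 (h.target_mem_interior hu₀))).fderiv_eq_zero

theorem continuousOn_zeta (ys : Fin n → 𝓨) : ContinuousOn (zeta P ℓ ys) Θ := by
  unfold zeta logLik
  exact (continuousOn_finsetSum _ fun i _ => h.continuousOn (ys i)).sub
    (continuousOn_const.mul h.continuousOn_mean)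

/-- A bound for the increments of `ζ` at the interior points of a vicinity extends to `Θ`. -/
theorem zeta_bound_extend (hu₀ : 0 < u₀) (ys : Fin n → 𝓨) {r B : ℝ}
    (hB : ∀ θ ∈ interior Θ, ‖op (rootInfo n G P ℓ θs) (θ - θs)‖ ≤ r →
      |zeta P ℓ ys θ - zeta P ℓ ys θs| ≤ B) {θ : Vec p} (hθ : θ ∈ Θ)
    (hr : ‖op (rootInfo n G P ℓ θs) (θ - θs)‖ ≤ r) :
    |zeta P ℓ ys θ - zeta P ℓ ys θs| ≤ B := by
  set t : ℕ → ℝ := fun k => 1 / ((k : ℝ) + 1) with ht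
  have ht0 : ∀ k, 0 < t k := fun k => by simp only [ht]; positivity
  have ht1 : ∀ k, t k ≤ 1 := fun k => by
    simp only [ht]; rw [div_le_one (by positivity)]; linarith [(Nat.cast_nonneg k : (0 : ℝ) ≤ k)]
  -- Contracting towards the interior target keeps a point in the vicinity and moves it into the
  -- interior, where the bound is available; continuity of ζ on Θ then reaches the point itself.
  have hmem : ∀ k, θ + t k • (θs - θ) ∈ interior Θ := fun k =>
    h.convex.add_smul_sub_mem_interior hθ (h.target_mem_interior hu₀) ⟨ht0 k, ht1 k⟩
  have hlim : Tendsto (fun k => θ + t k • (θs - θ)) atTop (𝓝 θ) := by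
    have h1 : Tendsto t atTop (𝓝 0) := tendsto_one_div_add_atTop_nhds_zero_nat
    simpa using (h1.smul_const (θs - θ)).const_add θ
  have hlim' : Tendsto (fun k => θ + t k • (θs - θ)) atTop (𝓝[Θ] θ) :=
    tendsto_nhdsWithin_iff.2 ⟨hlim, Eventually.of_forall fun k => interior_subset (hmem k)⟩
  have hz := ((h.continuousOn_zeta ys θ hθ).tendsto.comp hlim').sub_const (zeta P ℓ ys θs)
  refine le_of_tendsto' hz.abs fun k => hB _ (hmem k) ?_
  have h2 : θ + t k • (θs - θ) - θs = (1 - t k) • (θ - θs) := by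
    rw [sub_smul, one_smul, smul_sub, smul_sub]; abel
  rw [h2, map_smul, norm_smul, Real.norm_eq_abs, abs_of_nonneg (by linarith [ht1 k])]
  exact (mul_le_of_le_one_left (norm_nonneg _) (by linarith [ht0 k])).trans hr

theorem inner_xiG (hn : 0 < n) (ha : 0 < a) (ys : Fin n → 𝓨) (e : Vec p) :
    inner ℝ (xiG G P ℓ θs ys) e
      = fderiv ℝ (zeta P ℓ ys) θs (op (rootInfo n G P ℓ θs)⁻¹ e) := by
  unfold xiG
  rw [inner_op_comm (h.posDef_rootInfo hn ha).inv.1, real_inner_comm, inner_gradient_eq]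

theorem norm_xiG_le (hn : 0 < n) (ha : 0 < a) (ys : Fin n → 𝓨) {B : ℝ} (hB0 : 0 ≤ B)
    (hB : ∀ γ : Vec p, ‖γ‖ ≤ 1 →
      |fderiv ℝ (zeta P ℓ ys) θs (op (rootInfo n G P ℓ θs)⁻¹ γ)| ≤ B) :
    ‖xiG G P ℓ θs ys‖ ≤ B := by
  set ξ := xiG G P ℓ θs ys with hξ
  rcases eq_or_ne ξ 0 with h0 | h0
  · rwa [h0, norm_zero]
  · have hpos := norm_pos_iff.2 h0
    have h1 := hB (‖ξ‖⁻¹ • ξ) (by rw [norm_smul, norm_inv, norm_norm, inv_mul_cancel₀ hpos.ne'])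
    rw [← h.inner_xiG hn ha, inner_smul_right, ← hξ, real_inner_self_eq_norm_sq, sq,
      inv_mul_cancel_left₀ hpos.ne'] at h1
    exact (le_abs_self _).trans h1

/-- Linearization of the gradient of the penalized mean log-likelihood. -/
theorem fderiv_mean_approx (hn : 0 < n) (ha : 0 < a) (hu₀ : 0 < u₀) {r : ℝ} (hr : 0 < r)
    (hru : r ≤ u₀ * √n) {θ : Vec p}
    (hθ : ‖op (rootInfo n G P ℓ θs) (θ - θs)‖ ≤ r) (e : Vec p) :
    |fderiv ℝ (meanPenLogLik n G P ℓ) θ (op (rootInfo n G P ℓ θs)⁻¹ e)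
      + inner ℝ (op (rootInfo n G P ℓ θs) (θ - θs)) e| ≤ δ * r ^ 2 / √n * ‖e‖ := by
  have hDpos := h.posDef_rootInfo hn ha
  have hN : 0 < √(n : ℝ) := sqrt_pos.2 (by exact_mod_cast hn)
  have hsmooth : ∀ θ ∈ localSet n G P ℓ θs r, ‖op ((rootInfo n G P ℓ θs)⁻¹ * penInfo n G P ℓ θ
      * (rootInfo n G P ℓ θs)⁻¹ - 1)‖ ≤ δ * (r / √n) := fun θ hθ =>
    h.smooth (r / √n) (by positivity) (by rwa [div_le_iff₀ hN]) θ
      (by rwa [div_mul_cancel₀ _ hN.ne'])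
  have htarget := h.fderiv_mean_target hu₀
  set D := rootInfo n G P ℓ θs with hD
  set N := √(n : ℝ)
  set x := θ - θs with hx
  set w := op D x with hw
  have hxw : op D⁻¹ w = x := op_inv_mul_apply hDpos x
  have hseg : ∀ t ∈ Icc (0 : ℝ) 1, θs + t • x ∈ localSet n G P ℓ θs r := by
    intro t ht
    change ‖op D (θs + t • x - θs)‖ ≤ r
    rw [add_sub_cancel_left, map_smul, norm_smul, Real.norm_eq_abs, abs_of_nonneg ht.1]
    exact (mul_le_of_le_one_left (norm_nonneg _) ht.2).trans hθ
  have hseg' : ∀ t ∈ Icc (0 : ℝ) 1, θs + t • x ∈ interior Θ := fun t ht =>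
    h.local_subset (le_trans (hseg t ht) hru)
  set γ := op D⁻¹ e with hγ
  -- The error of the linear model along the segment. It vanishes at 0 because the target is a
  -- critical point, and its derivative is governed by D⁻¹ D²(θ) D⁻¹ - 1, of norm at most δ r / √n.
  set φ : ℝ → ℝ := fun t => n * fderiv ℝ (meanLogLik P ℓ) (θs + t • x) γ
    - inner ℝ (op G (θs + t • x)) (op G γ) + t * inner ℝ w e with hφ
  set φ' : ℝ → ℝ := fun t => -inner ℝ w
    (op (D⁻¹ * penInfo n G P ℓ (θs + t • x) * D⁻¹ - 1) e) with hφ'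
  have hder : ∀ t ∈ Icc (0 : ℝ) 1, HasDerivWithinAt φ (φ' t) (Icc 0 1) t := by
    intro t ht
    have h1 := (hasDerivAt_fderiv_comp_line (γ := γ) isOpen_interior h.contDiffOn_mean
      (hseg' t ht)).const_mul (n : ℝ)
    have h2 : HasDerivAt (fun t : ℝ => inner ℝ (op G (θs + t • x)) (op G γ))
        (inner ℝ (op G x) (op G γ)) t := by
      have := ((op G).hasFDerivAt.comp_hasDerivAt t (hasDerivAt_line θs x t)).inner ℝ
        (hasDerivAt_const t (op G γ))
      simpa using this
    have h3 : HasDerivAt (fun t : ℝ => t * inner ℝ w e) (inner ℝ w e) t := by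
      simpa using (hasDerivAt_id t).mul_const (inner ℝ w e)
    refine (((h1.sub h2).add h3).congr_deriv ?_).hasDerivWithinAt
    simp only [hφ']
    rw [op_sub_apply, op_one_apply, op_mul_apply, op_mul_apply, inner_sub_right,
      ← inner_op_comm hDpos.inv.1, hxw, inner_op_penInfo h.symm_penalty]
    ring
  have hbound : ∀ t ∈ Icc (0 : ℝ) 1, ‖φ' t‖ ≤ δ * r ^ 2 / N * ‖e‖ := by
    intro t ht
    simp only [hφ', norm_neg]
    calc ‖inner ℝ w (op (D⁻¹ * penInfo n G P ℓ (θs + t • x) * D⁻¹ - 1) e)‖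
        ≤ ‖w‖ * (‖op (D⁻¹ * penInfo n G P ℓ (θs + t • x) * D⁻¹ - 1)‖ * ‖e‖) :=
          (norm_inner_le_norm _ _).trans (by gcongr; exact ContinuousLinearMap.le_opNorm _ _)
      _ ≤ r * (δ * (r / N) * ‖e‖) := by
          gcongr
          exact hsmooth _ (hseg t ht)
      _ = _ := by ring
  have hmvt := Convex.norm_image_sub_le_of_norm_hasDerivWithin_le hder hbound (convex_Icc 0 1)
    (left_mem_Icc.2 zero_le_one) (right_mem_Icc.2 zero_le_one)
  rw [sub_zero, norm_one, mul_one, Real.norm_eq_abs] at hmvt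
  have h0 : φ 0 = 0 := by
    simp only [hφ, zero_smul, add_zero, zero_mul]
    rw [← h.fderiv_meanPenLogLik (h.target_mem_interior hu₀), htarget]; rfl
  have h1 : φ 1 = fderiv ℝ (meanPenLogLik n G P ℓ) θ γ + inner ℝ w e := by
    have hθ' : θs + (1 : ℝ) • x = θ := by rw [one_smul, hx, add_sub_cancel]
    have hmem := hseg' 1 (right_mem_Icc.2 zero_le_one)
    rw [hθ'] at hmem
    simp only [hφ]
    rw [hθ', h.fderiv_meanPenLogLik hmem, one_mul]
  rwa [h0, h1, sub_zero] at hmvt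

/-- Linearization of the gradient of the penalized log-likelihood. -/
theorem fderiv_penLogLik_approx (hn : 0 < n) (ha : 0 < a) (hu₀ : 0 < u₀) {r : ℝ} (hr : 0 < r)
    (hru : r ≤ u₀ * √n) (ys : Fin n → 𝓨) {η : ℝ}
    (hη : ∀ θ γ : Vec p, ‖op (rootInfo n G P ℓ θs) (θ - θs)‖ ≤ r → ‖γ‖ ≤ 1 →
      |fderiv ℝ (zeta P ℓ ys) θ (op (rootInfo n G P ℓ θs)⁻¹ γ)
        - fderiv ℝ (zeta P ℓ ys) θs (op (rootInfo n G P ℓ θs)⁻¹ γ)| ≤ η) {θ : Vec p}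
    (hθ : ‖op (rootInfo n G P ℓ θs) (θ - θs)‖ ≤ r) (e : Vec p) :
    |fderiv ℝ (penLogLik G ℓ ys) θ (op (rootInfo n G P ℓ θs)⁻¹ e) - inner ℝ (xiG G P ℓ θs ys) e
      + inner ℝ (op (rootInfo n G P ℓ θs) (θ - θs)) e| ≤ (η + δ * r ^ 2 / √n) * ‖e‖ := by
  have hθint : θ ∈ interior Θ := h.local_subset (le_trans hθ hru)
  have hmean := h.fderiv_mean_approx hn ha hu₀ hr hru hθ e
  rw [h.inner_xiG hn ha]
  have hfd : fderiv ℝ (penLogLik G ℓ ys) θ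
      = fderiv ℝ (meanPenLogLik n G P ℓ) θ + fderiv ℝ (zeta P ℓ ys) θ := by
    rw [penLogLik_eq G P]
    exact fderiv_fun_add
      ((h.contDiffOn_meanPenLogLik.contDiffAt (isOpen_interior.mem_nhds hθint)).differentiableAt
        (by norm_num))
      (((h.contDiffOn_zeta ys).contDiffAt (isOpen_interior.mem_nhds hθint)).differentiableAt
        (by norm_num))
  rw [hfd, _root_.add_apply]
  set D := rootInfo n G P ℓ θs
  have hz : |fderiv ℝ (zeta P ℓ ys) θ (op D⁻¹ e) - fderiv ℝ (zeta P ℓ ys) θs (op D⁻¹ e)|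
      ≤ η * ‖e‖ := by
    rcases eq_or_ne e 0 with rfl | h0
    · simp
    · have hpos := norm_pos_iff.2 h0
      have h1 := hη θ (‖e‖⁻¹ • e) hθ
        (by rw [norm_smul, norm_inv, norm_norm, inv_mul_cancel₀ hpos.ne'])
      rw [map_smul, map_smul, map_smul, ← smul_sub, smul_eq_mul, abs_mul, abs_inv, abs_norm,
        ← div_eq_inv_mul, div_le_iff₀ hpos] at h1
      exact h1
  calc |fderiv ℝ (meanPenLogLik n G P ℓ) θ (op D⁻¹ e) + fderiv ℝ (zeta P ℓ ys) θ (op D⁻¹ e)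
        - fderiv ℝ (zeta P ℓ ys) θs (op D⁻¹ e) + inner ℝ (op D (θ - θs)) e|
      = |(fderiv ℝ (zeta P ℓ ys) θ (op D⁻¹ e) - fderiv ℝ (zeta P ℓ ys) θs (op D⁻¹ e))
        + (fderiv ℝ (meanPenLogLik n G P ℓ) θ (op D⁻¹ e) + inner ℝ (op D (θ - θs)) e)| := by
        congr 1; ring
    _ ≤ η * ‖e‖ + δ * r ^ 2 / √n * ‖e‖ := (abs_add_le _ _).trans (add_le_add hz hmean)
    _ = _ := by ring

/-- The Fisher and Wilks expansions for a maximizer in the local zone. -/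
theorem fisher_wilks (hn : 0 < n) (ha : 0 < a) {r : ℝ}
    (hru : r ≤ u₀ * √n) (ys : Fin n → 𝓨) {Δ : ℝ} (hΔ : 0 ≤ Δ)
    (happrox : ∀ θ e : Vec p, ‖op (rootInfo n G P ℓ θs) (θ - θs)‖ ≤ r →
      |fderiv ℝ (penLogLik G ℓ ys) θ (op (rootInfo n G P ℓ θs)⁻¹ e) - inner ℝ (xiG G P ℓ θs ys) e
        + inner ℝ (op (rootInfo n G P ℓ θs) (θ - θs)) e| ≤ Δ * ‖e‖)
    {θt : Vec p} (hmax : IsMaxOn (penLogLik G ℓ ys) Θ θt)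
    (hθt : ‖op (rootInfo n G P ℓ θs) (θt - θs)‖ ≤ r) :
    ‖op (rootInfo n G P ℓ θs) (θt - θs) - xiG G P ℓ θs ys‖ ≤ Δ ∧
      |√(2 * (penLogLik G ℓ ys θt - penLogLik G ℓ ys θs)) - ‖xiG G P ℓ θs ys‖| ≤ 5 * Δ := by
  have hDpos := h.posDef_rootInfo hn ha
  set D := rootInfo n G P ℓ θs with hD
  set ξ := xiG G P ℓ θs ys
  set x := θt - θs with hx
  set w := op D x with hw
  have hxw : op D⁻¹ w = x := op_inv_mul_apply hDpos x
  have hθx : θs + x = θt := by rw [hx, add_sub_cancel]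
  have hseg : ∀ t ∈ Icc (0 : ℝ) 1, ‖op D (θs + t • x - θs)‖ ≤ r := by
    intro t ht
    rw [add_sub_cancel_left, map_smul, norm_smul, Real.norm_eq_abs, abs_of_nonneg ht.1]
    exact (mul_le_of_le_one_left (norm_nonneg _) ht.2).trans hθt
  have hseg' : ∀ t ∈ Icc (0 : ℝ) 1, θs + t • x ∈ interior Θ := fun t ht =>
    h.local_subset (le_trans (hseg t ht) hru)
  have hint : θt ∈ interior Θ := h.local_subset (le_trans hθt hru)
  have hcrit : fderiv ℝ (penLogLik G ℓ ys) θt = 0 :=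
    (hmax.isLocalMax (mem_interior_iff_mem_nhds.1 hint)).fderiv_eq_zero
  -- At the maximizer only the linear model remains; testing it on w - ξ gives ‖w - ξ‖² ≤ Δ ‖w - ξ‖.
  have hwξ : ‖w - ξ‖ ≤ Δ := by
    have h1 := happrox θt (w - ξ) hθt
    rw [hcrit, _root_.zero_apply, zero_sub, neg_add_eq_sub, ← inner_sub_left,
      real_inner_self_eq_norm_sq, abs_of_nonneg (sq_nonneg _), sq] at h1
    rcases (norm_nonneg (w - ξ)).eq_or_lt with h0 | h0
    · rw [← h0]; exact hΔ
    · exact le_of_mul_le_mul_right h1 h0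
  refine ⟨hwξ, ?_⟩
  have hC2 : ContDiffOn ℝ 2 (penLogLik G ℓ ys) (interior Θ) := by
    rw [penLogLik_eq G P]
    exact h.contDiffOn_meanPenLogLik.add (h.contDiffOn_zeta ys)
  -- The likelihood minus its quadratic model; the derivative along the segment is the linearization
  -- error in the direction w.
  set φ : ℝ → ℝ := fun t => penLogLik G ℓ ys (θs + t • x) - t * inner ℝ ξ w
    + t ^ 2 / 2 * ‖w‖ ^ 2 with hφ
  have hder : ∀ t ∈ Icc (0 : ℝ) 1, HasDerivWithinAt φ
      (fderiv ℝ (penLogLik G ℓ ys) (θs + t • x) (op D⁻¹ w) - inner ℝ ξ w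
        + inner ℝ (op D (θs + t • x - θs)) w) (Icc 0 1) t := by
    intro t ht
    have h1 := hasDerivAt_comp_line isOpen_interior hC2 (hseg' t ht)
    have h2 : HasDerivAt (fun t : ℝ => t * inner ℝ ξ w) (inner ℝ ξ w) t := by
      simpa using (hasDerivAt_id t).mul_const (inner ℝ ξ w)
    have h3 : HasDerivAt (fun t : ℝ => t ^ 2 / 2 * ‖w‖ ^ 2) (t * ‖w‖ ^ 2) t := by
      have := (((hasDerivAt_id t).pow 2).div_const 2).mul_const (‖w‖ ^ 2)
      refine this.congr_deriv ?_
      simp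
    refine (((h1.sub h2).add h3).congr_deriv ?_).hasDerivWithinAt
    rw [hxw, add_sub_cancel_left, map_smul, ← hw, inner_smul_left, real_inner_self_eq_norm_sq]
    simp
  have hmvt := Convex.norm_image_sub_le_of_norm_hasDerivWithin_le hder
    (fun t ht => happrox _ w (hseg t ht)) (convex_Icc 0 1)
    (left_mem_Icc.2 zero_le_one) (right_mem_Icc.2 zero_le_one)
  rw [sub_zero, norm_one, mul_one, Real.norm_eq_abs] at hmvt
  simp only [hφ, one_smul, zero_smul, add_zero, hθx] at hmvt
  have hθs : θs ∈ Θ := h.target_mem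
  have hL0 : 0 ≤ 2 * (penLogLik G ℓ ys θt - penLogLik G ℓ ys θs) := by
    have : penLogLik G ℓ ys θs ≤ penLogLik G ℓ ys θt := hmax hθs
    linarith
  have hinner : |inner ℝ (w - ξ) w| ≤ Δ * ‖w‖ :=
    (abs_real_inner_le_norm _ _).trans (by gcongr)
  rw [inner_sub_left, real_inner_self_eq_norm_sq] at hinner
  -- One half of 4 Δ ‖w‖ is the error of the quadratic model, the other comes from replacing ⟨ξ, w⟩
  -- by ‖w‖².
  have hkey : |2 * (penLogLik G ℓ ys θt - penLogLik G ℓ ys θs) - ‖w‖ ^ 2| ≤ 4 * Δ * ‖w‖ := by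
    rw [abs_le] at hinner hmvt ⊢
    constructor <;> nlinarith [hinner.1, hinner.2, hmvt.1, hmvt.2]
  have h5 := abs_sqrt_sub_le hL0 (norm_nonneg w) (by positivity) hkey
  have h6 : |‖w‖ - ‖ξ‖| ≤ Δ := (abs_norm_sub_norm_le w ξ).trans hwξ
  calc |√(2 * (penLogLik G ℓ ys θt - penLogLik G ℓ ys θs)) - ‖ξ‖|
      ≤ |√(2 * (penLogLik G ℓ ys θt - penLogLik G ℓ ys θs)) - ‖w‖| + |‖w‖ - ‖ξ‖| :=
        abs_sub_le _ _ _
    _ ≤ 5 * Δ := by linarith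

end IIDConditions

end Model

/-! ### Deterministic estimates, concentration, and the good event -/

/-- The constant of the deviation bounds, for an effective dimension at most `(A q)²` and an entropy
at most `B √n q`. -/
noncomputable def devConst (ν g K A B : ℝ) : ℝ := 400 * (√2 * ν * (A + 9) + g⁻¹ * (B + √K + 8))

theorem devConst_pos {ν g K A B : ℝ} (hν : 1 ≤ ν) (hg : 0 < g) (hA : 0 ≤ A) (hB : 0 ≤ B) :
    0 < devConst ν g K A B := by unfold devConst; positivity

/-- The condition q ≤ √K √n turns x ≤ q² into x ≤ √K √n q, so the exponential part, once divided by
√n, is of the same order q as the Gaussian part. Since q ≥ 1/2, additive constants are absorbed. -/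
theorem chainBound_le {ν g K A B d E q x m : ℝ} {n : ℕ} (hν : 1 ≤ ν) (hg : 0 < g) (hn : 0 < n)
    (hA : 0 ≤ A) (hB : 0 ≤ B) (hq : 1 / 2 ≤ q) (hxq : x ≤ q ^ 2)
    (hqN : q ≤ √K * √n) (hm : 0 ≤ m) (hd : d ≤ (A * q) ^ 2) (hE : E ≤ B * (√n * q)) :
    chainBound ν g n d E (x + m + 3) ≤ devConst ν g K A B * (q + m) := by
  have hN1 : 1 ≤ √(n : ℝ) := one_le_sqrt.2 (by exact_mod_cast hn)
  set N := √(n : ℝ)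
  have h1 : √(d + (x + m + 3) + 1) ≤ (A + 9) * (q + m) := by
    refine sqrt_le_iff.2 ⟨by positivity, ?_⟩
    have e1 : 0 ≤ A * q * m := by positivity
    have e2 : 0 ≤ A * m := by positivity
    have h4 : d + (x + m + 3) + 1 ≤ (A * q) ^ 2 + (9 * (q + m)) ^ 2 := by nlinarith
    have h5 : (A * q) ^ 2 + (9 * (q + m)) ^ 2 ≤ ((A + 9) * (q + m)) ^ 2 := by
      have h6 : (A * q) ^ 2 ≤ (A * (q + m)) ^ 2 := by gcongr; linarith
      nlinarith [mul_nonneg hA (sq_nonneg (q + m))]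
    exact h4.trans h5
  have h2 : (g * N)⁻¹ * (E + (x + m + 3) + 1) ≤ g⁻¹ * (B + √K + 8) * (q + m) := by
    have h3 : E + (x + m + 3) + 1 ≤ N * ((B + √K + 8) * (q + m)) := by
      have e1 : x ≤ √K * N * q := by nlinarith
      have e2 : m + 4 ≤ N * (8 * (q + m)) := by nlinarith
      have e3 : 0 ≤ N * (B + √K) * m := by positivity
      nlinarith
    calc (g * N)⁻¹ * (E + (x + m + 3) + 1) ≤ (g * N)⁻¹ * (N * ((B + √K + 8) * (q + m))) := by
          gcongr
      _ = _ := by field_simp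
  unfold chainBound devConst
  calc 400 * (√2 * ν * √(d + (x + m + 3) + 1) + (g * N)⁻¹ * (E + (x + m + 3) + 1))
      ≤ 400 * (√2 * ν * ((A + 9) * (q + m)) + g⁻¹ * (B + √K + 8) * (q + m)) := by gcongr
    _ = _ := by ring

/-- The arithmetic behind the concentration of the maximizer. -/
theorem le_radius_of_global {b : ℝ → ℝ} {C q K N u₁ r₀ r : ℝ} (hC : 0 < C) (hq : 1 / 2 ≤ q)
    (hN : 1 ≤ N) (hqN : q ≤ √K * N) (hu₁ : exp 1 ≤ u₁)
    (hb : ∀ u, u₁ ≤ u → 4 * C * (√K + 5) * log u < u * b u) (hb₁ : 0 < b u₁)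
    (hr₀ : 1 ≤ r₀) (hr₀' : 12 * C * q < b u₁ * r₀)
    (hglob : ∀ u, 0 < u → r ≤ u * N → ∀ k : ℕ, r ≤ 2 ^ (k + 1) * r₀ →
      b u * r ^ 2 ≤ 2 * (C * (q + (k + 1 : ℕ)) * (2 ^ (k + 1) * r₀))) :
    r ≤ r₀ := by
  by_contra! hlt
  have hrpos : 0 < r := by linarith
  have hr₀pos : 0 < r₀ := by linarith
  -- The index of the dyadic slice containing r.
  obtain ⟨k, hk1, hk2⟩ := exists_nat_pow_near (x := r / r₀) (y := 2)
    ((one_le_div hr₀pos).2 hlt.le) (by norm_num)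
  rw [le_div_iff₀ hr₀pos] at hk1
  rw [div_lt_iff₀ hr₀pos] at hk2
  have hmain : ∀ u, 0 < u → r ≤ u * N → b u * r ≤ 4 * C * (q + k + 1) := by
    intro u hu hru
    have h1 := hglob u hu hru k hk2.le
    have h2 : (2 : ℝ) ^ (k + 1) * r₀ ≤ 2 * r := by rw [pow_succ]; linarith
    have h3 : C * (q + (k + 1 : ℕ)) * (2 ^ (k + 1) * r₀) ≤ C * (q + (k + 1 : ℕ)) * (2 * r) := by
      gcongr
    push_cast at h1 h3
    have h4 : (b u * r) * r ≤ (4 * C * (q + k + 1)) * r := by nlinarith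
    exact le_of_mul_le_mul_right h4 hrpos
  have hu₁pos : 0 < u₁ := (exp_pos 1).trans_le hu₁
  -- At moderate radii b is taken at u₁, and 2 ^ k outgrows k + 1, which contradicts the choice of
  -- r₀. At large radii u = r / N, and the growth of u b(u) must beat k, which is logarithmic in r.
  rcases le_or_gt r (u₁ * N) with hcase | hcase
  · have h1 := hmain u₁ hu₁pos hcase
    have h2 : ((k : ℝ) + 1) ≤ 2 ^ k := by exact_mod_cast Nat.lt_two_pow_self
    have h3 : q + k + 1 ≤ 3 * q * 2 ^ k := by nlinarith
    have h4 : b u₁ * r₀ * 2 ^ k ≤ (12 * C * q) * 2 ^ k := by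
      calc b u₁ * r₀ * 2 ^ k = b u₁ * (2 ^ k * r₀) := by ring
        _ ≤ b u₁ * r := by gcongr
        _ ≤ 4 * C * (q + k + 1) := h1
        _ ≤ 4 * C * (3 * q * 2 ^ k) := by gcongr
        _ = _ := by ring
    have := le_of_mul_le_mul_right h4 (by positivity)
    linarith
  · set u := r / N with hu
    have hNpos : 0 < N := by linarith
    have hur : u * N = r := div_mul_cancel₀ _ hNpos.ne'
    have huu₁ : u₁ ≤ u := by rw [hu, le_div_iff₀ hNpos]; exact hcase.le
    have hupos : 0 < u := hu₁pos.trans_le huu₁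
    have hlog1 : 1 ≤ log u := (le_log_iff_exp_le hupos).2 (hu₁.trans huu₁)
    have h1 := hmain u hupos hur.ge
    have h2 : (k : ℝ) * log 2 ≤ log u + log N := by
      rw [← log_pow, ← log_mul hupos.ne' hNpos.ne', hur]
      refine log_le_log (by positivity) ?_
      exact (le_mul_of_one_le_right (by positivity) hr₀).trans hk1
    -- This crude bound is harmless, since q itself may be of order N.
    have h3 : log N ≤ N - 1 := log_le_sub_one_of_pos hNpos
    have hl2 := log_two_gt_d9
    have hk : (k : ℝ) ≤ 2 * (log u + N) := by
      have : (0 : ℝ) ≤ k := Nat.cast_nonneg k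
      nlinarith
    have h4 : q + k + 1 ≤ N * ((√K + 5) * log u) := by
      have e1 : √K * N ≤ √K * N * log u := le_mul_of_one_le_right (by positivity) hlog1
      have e2 : log u ≤ N * log u := le_mul_of_one_le_left (by linarith) hN
      have e3 : N ≤ N * log u := le_mul_of_one_le_right (by linarith) hlog1
      nlinarith
    have h5 : (u * b u) * N ≤ (4 * C * (√K + 5) * log u) * N := by
      calc (u * b u) * N = b u * r := by rw [← hur]; ring
        _ ≤ 4 * C * (q + k + 1) := h1
        _ ≤ 4 * C * (N * ((√K + 5) * log u)) := by gcongr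
        _ = _ := by ring
    have := le_of_mul_le_mul_right h5 hNpos
    linarith [hb u huu₁]

/-- The conclusions for a deterministic sample, from the deviation bounds. -/
theorem conclusion_of_bounds {q N r₀ u₀ Cz Cg C₄ δ wξ w ξ L : ℝ} (hq : 1 / 2 ≤ q) (hN : 0 < N)
    (hu₀ : 0 < u₀) (hCz : 0 < Cz) (hCg : 0 < Cg) (hδ : 0 < δ) (hC₄ : 0 < C₄) (hr₀ : r₀ = C₄ * q)
    (hL : 0 ≤ L) (hξ0 : 0 ≤ ξ) (hξ : ξ ≤ Cz * q) (hw : w ≤ r₀) (hwξ : wξ ≤ w + ξ)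
    (hLle : L ≤ 2 * (Cz * q * r₀))
    (hloc : r₀ ≤ u₀ * N → wξ ≤ Cg * r₀ / N * q + δ * r₀ ^ 2 / N ∧
      |√L - ξ| ≤ 5 * (Cg * r₀ / N * q + δ * r₀ ^ 2 / N)) {C : ℝ}
    (hC : C = (5 * (Cg * C₄ + δ * C₄ ^ 2) + (C₄ + Cz + √(2 * Cz * C₄)) * (C₄ / u₀))
      * (1 + √(2 * Cz * C₄) + Cz)) :
    wξ ≤ C * (q ^ 2 / N) ∧ |√L - ξ| ≤ C * (q ^ 2 / N) ∧ |L - ξ ^ 2| ≤ C * (q ^ 3 / N) := by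
  set R := √(2 * Cz * C₄) with hR
  set C₁ := 5 * (Cg * C₄ + δ * C₄ ^ 2) + (C₄ + Cz + R) * (C₄ / u₀) with hC₁
  have hR0 : 0 ≤ R := sqrt_nonneg _
  have hq0 : 0 < q := by linarith
  have hC₁0 : 0 < C₁ := by positivity
  have hqq : 0 < q ^ 2 / N := by positivity
  have hsL : √L ≤ R * q := by
    refine sqrt_le_iff.2 ⟨by positivity, ?_⟩
    rw [mul_pow, hR, sq_sqrt (by positivity)]
    calc L ≤ 2 * (Cz * q * r₀) := hLle
      _ = _ := by rw [hr₀]; ring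
  have h12 : wξ ≤ C₁ * (q ^ 2 / N) ∧ |√L - ξ| ≤ C₁ * (q ^ 2 / N) := by
    rcases le_or_gt r₀ (u₀ * N) with hcase | hcase
    · obtain ⟨h1, h2⟩ := hloc hcase
      have h3 : Cg * r₀ / N * q + δ * r₀ ^ 2 / N = (Cg * C₄ + δ * C₄ ^ 2) * (q ^ 2 / N) := by
        rw [hr₀]; field_simp
      rw [h3] at h1 h2
      have h4 : 0 ≤ (Cg * C₄ + δ * C₄ ^ 2) * (q ^ 2 / N) := by positivity
      have h5 : 0 ≤ (C₄ + Cz + R) * (C₄ / u₀) * (q ^ 2 / N) := by positivity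
      have h6 : C₁ * (q ^ 2 / N) = 5 * ((Cg * C₄ + δ * C₄ ^ 2) * (q ^ 2 / N))
        + (C₄ + Cz + R) * (C₄ / u₀) * (q ^ 2 / N) := by rw [hC₁]; ring
      rw [h6]
      exact ⟨by linarith, by linarith⟩
    -- Here q exceeds a multiple of √n, so the claimed error is at least of order q, and the
    -- triangle inequality suffices.
    · have h1 : q ≤ C₄ / u₀ * (q ^ 2 / N) := by
        rw [div_mul_div_comm, le_div_iff₀ (by positivity)]
        rw [hr₀] at hcase
        nlinarith
      have h2 : (C₄ + Cz + R) * q ≤ C₁ * (q ^ 2 / N) := by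
        have h4 : 0 ≤ 5 * (Cg * C₄ + δ * C₄ ^ 2) * (q ^ 2 / N) := by positivity
        calc (C₄ + Cz + R) * q ≤ (C₄ + Cz + R) * (C₄ / u₀ * (q ^ 2 / N)) := by gcongr
          _ ≤ _ := by rw [hC₁, add_mul]; linarith
      have e1 : 0 ≤ C₄ * q := by positivity
      have e2 : 0 ≤ Cz * q := by positivity
      have e3 : 0 ≤ R * q := by positivity
      refine ⟨by rw [hr₀] at hw; linarith, (abs_sub_le_iff.2 ⟨?_, ?_⟩).trans h2⟩
      · linarith
      · linarith [sqrt_nonneg L]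
  have hC₁C : C₁ * (q ^ 2 / N) ≤ C * (q ^ 2 / N) := by
    gcongr
    rw [hC]
    exact le_mul_of_one_le_right hC₁0.le (by linarith)
  refine ⟨h12.1.trans hC₁C, h12.2.trans hC₁C, ?_⟩
  have h7 : L - ξ ^ 2 = (√L - ξ) * (√L + ξ) := by linear_combination -(sq_sqrt hL)
  rw [h7, abs_mul, abs_of_nonneg (by positivity : 0 ≤ √L + ξ)]
  calc |√L - ξ| * (√L + ξ) ≤ C₁ * (q ^ 2 / N) * ((R + Cz) * q) := by
        gcongr
        · exact h12.2
        · linarith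
    _ = C₁ * (R + Cz) * (q ^ 3 / N) := by ring
    _ ≤ C * (q ^ 3 / N) := by
        gcongr
        rw [hC]
        gcongr
        linarith

section Model

variable {𝓨 : Type*} [MeasurableSpace 𝓨] {p n : ℕ} {Θ : Set (Vec p)} {P : Measure 𝓨}
  {ℓ : 𝓨 → Vec p → ℝ} {G v₀ : Mat p} {θs : Vec p} {ν g ω δ a u₀ : ℝ} {b : ℝ → ℝ}

/-- The maximizer over `Θ` concentrates on the vicinity of radius `r₀`. -/
theorem IIDConditions.norm_le_radius (h : IIDConditions Θ P ℓ n G v₀ θs ν g ω δ a u₀ b)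
    {C q K u₁ r₀ : ℝ} (ys : Fin n → 𝓨) (hC : 0 < C) (hq : 1 / 2 ≤ q)
    (hn : 0 < n) (hqN : q ≤ √K * √n) (hu₁ : exp 1 ≤ u₁)
    (hb : ∀ u, u₁ ≤ u → 4 * C * (√K + 5) * log u < u * b u) (hb₁ : 0 < b u₁)
    (hr₀ : 1 ≤ r₀) (hr₀' : 12 * C * q < b u₁ * r₀)
    (hz : ∀ k : ℕ, ∀ θ ∈ Θ, ‖op (rootInfo n G P ℓ θs) (θ - θs)‖ ≤ 2 ^ k * r₀ →
      |zeta P ℓ ys θ - zeta P ℓ ys θs| ≤ C * (q + k) * (2 ^ k * r₀))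
    {θt : Vec p} (hθt : θt ∈ Θ) (hmax : IsMaxOn (penLogLik G ℓ ys) Θ θt) :
    ‖op (rootInfo n G P ℓ θs) (θt - θs)‖ ≤ r₀ := by
  have hN1 : 1 ≤ √(n : ℝ) := one_le_sqrt.2 (by exact_mod_cast hn)
  refine le_radius_of_global hC hq hN1 hqN hu₁ hb hb₁ hr₀ hr₀' fun u hu hru k hk => ?_
  have h1 := h.global u hu θt ⟨hθt, hru⟩
  -- Maximality of θt means that the loss in the mean is at most the gain in ζ.
  have h2 : penLogLik G ℓ ys θs ≤ penLogLik G ℓ ys θt := hmax h.target_mem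
  rw [penLogLik_eq G P] at h2
  have h3 := (le_abs_self _).trans (hz (k + 1) θt hθt hk)
  linarith

end Model

/-- An event of probability at least `1 - 2 e⁻ˣ` that avoids countably many bad sets. -/
theorem exists_good_event {Ω : Type*} [MeasurableSpace Ω] {Pr : Measure Ω} [IsProbabilityMeasure Pr]
    {x : ℝ} (Z : ℕ → Set Ω) (S U : Set Ω)
    (hZ : ∀ k : ℕ, Pr (Z k) ≤ ENNReal.ofReal (exp (-(x + k + 3))))
    (hS : Pr S ≤ ENNReal.ofReal (exp (-(x + 0 + 3))))
    (hU : Pr U ≤ ENNReal.ofReal (exp (-(x + 0 + 3)))) :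
    ∃ A : Set Ω, MeasurableSet A ∧ ENNReal.ofReal (1 - 2 * exp (-x)) ≤ Pr A ∧
      ∀ s ∈ A, (∀ k, s ∉ Z k) ∧ s ∉ S ∧ s ∉ U := by
  have he : exp (-1) ≤ 0.37 := by have := exp_neg_one_lt_d9; linarith
  have he0 := exp_pos (-1)
  have hx := exp_pos (-x)
  have h3 : exp (-3) ≤ 1 / 8 := by
    have : exp (-3) = exp (-1) ^ 3 := by rw [← exp_nat_mul]; norm_num
    rw [this]
    calc exp (-1) ^ 3 ≤ 0.37 ^ 3 := by gcongr
      _ ≤ 1 / 8 := by norm_num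
  -- The slices together cost exp (-x), since exp (-3) ≤ 1 - exp (-1), and S and U cost at most exp
  -- (-x) / 2 each. As B need not be measurable, its measurable hull is removed.
  set B := (⋃ k, Z k) ∪ (S ∪ U) with hB
  have hbad : Pr B ≤ ENNReal.ofReal (2 * exp (-x)) := by
    have hsum : Summable fun k : ℕ => exp (-x) * exp (-3) * exp (-1) ^ k :=
      (summable_geometric_of_lt_one he0.le (by linarith)).mul_left _
    have h1 : Pr (⋃ k, Z k) ≤ ENNReal.ofReal (exp (-x)) := by
      calc Pr (⋃ k, Z k) ≤ ∑' k, Pr (Z k) := measure_iUnion_le _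
        _ ≤ ∑' k : ℕ, ENNReal.ofReal (exp (-x) * exp (-3) * exp (-1) ^ k) := by
            refine ENNReal.tsum_le_tsum fun k => (hZ k).trans (le_of_eq ?_)
            rw [← exp_nat_mul, ← exp_add, ← exp_add]
            congr 2; ring
        _ = ENNReal.ofReal (∑' k : ℕ, exp (-x) * exp (-3) * exp (-1) ^ k) :=
            (ENNReal.ofReal_tsum_of_nonneg (fun k => by positivity) hsum).symm
        _ ≤ _ := by
            refine ENNReal.ofReal_le_ofReal ?_
            rw [tsum_mul_left, tsum_geometric_of_lt_one he0.le (by linarith), ← div_eq_mul_inv,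
              div_le_iff₀ (by linarith)]
            gcongr
            linarith
    have h2 : exp (-(x + 0 + 3)) ≤ exp (-x) / 2 := by
      have : exp (-(x + 0 + 3)) = exp (-x) * exp (-3) := by rw [← exp_add]; congr 1; ring
      rw [this]
      nlinarith
    calc Pr B ≤ Pr (⋃ k, Z k) + (Pr S + Pr U) :=
          (measure_union_le _ _).trans (add_le_add le_rfl (measure_union_le _ _))
      _ ≤ ENNReal.ofReal (exp (-x))
          + (ENNReal.ofReal (exp (-x) / 2) + ENNReal.ofReal (exp (-x) / 2)) := by
          gcongr
          · exact hS.trans (ENNReal.ofReal_le_ofReal h2)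
          · exact hU.trans (ENNReal.ofReal_le_ofReal h2)
      _ = _ := by
          rw [← ENNReal.ofReal_add (by positivity) (by positivity),
            ← ENNReal.ofReal_add (by positivity) (by positivity)]
          congr 1; ring
  refine ⟨(toMeasurable Pr B)ᶜ, (measurableSet_toMeasurable Pr B).compl, ?_, fun s hs => ?_⟩
  · rw [prob_compl_eq_one_sub (measurableSet_toMeasurable Pr B), measure_toMeasurable,
      ENNReal.ofReal_sub _ (by positivity), ENNReal.ofReal_one]
    exact tsub_le_tsub_left hbad 1
  · have hsB : s ∉ B := fun h => hs (subset_toMeasurable Pr B h)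
    rw [hB, mem_union, mem_union, mem_iUnion, not_or, not_or, not_exists] at hsB
    exact ⟨hsB.1, hsB.2.1, hsB.2.2⟩

end PenML

/-! ### Choice of the constants and assembly -/

theorem theorem2p4
    -- constants of the conditions
    (ν g ω δ a u₀ K : ℝ) (b : ℝ → ℝ)
    (hν : 1 ≤ ν) (hg : 0 < g) (hω : 0 < ω) (hδ : 0 < δ) (ha : 0 < a) (hu₀ : 0 < u₀) (hK : 0 < K)
    (hb : ∀ u : ℝ, 0 < u → 0 < b u)
    (hb_top : Tendsto (fun u : ℝ => u * b u / Real.log u) atTop atTop) :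
    ∃ C : ℝ, 0 < C ∧
      ∀ (n p : ℕ) {𝓨 : Type*} [MeasurableSpace 𝓨] {Ω : Type*} [MeasurableSpace Ω]
        (P : Measure 𝓨) [IsProbabilityMeasure P] (Pr : Measure Ω) [IsProbabilityMeasure Pr]
        (Y : Fin n → Ω → 𝓨) (Θ : Set (PenML.Vec p)) (ℓ : 𝓨 → PenML.Vec p → ℝ)
        (G v₀ : PenML.Mat p) (θs : PenML.Vec p) (x : ℝ),
        -- the observations are i.i.d. with law `P`
        (∀ i, Measurable (Y i)) → (∀ i, Measure.map (Y i) Pr = P) → iIndepFun Y Pr →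
        PenML.IIDConditions Θ P ℓ n G v₀ θs ν g ω δ a u₀ b →
        0 < x →
        -- sample size
        PenML.effDim n G v₀ P ℓ θs + x ≤ K * n →
        PenML.penEntropy n G v₀ P ℓ θs ≤ K * √(n * (PenML.effDim n G v₀ P ℓ θs + x)) →
        ∃ A : Set Ω, MeasurableSet A ∧ ENNReal.ofReal (1 - 2 * Real.exp (-x)) ≤ Pr A ∧
          ∀ s ∈ A, ∀ θt ∈ Θ, IsMaxOn (PenML.penLogLik G ℓ (fun i => Y i s)) Θ θt →
            ‖PenML.op (PenML.rootInfo n G P ℓ θs) (θt - θs)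
                - PenML.xiG G P ℓ θs (fun i => Y i s)‖
              ≤ C * √((PenML.effDim n G v₀ P ℓ θs + x) ^ 2 / n) ∧
            |√(2 * (PenML.penLogLik G ℓ (fun i => Y i s) θt
                  - PenML.penLogLik G ℓ (fun i => Y i s) θs))
                - ‖PenML.xiG G P ℓ θs (fun i => Y i s)‖|
              ≤ C * √((PenML.effDim n G v₀ P ℓ θs + x) ^ 2 / n) ∧
            |2 * (PenML.penLogLik G ℓ (fun i => Y i s) θt
                  - PenML.penLogLik G ℓ (fun i => Y i s) θs)
                - ‖PenML.xiG G P ℓ θs (fun i => Y i s)‖ ^ 2|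
              ≤ C * √((PenML.effDim n G v₀ P ℓ θs + x) ^ 3 / n) := by
  set A₀ := 1 / a with hA₀
  set B₀ := K / a with hB₀
  set Cz := a * PenML.devConst ν g K A₀ B₀ with hCz
  set Cg := 2 * ω * a ^ 2 * PenML.devConst ν g K (2 * A₀) (2 * B₀) with hCg
  have hA₀0 : 0 < A₀ := by positivity
  have hB₀0 : 0 < B₀ := by positivity
  have hdev := PenML.devConst_pos (K := K) hν hg hA₀0.le hB₀0.le
  have hdev2 := PenML.devConst_pos (K := K) hν hg (A := 2 * A₀) (B := 2 * B₀)
    (by positivity) (by positivity)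
  have hCz0 : 0 < Cz := by positivity
  have hCg0 : 0 < Cg := by positivity
  -- The summand 1 makes the growth inequality strict, and u₁ ≥ e ensures log u ≥ 1 beyond u₁.
  obtain ⟨u₁, hu₁⟩ := (((hb_top.eventually_ge_atTop (4 * Cz * (√K + 5) + 1)).and
    (eventually_ge_atTop (Real.exp 1))).exists_forall_of_atTop)
  have hu₁e : Real.exp 1 ≤ u₁ := (hu₁ u₁ le_rfl).2
  have hu₁pos : 0 < u₁ := (Real.exp_pos 1).trans_le hu₁e
  have hbu : ∀ u, u₁ ≤ u → 4 * Cz * (√K + 5) * Real.log u < u * b u := by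
    intro u hu
    have h1 := (hu₁ u hu).1
    have hlog : 1 ≤ Real.log u :=
      (Real.le_log_iff_exp_le (hu₁pos.trans_le hu)).2 (hu₁e.trans hu)
    have h2 := (le_div_iff₀ (by linarith)).1 h1
    linarith
  have hb₁ := hb u₁ hu₁pos
  -- Since q ≥ 1/2, the 2 ensures r₀ ≥ 1 and makes 12 Cz q < b(u₁) r₀ strict; the other term matches
  -- 12 Cz q.
  set C₄ := 2 + 12 * Cz / b u₁ with hC₄
  have hC₄0 : 0 < C₄ := by positivity
  set C := (5 * (Cg * C₄ + δ * C₄ ^ 2) + (C₄ + Cz + √(2 * Cz * C₄)) * (C₄ / u₀))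
      * (1 + √(2 * Cz * C₄) + Cz) with hC
  refine ⟨C, by positivity, ?_⟩
  intro n p 𝓨 _ Ω _ P _ Pr _ Y Θ ℓ G v₀ θs x hY hmap hind h hx hsize hent
  -- For x < 1/2 the required probability is nonpositive and the empty event serves. Otherwise q ≥
  -- 1/2.
  rcases lt_or_ge x (1 / 2) with hxs | hxs
  · refine ⟨∅, MeasurableSet.empty, ?_, fun s hs => absurd hs (by simp)⟩
    have h1 : 1 - 2 * Real.exp (-x) ≤ 0 := by linarith [Real.add_one_le_exp (-x)]
    rw [ENNReal.ofReal_of_nonpos h1]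
    exact zero_le
  set d := PenML.effDim n G v₀ P ℓ θs with hd
  set E := PenML.penEntropy n G v₀ P ℓ θs with hE
  have hd0' : 0 < n → 0 ≤ d := by
    intro hn
    obtain ⟨e, s, hs⟩ := PenML.exists_spectralData h hn ha
    rw [hd, ← hs.sum_sq_eq]
    positivity
  have hn : 0 < n := by
    rcases Nat.eq_zero_or_pos n with rfl | hn
    -- For n = 0 the effective dimension vanishes, and the size condition would force x ≤ 0.
    · exfalso
      have : d = 0 := by rw [hd]; simp [PenML.effDim, PenML.matB]
      rw [this] at hsize
      norm_num at hsize
      linarith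
    · exact hn
  have hd0 := hd0' hn
  obtain ⟨e, s, hs⟩ := PenML.exists_spectralData h hn ha
  have hnR : (0 : ℝ) < n := by exact_mod_cast hn
  have hN1 : 1 ≤ √(n : ℝ) := Real.one_le_sqrt.2 (by exact_mod_cast hn)
  set N := √(n : ℝ) with hN
  have hNpos : 0 < N := by linarith
  set q := √(d + x) with hq
  have hqq : q ^ 2 = d + x := Real.sq_sqrt (by linarith)
  have hq2 : 1 / 2 ≤ q := Real.le_sqrt_of_sq_le (by linarith)
  have hq0 : 0 < q := by linarith
  have hqN : q ≤ √K * N := by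
    rw [hq, hN, ← Real.sqrt_mul hK.le]
    exact Real.sqrt_le_sqrt hsize
  have hE' : E ≤ K * (N * q) := by rwa [hq, hN, ← Real.sqrt_mul hnR.le]
  have hEa : E / a ≤ B₀ * (N * q) := by
    rw [hB₀, div_mul_eq_mul_div]; gcongr
  have hda : d / a ^ 2 ≤ (A₀ * q) ^ 2 := by
    rw [mul_pow, hqq, hA₀, div_pow, one_pow, one_div_mul_eq_div]; gcongr; linarith
  have hchain : ∀ m : ℝ, 0 ≤ m → PenML.chainBound ν g n (d / a ^ 2) (E / a) (x + m + 3)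
      ≤ PenML.devConst ν g K A₀ B₀ * (q + m) := fun m hm =>
    PenML.chainBound_le hν hg hn hA₀0.le hB₀0.le hq2 (by linarith) hqN hm hda hEa
  have hchain2 : PenML.chainBound ν g n (2 * (d / a ^ 2)) (2 * (E / a)) (x + 0 + 3)
      ≤ PenML.devConst ν g K (2 * A₀) (2 * B₀) * (q + 0) := by
    refine PenML.chainBound_le hν hg hn (by positivity) (by positivity) hq2 (by linarith) hqN le_rfl
      ?_ (by linarith)
    have : (2 * A₀ * q) ^ 2 = 4 * (A₀ * q) ^ 2 := by ring
    rw [this]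
    linarith [sq_nonneg (A₀ * q)]
  set r₀ := C₄ * q with hr₀
  have hr₀1 : 1 ≤ r₀ := by
    have : 0 ≤ 12 * Cz / b u₁ * q := by positivity
    rw [hr₀, hC₄]; linarith
  have hr₀pos : 0 < r₀ := by linarith
  have hr₀b : 12 * Cz * q < b u₁ * r₀ := by
    have h1 : b u₁ * r₀ = 2 * (b u₁ * q) + 12 * Cz * q := by rw [hr₀, hC₄]; field_simp
    have : 0 < b u₁ * q := by positivity
    linarith
  have hrk : ∀ k : ℕ, 0 < 2 ^ k * r₀ := fun k => by positivity
  -- The gradient is controlled only if the vicinity of radius r₀ lies in the local zone; otherwise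
  -- the third bad set is empty.
  obtain ⟨A, hA, hprob, hgood⟩ := PenML.exists_good_event (Pr := Pr) (x := x) _ _
    (if r₀ ≤ u₀ * N then _ else ∅)
    (fun k => PenML.zeta_deviation h hs hY hmap hind hν hg ha hu₀ hn (hrk k)
      (y := x + k + 3) (by positivity))
    (PenML.score_deviation h hs hY hmap hind hν hg ha hu₀ hn (y := x + 0 + 3) (by positivity))
    (by
      split_ifs with hru
      · exact PenML.gradient_deviation h hs hY hmap hind hν hg hω ha hn hr₀pos hru
          (y := x + 0 + 3) (by positivity)
      · simp)
  refine ⟨A, hA, hprob, fun w hw θt hθt hmax => ?_⟩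
  obtain ⟨hZ, hS, hU⟩ := hgood w hw
  set ys : Fin n → 𝓨 := fun i => Y i w with hys
  have hz : ∀ k : ℕ, ∀ θ ∈ Θ, ‖PenML.op (PenML.rootInfo n G P ℓ θs) (θ - θs)‖ ≤ 2 ^ k * r₀ →
      |PenML.zeta P ℓ ys θ - PenML.zeta P ℓ ys θs| ≤ Cz * (q + k) * (2 ^ k * r₀) := by
    intro k θ hθ hθr
    refine h.zeta_bound_extend hu₀ ys (fun θ hθ hθr => ?_) hθ hθr
    by_contra! hlt
    refine hZ k ⟨θ, hθ, hθr, lt_of_le_of_lt ?_ hlt⟩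
    calc 2 ^ k * r₀ * a * PenML.chainBound ν g n (d / a ^ 2) (E / a) (x + k + 3)
        ≤ 2 ^ k * r₀ * a * (PenML.devConst ν g K A₀ B₀ * (q + k)) := by
          gcongr
          exact hchain k (Nat.cast_nonneg k)
      _ = _ := by rw [hCz]; ring
  have hnorm := h.norm_le_radius ys hCz0 hq2 hn hqN hu₁e hbu hb₁ hr₀1 hr₀b hz hθt hmax
  have hξ : ‖PenML.xiG G P ℓ θs ys‖ ≤ Cz * q := by
    refine h.norm_xiG_le hn ha ys (by positivity) fun γ hγ => ?_
    by_contra! hlt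
    refine hS ⟨γ, hγ, lt_of_le_of_lt ?_ hlt⟩
    calc a * PenML.chainBound ν g n (d / a ^ 2) (E / a) (x + 0 + 3)
        ≤ a * (PenML.devConst ν g K A₀ B₀ * (q + 0)) := by
          gcongr
          exact hchain 0 le_rfl
      _ = _ := by rw [hCz]; ring
  have hLmax : PenML.penLogLik G ℓ ys θs ≤ PenML.penLogLik G ℓ ys θt := hmax h.target_mem
  have hL0 : 0 ≤ 2 * (PenML.penLogLik G ℓ ys θt - PenML.penLogLik G ℓ ys θs) := by linarith
  -- The target maximizes the mean, so the gain in L_G is at most the gain in ζ, which slice 0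
  -- bounds.
  have hLle : 2 * (PenML.penLogLik G ℓ ys θt - PenML.penLogLik G ℓ ys θs)
      ≤ 2 * (Cz * q * r₀) := by
    have h1 := (le_abs_self _).trans (hz 0 θt hθt (by simpa using hnorm))
    have h2 : PenML.meanPenLogLik n G P ℓ θt ≤ PenML.meanPenLogLik n G P ℓ θs := h.target_max hθt
    rw [PenML.penLogLik_eq G P]
    norm_num at h1
    linarith
  have hconc := PenML.conclusion_of_bounds (N := N) hq2 hNpos hu₀ hCz0 hCg0 hδ hC₄0 hr₀ hL0
    (norm_nonneg _) hξ hnorm (norm_sub_le _ _) hLle (fun hru => ?_) hC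
  · have h2 : √((d + x) ^ 2 / n) = q ^ 2 / N := by
      rw [← hqq, Real.sqrt_div (by positivity), Real.sqrt_sq (by positivity)]
    have h3 : √((d + x) ^ 3 / n) = q ^ 3 / N := by
      have : (q ^ 2) ^ 3 = (q ^ 3) ^ 2 := by ring
      rw [← hqq, Real.sqrt_div (by positivity), this, Real.sqrt_sq (by positivity)]
    rw [h2, h3]
    exact hconc
  · rw [if_pos hru] at hU
    have hη : ∀ θ γ : PenML.Vec p, ‖PenML.op (PenML.rootInfo n G P ℓ θs) (θ - θs)‖ ≤ r₀ →
        ‖γ‖ ≤ 1 →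
        |fderiv ℝ (PenML.zeta P ℓ ys) θ (PenML.op (PenML.rootInfo n G P ℓ θs)⁻¹ γ)
          - fderiv ℝ (PenML.zeta P ℓ ys) θs (PenML.op (PenML.rootInfo n G P ℓ θs)⁻¹ γ)|
          ≤ Cg * r₀ / N * q := by
      intro θ γ hθ hγ
      by_contra! hlt
      refine hU ⟨θ, γ, hθ, hγ, lt_of_le_of_lt ?_ hlt⟩
      calc 2 * ω * a ^ 2 * r₀ / N
            * PenML.chainBound ν g n (2 * (d / a ^ 2)) (2 * (E / a)) (x + 0 + 3)
          ≤ 2 * ω * a ^ 2 * r₀ / N * (PenML.devConst ν g K (2 * A₀) (2 * B₀) * (q + 0)) := by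
            gcongr
        _ = _ := by rw [hCg]; ring
    exact h.fisher_wilks hn ha hru ys (by positivity)
      (fun θ e hθ => h.fderiv_penLogLik_approx hn ha hu₀ hr₀pos hru ys hη hθ e) hmax hnorm
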